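/- A bimatrix game with $m_1,m_2\ge 1$ actions is given by two real $m_1\times m_2$ arrays $u_1,u_2$, the utilities of the two players; for mixed strategies $x=(x_1,x_2)$ put $v_i(x)=\sum_{a,b}u_i(a,b)\,x_1(a)\,x_2(b)$. A strong Nash equilibrium is a Nash equilibrium $x$ in mixed strategies such that no nonempty coalition $C\subseteq\{1,2\}$ has a joint deviation in mixed strategies $y$ (with $y_i=x_i$ for $i\notin C$) with $v_i(y)>v_i(x)$ for all $i\in C$. Computations are carried out on a real RAM: a fixed finite program, using rational constants only, works for all sizes; it operates exactly on real numbers by field operations and comparisons, uses indices in $\mathbb N$ with addition, truncated subtraction and comparison for addressing arrays, and each elementary operation takes one unit of time. A problem about bimatrix games is in Smoothed-P if there are such a program $M$, which on every bimatrix game halts with a correct answer, and a polynomial $p$ such that for all $m_1,m_2\ge1$, every bimatrix game $(u_1,u_2)$ with these numbers of actions and every $\sigma>0$, $$\mathbb E\big[\mathrm{time}_M(u_1+\omega_1,\;u_2+\omega_2)\big]\le p(m_1,m_2),$$ where the $2m_1m_2$ entries of $\omega_1,\omega_2$ are independent and uniformly distributed on $[-\sigma,\sigma]$. Theorem. The problem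 of finding a strong Nash equilibrium of a bimatrix game (that is, of returning a strong Nash equilibrium if there is one, and of reporting non-existence otherwise) is in Smoothed-P. So is the problem of deciding whether a bimatrix game has a strong Nash equilibrium. -/

import Mathlib

open MeasureTheory ProbabilityTheory

/-! ### Bimatrix games and strong Nash equilibria -/

/-- A bimatrix game with `m₁` actions for the first and `m₂` actions for the second player:
`U (i, a, b)` is the utility of player `i` when the first player chooses `a` and the second
player chooses `b`. Thus `U (0, a, b)` are the entries of the matrix of the first player, and
`U (1, a, b)` those of the (transposed) matrix of the second player. -/
abbrev BimatrixGame (m₁ m₂ : ℕ) : Type := Fin 2 × Fin m₁ × Fin m₂ → ℝ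

/-- A pair of vectors, one for each player. -/
abbrev Profile (m₁ m₂ : ℕ) : Type := (Fin m₁ → ℝ) × (Fin m₂ → ℝ)

namespace BimatrixGame

variable {m₁ m₂ : ℕ}

/-- Both components are mixed strategies. -/
def IsMixed (x : Profile m₁ m₂) : Prop :=
  x.1 ∈ stdSimplex ℝ (Fin m₁) ∧ x.2 ∈ stdSimplex ℝ (Fin m₂)

/-- The expected utility of player `i`. -/
def payoff (U : BimatrixGame m₁ m₂) (i : Fin 2) (x : Profile m₁ m₂) : ℝ :=
  ∑ a, ∑ b, U (i, a, b) * x.1 a * x.2 b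

/-- No player can gain by a unilateral deviation to another mixed strategy. -/
def IsNash (U : BimatrixGame m₁ m₂) (x : Profile m₁ m₂) : Prop :=
  IsMixed x ∧
    (∀ y₁ ∈ stdSimplex ℝ (Fin m₁), payoff U 0 (y₁, x.2) ≤ payoff U 0 x) ∧
    (∀ y₂ ∈ stdSimplex ℝ (Fin m₂), payoff U 1 (x.1, y₂) ≤ payoff U 1 x)

/-- `y` is a joint deviation of the coalition `C` from `x`: the players outside `C` do not
change their strategies. -/
def IsDeviation (C : Finset (Fin 2)) (x y : Profile m₁ m₂) : Prop :=
  IsMixed y ∧ (0 ∉ C → y.1 = x.1) ∧ (1 ∉ C → y.2 = x.2)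

/-- `x` is weakly Pareto efficient for the coalition `C`: no joint deviation of `C` makes every
member of `C` strictly better off. -/
def IsWeaklyEfficientFor (U : BimatrixGame m₁ m₂) (C : Finset (Fin 2))
    (x : Profile m₁ m₂) : Prop :=
  ¬ ∃ y, IsDeviation C x y ∧ ∀ i ∈ C, payoff U i x < payoff U i y

/-- A strong Nash equilibrium: a Nash equilibrium (in mixed strategies) which is weakly Pareto
efficient for every coalition. -/
def IsStrongNash (U : BimatrixGame m₁ m₂) (x : Profile m₁ m₂) : Prop :=
  IsNash U x ∧ ∀ C : Finset (Fin 2), C.Nonempty → IsWeaklyEfficientFor U C x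

end BimatrixGame

/-! ### The machine model: a real RAM with unit costs

The memory consists of index registers, which hold natural numbers, and of two-dimensional arrays
of real numbers. A program is a finite `while` program; it is the same for inputs of
all sizes. Reals are processed exactly, by the field operations and by comparisons; index
registers by addition, truncated subtraction and comparisons. Every elementary operation,
memory access, comparison and assignment takes one unit of time. -/

namespace RealRAM

structure State where
  /-- the index registers -/
  idx : ℕ → ℕ
  /-- `arr a i j` is the entry in position `(i, j)` of the array with number `a` -/
  arr : ℕ → ℕ → ℕ → ℝ

/-- Index expressions. -/
inductive IExpr where
  | const (n : ℕ)
  | reg (k : ℕ)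
  | add (e f : IExpr)
  | sub (e f : IExpr)

def IExpr.eval (s : State) : IExpr → ℕ
  | .const n => n
  | .reg k => s.idx k
  | .add e f => e.eval s + f.eval s
  | .sub e f => e.eval s - f.eval s

def IExpr.cost : IExpr → ℕ
  | .const _ => 1
  | .reg _ => 1
  | .add e f => e.cost + f.cost + 1
  | .sub e f => e.cost + f.cost + 1

/-- Real expressions. Only rational constants may be built into a program. -/
inductive RExpr where
  | const (q : ℚ)
  | load (a : ℕ) (i j : IExpr)
  | add (e f : RExpr)
  | sub (e f : RExpr)
  | mul (e f : RExpr)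
  | div (e f : RExpr)

/-- Division by zero returns zero (a program can always test the denominator first). -/
noncomputable def RExpr.eval (s : State) : RExpr → ℝ
  | .const q => (q : ℝ)
  | .load a i j => s.arr a (i.eval s) (j.eval s)
  | .add e f => e.eval s + f.eval s
  | .sub e f => e.eval s - f.eval s
  | .mul e f => e.eval s * f.eval s
  | .div e f => e.eval s / f.eval s

def RExpr.cost : RExpr → ℕ
  | .const _ => 1
  | .load _ i j => i.cost + j.cost + 1
  | .add e f => e.cost + f.cost + 1
  | .sub e f => e.cost + f.cost + 1
  | .mul e f => e.cost + f.cost + 1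
  | .div e f => e.cost + f.cost + 1

/-- Tests, for branching and for loops. -/
inductive Test where
  | idxLt (e f : IExpr)
  | realLt (e f : RExpr)
  | not (b : Test)
  | and (b c : Test)

def Test.Holds (s : State) : Test → Prop
  | .idxLt e f => e.eval s < f.eval s
  | .realLt e f => e.eval s < f.eval s
  | .not b => ¬ b.Holds s
  | .and b c => b.Holds s ∧ c.Holds s

def Test.cost : Test → ℕ
  | .idxLt e f => e.cost + f.cost + 1
  | .realLt e f => e.cost + f.cost + 1
  | .not b => b.cost + 1
  | .and b c => b.cost + c.cost + 1

/-- Programs: `setIdx k e` puts the value of `e` into the index register `k`, `setArr a i j e`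
puts it into position `(i, j)` of the array `a`, `branch b c d` is `if b then c else d`, and
`loop b c` is `while b do c`. -/
inductive Program where
  | skip
  | setIdx (k : ℕ) (e : IExpr)
  | setArr (a : ℕ) (i j : IExpr) (e : RExpr)
  | seq (c d : Program)
  | branch (b : Test) (c d : Program)
  | loop (b : Test) (c : Program)

def State.writeIdx (s : State) (k n : ℕ) : State :=
  { s with idx := fun k' => if k' = k then n else s.idx k' }

def State.writeArr (s : State) (a i j : ℕ) (r : ℝ) : State :=
  { s with arr := fun a' i' j' => if a' = a ∧ i' = i ∧ j' = j then r else s.arr a' i' j' }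

/-- `Run c s t s'`: started in the state `s`, the program `c` halts in the state `s'` after
exactly `t` units of time. -/
inductive Run : Program → State → ℕ → State → Prop where
  | skip (s : State) : Run .skip s 1 s
  | setIdx (k : ℕ) (e : IExpr) (s : State) :
      Run (.setIdx k e) s (e.cost + 1) (s.writeIdx k (e.eval s))
  | setArr (a : ℕ) (i j : IExpr) (e : RExpr) (s : State) :
      Run (.setArr a i j e) s (i.cost + j.cost + e.cost + 1)
        (s.writeArr a (i.eval s) (j.eval s) (e.eval s))
  | seq {c d : Program} {s s' s'' : State} {t t' : ℕ} :
      Run c s t s' → Run d s' t' s'' → Run (.seq c d) s (t + t') s''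
  | branch_true {b : Test} {c d : Program} {s s' : State} {t : ℕ} :
      b.Holds s → Run c s t s' → Run (.branch b c d) s (b.cost + t) s'
  | branch_false {b : Test} {c d : Program} {s s' : State} {t : ℕ} :
      ¬ b.Holds s → Run d s t s' → Run (.branch b c d) s (b.cost + t) s'
  | loop_true {b : Test} {c : Program} {s s' s'' : State} {t t' : ℕ} :
      b.Holds s → Run c s t s' → Run (.loop b c) s' t' s'' →
      Run (.loop b c) s (b.cost + t + t') s''
  | loop_false {b : Test} {c : Program} {s : State} :
      ¬ b.Holds s → Run (.loop b c) s b.cost s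

/-- Programs are deterministic: the running time and the final state are unique. -/
theorem Run.unique {c : Program} {s s₁ s₂ : State} {t₁ t₂ : ℕ}
    (h₁ : Run c s t₁ s₁) (h₂ : Run c s t₂ s₂) : t₁ = t₂ ∧ s₁ = s₂ := by
  induction h₁ generalizing t₂ s₂ with
  | skip s => cases h₂; exact ⟨rfl, rfl⟩
  | setIdx k e s => cases h₂; exact ⟨rfl, rfl⟩
  | setArr a i j e s => cases h₂; exact ⟨rfl, rfl⟩
  | seq _ _ ih ih' =>
    cases h₂ with
    | seq g g' =>
      obtain ⟨rfl, rfl⟩ := ih g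
      obtain ⟨rfl, rfl⟩ := ih' g'
      exact ⟨rfl, rfl⟩
  | branch_true hb _ ih =>
    cases h₂ with
    | branch_true _ g =>
      obtain ⟨rfl, rfl⟩ := ih g
      exact ⟨rfl, rfl⟩
    | branch_false hb' _ => exact absurd hb hb'
  | branch_false hb _ ih =>
    cases h₂ with
    | branch_true hb' _ => exact absurd hb' hb
    | branch_false _ g =>
      obtain ⟨rfl, rfl⟩ := ih g
      exact ⟨rfl, rfl⟩
  | loop_true hb _ _ ih ih' =>
    cases h₂ with
    | loop_true _ g g' =>
      obtain ⟨rfl, rfl⟩ := ih g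
      obtain ⟨rfl, rfl⟩ := ih' g'
      exact ⟨rfl, rfl⟩
    | loop_false hb' => exact absurd hb hb'
  | loop_false hb =>
    cases h₂ with
    | loop_true hb' _ _ => exact absurd hb' hb
    | loop_false _ => exact ⟨rfl, rfl⟩

open scoped ENNReal in
/-- The running time of `c` from the state `s`; it is `∞` if `c` does not halt. (By `Run.unique`
the infimum is over at most one number.) -/
noncomputable def time (c : Program) (s : State) : ℝ≥0∞ :=
  ⨅ (t : ℕ) (s' : State) (_ : Run c s t s'), (t : ℝ≥0∞)

/-- The initial state for the game `U`: the index registers `0` and `1` hold the numbers of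
actions, the arrays `0` and `1` the utilities of the two players; all else is zero. -/
noncomputable def initial {m₁ m₂ : ℕ} (U : BimatrixGame m₁ m₂) : State where
  idx k := if k = 0 then m₁ else if k = 1 then m₂ else 0
  arr p a b :=
    if h : p < 2 ∧ a < m₁ ∧ b < m₂ then U (⟨p, h.1⟩, ⟨a, h.2.1⟩, ⟨b, h.2.2⟩) else 0

/-- The output of a yes/no program: register `0` tells. -/
def readBool (_ _ : ℕ) (s : State) : Bool := decide (s.idx 0 ≠ 0)

/-- The output of a program that looks for a strategy profile: register `0` tells whether there
is one; if so, rows `0` and `1` of the array `2` contain the strategies of the two players. -/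
def readProfile (m₁ m₂ : ℕ) (s : State) : Option (Profile m₁ m₂) :=
  if s.idx 0 ≠ 0 then some (fun a => s.arr 2 0 a, fun b => s.arr 2 1 b) else none

end RealRAM

/-! ### Smoothed polynomial time -/

/-- The law of independent perturbations of all entries, each uniformly distributed on
`[-σ, σ]`. -/
noncomputable def uniformNoise (m₁ m₂ : ℕ) (σ : ℝ) : Measure (Fin 2 × Fin m₁ × Fin m₂ → ℝ) :=
  Measure.pi fun _ => cond volume (Set.Icc (-σ) σ)

open scoped ENNReal in
/-- The problem of computing, for a bimatrix game `U` (with at least one action for each player),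
an answer that is correct for `U` is in Smoothed-P: there is a real-RAM program that halts with a
correct answer on every game, and whose expected running time, after each of the entries of an
arbitrary game has been perturbed independently and uniformly in `[-σ, σ]`, is at most a
polynomial in the numbers of actions `m₁` and `m₂`. (The running time is a measurable function of
the game, as the set of games with a given course of the computation is described by rational
inequalities, and there are only countably many such courses.) -/
def InSmoothedP {Ans : ℕ → ℕ → Type} (read : ∀ m₁ m₂ : ℕ, RealRAM.State → Ans m₁ m₂)
    (Correct : ∀ m₁ m₂ : ℕ, BimatrixGame m₁ m₂ → Ans m₁ m₂ → Prop) : Prop :=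
  ∃ c : RealRAM.Program,
    (∀ m₁ m₂ : ℕ, 1 ≤ m₁ → 1 ≤ m₂ → ∀ U : BimatrixGame m₁ m₂,
      ∃ (t : ℕ) (s : RealRAM.State),
        RealRAM.Run c (RealRAM.initial U) t s ∧ Correct m₁ m₂ U (read m₁ m₂ s)) ∧
    ∃ p : MvPolynomial (Fin 2) ℕ,
      ∀ m₁ m₂ : ℕ, 1 ≤ m₁ → 1 ≤ m₂ → ∀ (U : BimatrixGame m₁ m₂) (σ : ℝ), 0 < σ →
        ∫⁻ ω, RealRAM.time c (RealRAM.initial (U + ω)) ∂(uniformNoise m₁ m₂ σ) ≤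
          ((MvPolynomial.eval ![m₁, m₂] p : ℕ) : ℝ≥0∞)

/-- An answer to the problem of finding a strong Nash equilibrium is correct if it is a strong
Nash equilibrium, or if it is `none` and the game has no strong Nash equilibrium. -/
def FindsStrongNash (m₁ m₂ : ℕ) (U : BimatrixGame m₁ m₂) : Option (Profile m₁ m₂) → Prop
  | some x => U.IsStrongNash x
  | none => ¬ ∃ x, U.IsStrongNash x

/-- An answer to the problem of deciding whether there is a strong Nash equilibrium is correct
if it is `true` precisely when there is one. -/
def DecidesStrongNash (m₁ m₂ : ℕ) (U : BimatrixGame m₁ m₂) (answer : Bool) : Prop :=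
  answer = true ↔ ∃ x, U.IsStrongNash x

/-! A single player cannot improve on a Nash equilibrium, so a Nash equilibrium is strong exactly
when no mixed profile gives both players strictly more (`isStrongNash_iff`). Three facts about this
condition carry the theorem.

Verification is polynomial. If a nonnegative combination of planar vectors lies in the open positive
quadrant, then one or two of them already suffice (`exists_pair_of_sum_pos`). Applied to payoff
surpluses, first over columns and then over rows, this shows that a joint improvement, if there is
one, can use at most two actions per player (`exists_improvement_iff`). For fixed rows and columns
the weight of the columns is eliminated by a determinant; two affine inequalities and one quadratic
inequality in the weight of the rows remain. They are decided by a constant number of rational test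
points, without square roots (`exists_pos_iff_testPoints`).

In a generic game every strong Nash equilibrium is pure (`IsGeneric.exists_eq_single`). If only one
player mixes, two payoffs in a row or column coincide. If both mix, bilinearity leaves a
second-order term which, for a nonzero minor, can be steered so that both players gain
(`not_isStrongNash_of_supports`). The generic games are given by polynomially many polynomial
conditions, each of which holds almost surely after perturbation (`ae_isGeneric`). Hence it almost
surely suffices to check all pure profiles and to test genericity, and both take polynomial time.

On degenerate games the program must still halt with a correct answer. The strategies of a strong
Nash equilibrium can be moved to vertices of the polyhedra of best-reply conditions without losing
tight constraints or payoff (`IsStrongNash.exists_derivedValues`). By elimination, the coordinates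
of a vertex arise from the payoffs in boundedly many rounds of `a - b * c / d`, so a finite list of
candidates is searched. The time this takes is irrelevant, because the degenerate games form a null
set.

Time bounds in `Spec` lie in `ℕ∞`: a finite bound is used for the polynomial parts, and `⊤`
expresses mere termination for the exhaustive search. -/

/-! ### A program logic with running times -/

namespace RealRAM

/-- Started in `s`, the program `c` halts within `T` units of time in a state that satisfies `Q`. -/
def Spec (c : Program) (s : State) (T : ℕ∞) (Q : State → Prop) : Prop :=
  ∃ (t : ℕ) (s' : State), Run c s t s' ∧ (t : ℕ∞) ≤ T ∧ Q s'

/-- The program `c` contains an assignment to the index register `k`. -/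
def Program.ModIdx : Program → ℕ → Prop
  | .skip, _ => False
  | .setIdx k' _, k => k = k'
  | .setArr _ _ _ _, _ => False
  | .seq c d, k => c.ModIdx k ∨ d.ModIdx k
  | .branch _ c d, k => c.ModIdx k ∨ d.ModIdx k
  | .loop _ c, k => c.ModIdx k

/-- The program `c` contains an assignment to the array `a`. -/
def Program.ModArr : Program → ℕ → Prop
  | .skip, _ => False
  | .setIdx _ _, _ => False
  | .setArr a' _ _ _, a => a = a'
  | .seq c d, a => c.ModArr a ∨ d.ModArr a
  | .branch _ c d, a => c.ModArr a ∨ d.ModArr a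
  | .loop _ c, a => c.ModArr a

theorem Run.idx_eq {c : Program} {s s' : State} {t : ℕ} (h : Run c s t s') {k : ℕ}
    (hk : ¬ c.ModIdx k) : s'.idx k = s.idx k := by
  induction h with
  | skip => rfl
  | setIdx k' e s => simp only [Program.ModIdx] at hk; simp [State.writeIdx, hk]
  | setArr => rfl
  | seq _ _ ih ih' =>
    simp only [Program.ModIdx, not_or] at hk
    rw [ih' hk.2, ih hk.1]
  | branch_true _ _ ih => simp only [Program.ModIdx, not_or] at hk; exact ih hk.1
  | branch_false _ _ ih => simp only [Program.ModIdx, not_or] at hk; exact ih hk.2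
  | loop_true _ _ _ ih ih' => rw [ih' hk, ih hk]
  | loop_false => rfl

theorem Run.arr_eq {c : Program} {s s' : State} {t : ℕ} (h : Run c s t s') {a : ℕ}
    (ha : ¬ c.ModArr a) : s'.arr a = s.arr a := by
  induction h with
  | skip => rfl
  | setIdx => rfl
  | setArr a' i j e s => simp only [Program.ModArr] at ha; simp [State.writeArr, ha]
  | seq _ _ ih ih' =>
    simp only [Program.ModArr, not_or] at ha
    rw [ih' ha.2, ih ha.1]
  | branch_true _ _ ih => simp only [Program.ModArr, not_or] at ha; exact ih ha.1
  | branch_false _ _ ih => simp only [Program.ModArr, not_or] at ha; exact ih ha.2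
  | loop_true _ _ _ ih ih' => rw [ih' ha, ih ha]
  | loop_false => rfl

@[simp] theorem State.writeIdx_idx (s : State) (k n k' : ℕ) :
    (s.writeIdx k n).idx k' = if k' = k then n else s.idx k' := rfl

@[simp] theorem State.writeIdx_arr (s : State) (k n : ℕ) : (s.writeIdx k n).arr = s.arr := rfl

@[simp] theorem State.writeArr_idx (s : State) (a i j : ℕ) (r : ℝ) :
    (s.writeArr a i j r).idx = s.idx := rfl

theorem State.writeArr_arr (s : State) (a i j a' i' j' : ℕ) (r : ℝ) :
    (s.writeArr a i j r).arr a' i' j' =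
      if a' = a ∧ i' = i ∧ j' = j then r else s.arr a' i' j' := rfl

theorem State.writeArr_arr_of_ne (s : State) {a a' : ℕ} (i j : ℕ) (r : ℝ) (h : a' ≠ a) :
    (s.writeArr a i j r).arr a' = s.arr a' := by
  simp [State.writeArr, h]

namespace Spec

variable {c d : Program} {s : State} {T T' : ℕ∞} {Q Q' : State → Prop}

theorem mono (h : Spec c s T Q) (hT : T ≤ T') (hQ : ∀ s', Q s' → Q' s') : Spec c s T' Q' := by
  obtain ⟨t, s', hr, ht, hq⟩ := h
  exact ⟨t, s', hr, ht.trans hT, hQ s' hq⟩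

theorem imp (h : Spec c s T Q) (hQ : ∀ s', Q s' → Q' s') : Spec c s T Q' := h.mono le_rfl hQ

/-- What the program does not assign to is unchanged. -/
theorem frame (h : Spec c s T Q) : Spec c s T fun s' => Q s' ∧
    (∀ k, ¬ c.ModIdx k → s'.idx k = s.idx k) ∧ ∀ a, ¬ c.ModArr a → s'.arr a = s.arr a := by
  obtain ⟨t, s', hr, ht, hq⟩ := h
  exact ⟨t, s', hr, ht, hq, fun k hk => hr.idx_eq hk, fun a ha => hr.arr_eq ha⟩

theorem skip (h : Q s) : Spec .skip s 1 Q := ⟨1, s, .skip s, by simp, h⟩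

theorem setIdx {k : ℕ} {e : IExpr} (h : Q (s.writeIdx k (e.eval s))) :
    Spec (.setIdx k e) s (e.cost + 1) Q := ⟨_, _, .setIdx k e s, by simp, h⟩

theorem setArr {a : ℕ} {i j : IExpr} {e : RExpr}
    (h : Q (s.writeArr a (i.eval s) (j.eval s) (e.eval s))) :
    Spec (.setArr a i j e) s (i.cost + j.cost + e.cost + 1) Q :=
  ⟨_, _, .setArr a i j e s, by simp, h⟩

/-- The intermediate assertion is itself a `Spec`, in the style of weakest preconditions, so
programs are verified by symbolic execution without naming assertions between commands. -/
theorem seq (h : Spec c s T fun s' => Spec d s' T' Q) : Spec (.seq c d) s (T + T') Q := by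
  obtain ⟨t, s', hr, ht, t', s'', hr', ht', hq⟩ := h
  exact ⟨t + t', s'', .seq hr hr', by push_cast; exact add_le_add ht ht', hq⟩

theorem branch {b : Test} (h₁ : b.Holds s → Spec c s T Q) (h₂ : ¬ b.Holds s → Spec d s T' Q) :
    Spec (.branch b c d) s (b.cost + max T T') Q := by
  by_cases hb : b.Holds s
  · obtain ⟨t, s', hr, ht, hq⟩ := h₁ hb
    exact ⟨_, s', .branch_true hb hr, by push_cast; gcongr; exact ht.trans (le_max_left _ _), hq⟩
  · obtain ⟨t, s', hr, ht, hq⟩ := h₂ hb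
    exact ⟨_, s', .branch_false hb hr, by push_cast; gcongr; exact ht.trans (le_max_right _ _), hq⟩

end Spec

/-! ### Counting loops and their invariants -/

/-- `for k < e do c`. -/
def forLoop (k : ℕ) (e : IExpr) (c : Program) : Program :=
  .seq (.setIdx k (.const 0))
    (.loop (.idxLt (.reg k) e) (.seq c (.setIdx k (.add (.reg k) (.const 1)))))

/-- A bound for the running time of `n` rounds of a loop, if the body takes time `T`. -/
def forCost (n : ℕ) (e : IExpr) (T : ℕ∞) : ℕ∞ := n * (T + e.cost + 6) + e.cost + 4

theorem modIdx_forLoop {k k' : ℕ} {e : IExpr} {c : Program} :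
    (forLoop k e c).ModIdx k' ↔ k' = k ∨ c.ModIdx k' := by
  simp only [forLoop, Program.ModIdx]; tauto

theorem modArr_forLoop {k a : ℕ} {e : IExpr} {c : Program} :
    (forLoop k e c).ModArr a ↔ c.ModArr a := by
  simp [forLoop, Program.ModArr]

namespace Spec

variable {c : Program} {s : State} {T : ℕ∞} {k : ℕ} {e : IExpr}

/-- The bound `e` is evaluated anew before every round, so the invariant has to fix its value. The
step asks for the invariant after the counter has been increased, since it may depend on all
registers. -/
theorem forLoop (n : ℕ) (Inv : ℕ → State → Prop) (hk : ¬ c.ModIdx k)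
    (h0 : Inv 0 (s.writeIdx k 0)) (he : ∀ i s', Inv i s' → e.eval s' = n)
    (hstep : ∀ i < n, ∀ s', Inv i s' → s'.idx k = i →
      Spec c s' T fun s'' => Inv (i + 1) (s''.writeIdx k (i + 1))) :
    Spec (forLoop k e c) s (forCost n e T) (Inv n) := by
  -- Induction on the number `j` of remaining rounds. A round costs `e.cost + 2` for the test, `T`
  -- for the body and `4` for the increment; the last, failing test costs `e.cost + 2`.
  have key : ∀ j i s', i + j = n → Inv i s' → s'.idx k = i →
      Spec (.loop (.idxLt (.reg k) e) (.seq c (.setIdx k (.add (.reg k) (.const 1))))) s'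
        (j * (T + e.cost + 6) + e.cost + 2) (Inv n) := by
    intro j
    induction j with
    | zero =>
      intro i s' hi hinv hki
      refine ⟨_, s', .loop_false ?_, ?_, by simpa [← hi] using hinv⟩
      · simp [Test.Holds, IExpr.eval, hki, he i s' hinv, ← hi]
      · simp only [Test.cost, IExpr.cost]; push_cast; simp only [zero_mul, zero_add]
        rw [add_comm (1 : ℕ∞), add_assoc]; norm_num
    | succ j ih =>
      intro i s' hi hinv hki
      obtain ⟨t, s'', hr, ht, hq⟩ := hstep i (by omega) s' hinv hki
      have hk'' : s''.idx k = i := by rw [hr.idx_eq hk, hki]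
      obtain ⟨t', s₃, hr', ht', hq'⟩ := ih (i + 1) _ (by omega) hq (by simp)
      have hset := Run.setIdx k (.add (.reg k) (.const 1)) s''
      simp only [IExpr.eval, hk''] at hset
      refine ⟨_, s₃, .loop_true ?_ (.seq hr hset) hr', ?_, hq'⟩
      · simp [Test.Holds, IExpr.eval, hki, he i s' hinv]; omega
      · simp only [Test.cost, IExpr.cost]
        push_cast
        calc ((1 : ℕ∞) + e.cost + 1) + (t + (1 + 1 + 1 + 1)) + t'
            ≤ (1 + e.cost + 1) + (T + (1 + 1 + 1 + 1)) + (j * (T + e.cost + 6) + e.cost + 2) := by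
              gcongr
          _ = _ := by ring
  refine (Spec.seq (T := 2) (T' := n * (T + e.cost + 6) + e.cost + 2) ?_).mono ?_ (fun _ h => h)
  · refine (Spec.setIdx ?_).mono (by norm_num [IExpr.cost]) (fun _ h => h)
    exact key n 0 _ (by simp) h0 (by simp [IExpr.eval])
  · rw [forCost]; apply le_of_eq; ring

/-- A loop that checks whether `P i` holds for all `i < n`; the outcome is recorded by `φ`. -/
theorem forAll (n : ℕ) (I φ : State → Prop) (P : ℕ → Prop) (hk : ¬ c.ModIdx k)
    (hI : ∀ s i, I s → I (s.writeIdx k i)) (hφ : ∀ s i, φ (s.writeIdx k i) ↔ φ s)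
    (he : ∀ s, I s → e.eval s = n) (hs : I s)
    (hstep : ∀ i < n, ∀ s', I s' → s'.idx k = i →
      Spec c s' T fun s'' => I s'' ∧ (φ s'' ↔ φ s' ∧ P i)) :
    Spec (RealRAM.forLoop k e c) s (forCost n e T)
      fun s' => I s' ∧ (φ s' ↔ φ s ∧ ∀ i < n, P i) := by
  refine Spec.forLoop n (fun i s' => I s' ∧ (φ s' ↔ φ s ∧ ∀ j < i, P j)) hk
    ⟨hI _ _ hs, by simp [hφ]⟩ (fun i s' h => he s' h.1) ?_
  rintro i hi s' ⟨h1, h2⟩ hki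
  refine (hstep i hi s' h1 hki).imp ?_
  rintro s'' ⟨h3, h4⟩
  refine ⟨hI _ _ h3, ?_⟩
  rw [hφ, h4, h2, and_assoc]
  simp only [Nat.lt_succ_iff_lt_or_eq, or_imp, forall_and, forall_eq]

end Spec

/-- `a(i, j) := ∑ k < e, f`. -/
def sumLoop (k : ℕ) (e : IExpr) (a : ℕ) (i j : IExpr) (f : RExpr) : Program :=
  .seq (.setArr a i j (.const 0)) (forLoop k e (.setArr a i j (.add (.load a i j) f)))

theorem modIdx_sumLoop {k k' a : ℕ} {e i j : IExpr} {f : RExpr} :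
    (sumLoop k e a i j f).ModIdx k' ↔ k' = k := by
  simp [sumLoop, modIdx_forLoop, Program.ModIdx]

theorem modArr_sumLoop {k a a' : ℕ} {e i j : IExpr} {f : RExpr} :
    (sumLoop k e a i j f).ModArr a' ↔ a' = a := by
  simp [sumLoop, modArr_forLoop, Program.ModArr]

/-- The running time of a `sumLoop` with `n` terms. -/
def sumCost (n : ℕ) (e i j : IExpr) (f : RExpr) : ℕ :=
  (i.cost + j.cost + 2) +
    (n * ((i.cost + j.cost + (i.cost + j.cost + 1 + f.cost + 1) + 1) + e.cost + 6) + e.cost + 4)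

/-- The accumulator is a cell of the array `a`, which changes during the loop. Hence the value of
`f` must be known in every state that agrees with `s` on the other arrays and on all registers but
the counter. -/
theorem Spec.sumLoop {k : ℕ} {e : IExpr} {a : ℕ} {i j : IExpr} {f : RExpr} {s : State}
    (n p q : ℕ) (F : ℕ → ℝ)
    (he : ∀ s', (∀ k' ≠ k, s'.idx k' = s.idx k') → e.eval s' = n)
    (hi : ∀ s', (∀ k' ≠ k, s'.idx k' = s.idx k') → i.eval s' = p)
    (hj : ∀ s', (∀ k' ≠ k, s'.idx k' = s.idx k') → j.eval s' = q)
    (hf : ∀ l < n, ∀ s', (∀ k' ≠ k, s'.idx k' = s.idx k') → s'.idx k = l →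
      (∀ a' ≠ a, s'.arr a' = s.arr a') → f.eval s' = F l) :
    Spec (sumLoop k e a i j f) s (sumCost n e i j f) fun s' =>
      (∀ k' ≠ k, s'.idx k' = s.idx k') ∧ (∀ a' ≠ a, s'.arr a' = s.arr a') ∧
      (∀ p' q', ¬ (p' = p ∧ q' = q) → s'.arr a p' q' = s.arr a p' q') ∧
      s'.arr a p q = ∑ l ∈ Finset.range n, F l := by
  refine (Spec.seq (T' := forCost n e
    (i.cost + j.cost + (RExpr.add (.load a i j) f).cost + 1)) (Spec.setArr ?_)).mono ?_
    (fun _ h => h)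
  · refine Spec.forLoop n (fun l s' => (∀ k' ≠ k, s'.idx k' = s.idx k') ∧
      (∀ a' ≠ a, s'.arr a' = s.arr a') ∧
      (∀ p' q', ¬ (p' = p ∧ q' = q) → s'.arr a p' q' = s.arr a p' q') ∧
      s'.arr a p q = ∑ l ∈ Finset.range l, F l) (by simp [Program.ModIdx]) ?_
      (fun l s' h => he s' h.1) ?_
    · have h1 := hi s (fun _ _ => rfl)
      have h2 := hj s (fun _ _ => rfl)
      refine ⟨fun k' hk' => by simp [hk'], fun a' ha' => ?_, fun p' q' h => ?_, ?_⟩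
      · simp [State.writeArr_arr_of_ne _ _ _ _ ha']
      · simp [State.writeArr_arr, h1, h2, h]
      · simp [State.writeArr_arr, h1, h2, RExpr.eval]
    · rintro l hl s' ⟨h1, h2, h3, h4⟩ hkl
      refine Spec.setArr ⟨fun k' hk' => by simp [hk', h1 k' hk'], fun a' ha' => ?_,
        fun p' q' h => ?_, ?_⟩
      · simp [State.writeArr_arr_of_ne _ _ _ _ ha', h2 a' ha']
      · simp [State.writeArr_arr, hi s' h1, hj s' h1, h, h3 p' q' h]
      · simp [State.writeArr_arr, hi s' h1, hj s' h1, RExpr.eval, h4, hf l hl s' h1 hkl h2,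
          Finset.sum_range_succ]
  · simp only [forCost, sumCost, RExpr.cost]
    push_cast
    apply le_of_eq; ring

end RealRAM

/-! ### Efficiency is decided by pairs of actions -/

/-- The points at which the sign conditions in `exists_pos_iff_testPoints` have to be tested. -/
noncomputable def testPoints (f₀ f₁ g₀ g₁ q₁ q₂ : ℝ) : List ℝ :=
  [0, 1, -f₀ / f₁, -g₀ / g₁, -q₁ / (2 * q₂)]

/-- The points of `[0, s]` where an affine function is nonnegative form an interval whose left end
is `0` or the root. -/
theorem exists_le_affine_nonneg {f₀ f₁ s : ℝ} (hs : 0 ≤ s) (hf : 0 < f₀ + f₁ * s) :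
    ∃ l, (l = 0 ∨ l = -f₀ / f₁) ∧ 0 ≤ l ∧ l ≤ s ∧ 0 ≤ f₀ + f₁ * l := by
  by_cases h : 0 ≤ f₀
  · exact ⟨0, Or.inl rfl, le_rfl, hs, by simpa using h⟩
  · have h1 : 0 < f₁ := by by_contra h1; nlinarith
    refine ⟨-f₀ / f₁, Or.inr rfl, div_nonneg (by linarith) h1.le, ?_, ?_⟩
    · rw [div_le_iff₀ h1]; linarith
    · rw [mul_div_cancel₀ _ h1.ne']; linarith

theorem exists_ge_affine_nonneg {f₀ f₁ s : ℝ} (hs : s ≤ 1) (hf : 0 < f₀ + f₁ * s) :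
    ∃ u, (u = 1 ∨ u = -f₀ / f₁) ∧ s ≤ u ∧ u ≤ 1 ∧ 0 ≤ f₀ + f₁ * u := by
  by_cases h : 0 ≤ f₀ + f₁
  · exact ⟨1, Or.inl rfl, hs, le_rfl, by simpa using h⟩
  · have h1 : f₁ < 0 := by by_contra h1; nlinarith
    refine ⟨-f₀ / f₁, Or.inr rfl, ?_, ?_, ?_⟩
    · rw [le_div_iff_of_neg h1]; linarith
    · rw [div_le_iff_of_neg h1]; linarith
    · rw [mul_div_cancel₀ _ h1.ne]; linarith

theorem affine_nonneg_of_between {f₀ f₁ l u s : ℝ} (hl : 0 ≤ f₀ + f₁ * l) (hu : 0 ≤ f₀ + f₁ * u)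
    (h1 : l ≤ s) (h2 : s ≤ u) : 0 ≤ f₀ + f₁ * s := by
  rcases le_total 0 f₁ with h | h
  · nlinarith
  · nlinarith

theorem affine_add_pos_of_between {f₀ f₁ l u s : ℝ} (hl : 0 ≤ f₀ + f₁ * l)
    (hu : 0 ≤ f₀ + f₁ * u) (hs : 0 < f₀ + f₁ * s) (h1 : l ≤ s) (h2 : s ≤ u) :
    0 < (f₀ + f₁ * l) + (f₀ + f₁ * u) := by
  rcases le_total 0 f₁ with h | h
  · nlinarith
  · nlinarith

/-- An interior value is a combination, with two positive weights, of endpoint values that are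
nonnegative and not both zero. -/
theorem affine_pos_of_between {f₀ f₁ l u w : ℝ} (hl : 0 ≤ f₀ + f₁ * l) (hu : 0 ≤ f₀ + f₁ * u)
    (hs : 0 < (f₀ + f₁ * l) + (f₀ + f₁ * u)) (h1 : l < w) (h2 : w < u) : 0 < f₀ + f₁ * w := by
  have h : (f₀ + f₁ * w) * (u - l) = (f₀ + f₁ * l) * (u - w) + (f₀ + f₁ * u) * (w - l) := by ring
  have h3 : 0 < (f₀ + f₁ * w) * (u - l) := by
    rw [h]
    rcases hl.eq_or_lt with h4 | h4
    · have : 0 < f₀ + f₁ * u := by linarith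
      have := mul_pos this (sub_pos.2 h1)
      have := mul_nonneg hl (sub_pos.2 h2).le
      linarith
    · have := mul_pos h4 (sub_pos.2 h2)
      have := mul_nonneg hu (sub_pos.2 h1).le
      linarith
  exact pos_of_mul_pos_left h3 (by linarith)

/-- A quadratic that is nonpositive at both ends but positive in between is strictly concave. Its
vertex lies strictly between the ends, since otherwise it would be monotone there, and is a rational
expression in the coefficients, unlike its roots. -/
theorem vertex_between_of_quadratic_pos {q₀ q₁ q₂ l u s : ℝ} (hl : q₀ + q₁ * l + q₂ * l * l ≤ 0)
    (hu : q₀ + q₁ * u + q₂ * u * u ≤ 0) (hQ : 0 < q₀ + q₁ * s + q₂ * s * s) (ls : l ≤ s)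
    (su : s ≤ u) : l < -q₁ / (2 * q₂) ∧ -q₁ / (2 * q₂) < u ∧
      0 < q₀ + q₁ * (-q₁ / (2 * q₂)) + q₂ * (-q₁ / (2 * q₂)) * (-q₁ / (2 * q₂)) := by
  have ls' : l < s := lt_of_le_of_ne ls (by rintro rfl; linarith)
  have su' : s < u := lt_of_le_of_ne su (by rintro rfl; linarith)
  -- Linear interpolation of the quadratic between `l` and `u`, with its error term; for `0 ≤ q₂` it
  -- would contradict positivity at `s`.
  have h1 : (u - l) * (q₀ + q₁ * s + q₂ * s * s) =
      (u - s) * (q₀ + q₁ * l + q₂ * l * l) + (s - l) * (q₀ + q₁ * u + q₂ * u * u) +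
        (-q₂) * ((s - l) * (u - s) * (u - l)) := by ring
  have hq2 : q₂ < 0 := by
    by_contra h
    have h2 := mul_pos (by linarith : 0 < u - l) hQ
    have h3 := mul_nonneg (by linarith : 0 ≤ u - s) (sub_nonneg.2 hl)
    have h4 := mul_nonneg (by linarith : 0 ≤ s - l) (sub_nonneg.2 hu)
    have h5 : 0 < (s - l) * (u - s) * (u - l) :=
      mul_pos (mul_pos (by linarith) (by linarith)) (by linarith)
    have h6 := mul_nonneg (not_lt.1 h) h5.le
    linarith
  have hne := hq2.ne
  have hw : ∀ r, q₀ + q₁ * r + q₂ * r * r = q₀ + q₁ * (-q₁ / (2 * q₂)) +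
      q₂ * (-q₁ / (2 * q₂)) * (-q₁ / (2 * q₂)) + q₂ * (r - (-q₁ / (2 * q₂))) ^ 2 := by
    intro r
    field_simp
    ring
  generalize -q₁ / (2 * q₂) = w at hw
  have hws := hw s
  have hwl := hw l
  have hwu := hw u
  refine ⟨?_, ?_, ?_⟩
  · by_contra h
    have h2 := mul_nonneg (neg_nonneg.2 hq2.le)
      (mul_nonneg (by linarith : 0 ≤ s - l) (by linarith : 0 ≤ s + l - 2 * w))
    have h3 : -q₂ * ((s - l) * (s + l - 2 * w)) = -q₂ * (s - w) ^ 2 - -q₂ * (l - w) ^ 2 := by ring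
    linarith
  · by_contra h
    have h2 := mul_nonneg (neg_nonneg.2 hq2.le)
      (mul_nonneg (by linarith : 0 ≤ u - s) (by linarith : 0 ≤ 2 * w - s - u))
    have h3 : -q₂ * ((u - s) * (2 * w - s - u)) = -q₂ * (s - w) ^ 2 - -q₂ * (u - w) ^ 2 := by ring
    linarith
  · have := mul_nonneg (neg_nonneg.2 hq2.le) (sq_nonneg (s - w))
    linarith

/-- A system of two affine and (unless `d` holds) one quadratic strict inequality on `[0, 1]`
is decided by finitely many rational test points. -/
theorem exists_pos_iff_testPoints (d : Prop) (f₀ f₁ g₀ g₁ q₀ q₁ q₂ : ℝ) :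
    (∃ s, 0 ≤ s ∧ s ≤ 1 ∧ 0 < f₀ + f₁ * s ∧ 0 < g₀ + g₁ * s ∧
      (d ∨ 0 < q₀ + q₁ * s + q₂ * s * s)) ↔
    ∃ c ∈ testPoints f₀ f₁ g₀ g₁ q₁ q₂, ∃ c' ∈ testPoints f₀ f₁ g₀ g₁ q₁ q₂,
      (0 ≤ c ∧ c ≤ 1 ∧ 0 ≤ c' ∧ c' ≤ 1) ∧
      (0 ≤ f₀ + f₁ * c ∧ 0 ≤ f₀ + f₁ * c' ∧ 0 < (f₀ + f₁ * c) + (f₀ + f₁ * c')) ∧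
      (0 ≤ g₀ + g₁ * c ∧ 0 ≤ g₀ + g₁ * c' ∧ 0 < (g₀ + g₁ * c) + (g₀ + g₁ * c')) ∧
      (d ∨ 0 < q₀ + q₁ * c + q₂ * c * c) := by
  constructor
  · rintro ⟨s, hs0, hs1, hf, hg, hq⟩
    obtain ⟨l₁, ml₁, l₁0, l₁s, hl₁⟩ := exists_le_affine_nonneg hs0 hf
    obtain ⟨l₂, ml₂, l₂0, l₂s, hl₂⟩ := exists_le_affine_nonneg hs0 hg
    obtain ⟨u₁, mu₁, su₁, u₁1, hu₁⟩ := exists_ge_affine_nonneg hs1 hf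
    obtain ⟨u₂, mu₂, su₂, u₂1, hu₂⟩ := exists_ge_affine_nonneg hs1 hg
    -- The larger of the two left ends works for both affine functions; likewise below the smaller
    -- of the two right ends. The endpoints may be roots, which is why the test uses weak
    -- inequalities together with a strict one for the sum.
    obtain ⟨l, ml, l0, ls, hlf, hlg⟩ : ∃ l ∈ testPoints f₀ f₁ g₀ g₁ q₁ q₂,
        0 ≤ l ∧ l ≤ s ∧ 0 ≤ f₀ + f₁ * l ∧ 0 ≤ g₀ + g₁ * l := by
      rcases le_total l₁ l₂ with h | h
      · exact ⟨l₂, by simp only [testPoints, List.mem_cons]; tauto, l₂0, l₂s,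
          affine_nonneg_of_between hl₁ hf.le h l₂s, hl₂⟩
      · exact ⟨l₁, by simp only [testPoints, List.mem_cons]; tauto, l₁0, l₁s, hl₁,
          affine_nonneg_of_between hl₂ hg.le h l₁s⟩
    obtain ⟨u, mu, su, u1, huf, hug⟩ : ∃ u ∈ testPoints f₀ f₁ g₀ g₁ q₁ q₂,
        s ≤ u ∧ u ≤ 1 ∧ 0 ≤ f₀ + f₁ * u ∧ 0 ≤ g₀ + g₁ * u := by
      rcases le_total u₁ u₂ with h | h
      · exact ⟨u₁, by simp only [testPoints, List.mem_cons]; tauto, su₁, u₁1, hu₁,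
          affine_nonneg_of_between hg.le hu₂ su₁ h⟩
      · exact ⟨u₂, by simp only [testPoints, List.mem_cons]; tauto, su₂, u₂1,
          affine_nonneg_of_between hf.le hu₁ su₂ h, hu₂⟩
    have l1 : l ≤ 1 := ls.trans hs1
    have u0 : 0 ≤ u := hs0.trans su
    have hF := affine_add_pos_of_between hlf huf hf ls su
    have hG := affine_add_pos_of_between hlg hug hg ls su
    by_cases hl : d ∨ 0 < q₀ + q₁ * l + q₂ * l * l
    · exact ⟨l, ml, u, mu, ⟨l0, l1, u0, u1⟩, ⟨hlf, huf, hF⟩, ⟨hlg, hug, hG⟩, hl⟩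
    by_cases hu : d ∨ 0 < q₀ + q₁ * u + q₂ * u * u
    · exact ⟨u, mu, l, ml, ⟨u0, u1, l0, l1⟩, ⟨huf, hlf, by linarith⟩, ⟨hug, hlg, by linarith⟩, hu⟩
    push Not at hl hu
    have hQ : 0 < q₀ + q₁ * s + q₂ * s * s := hq.resolve_left hl.1
    obtain ⟨lw, wu, hwQ⟩ := vertex_between_of_quadratic_pos hl.2 hu.2 hQ ls su
    have mw : -q₁ / (2 * q₂) ∈ testPoints f₀ f₁ g₀ g₁ q₁ q₂ := by simp [testPoints]
    generalize -q₁ / (2 * q₂) = w at lw wu hwQ mw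
    have hwf := affine_pos_of_between hlf huf hF lw wu
    have hwg := affine_pos_of_between hlg hug hG lw wu
    refine ⟨w, mw, w, mw, ⟨by linarith, by linarith, by linarith, by linarith⟩,
      ⟨hwf.le, hwf.le, by linarith⟩, ⟨hwg.le, hwg.le, by linarith⟩, Or.inr hwQ⟩
  · rintro ⟨c, -, c', -, ⟨c0, c1, c0', c1'⟩, ⟨hf, hf', hF⟩, ⟨hg, hg', hG⟩, hq⟩
    -- A slight move from `c` towards `c'` keeps the quadratic positive by continuity, and makes
    -- both affine functions strictly positive.
    have key : ∀ᶠ ε in nhdsWithin (0 : ℝ) (Set.Ioi 0), (d ∨ 0 < q₀ + q₁ * ((1 - ε) * c + ε * c') +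
        q₂ * ((1 - ε) * c + ε * c') * ((1 - ε) * c + ε * c')) := by
      rcases hq with hd | hq
      · exact Filter.Eventually.of_forall fun _ => Or.inl hd
      · have hc : Continuous fun ε : ℝ => q₀ + q₁ * ((1 - ε) * c + ε * c') +
          q₂ * ((1 - ε) * c + ε * c') * ((1 - ε) * c + ε * c') := by fun_prop
        have := hc.continuousAt.eventually (lt_mem_nhds (a := 0) (b := _)
          (by simpa using hq : 0 < q₀ + q₁ * ((1 - (0 : ℝ)) * c + 0 * c') +
            q₂ * ((1 - (0 : ℝ)) * c + 0 * c') * ((1 - (0 : ℝ)) * c + 0 * c')))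
        exact (this.filter_mono nhdsWithin_le_nhds).mono fun _ h => Or.inr h
    obtain ⟨ε, hε, hε0, hε1⟩ := (key.and (Ioo_mem_nhdsGT (zero_lt_one' ℝ))).exists
    have aux : ∀ p p' : ℝ, 0 ≤ p → 0 ≤ p' → 0 < p + p' → 0 < (1 - ε) * p + ε * p' := by
      intro p p' hp hp' h
      rcases hp.eq_or_lt with h4 | h4
      · have := mul_pos hε0 (by linarith : 0 < p'); rw [← h4]; linarith
      · have := mul_pos (sub_pos.2 hε1) h4
        have := mul_nonneg hε0.le hp'
        linarith
    have e1 : 0 ≤ 1 - ε := by linarith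
    refine ⟨(1 - ε) * c + ε * c', by positivity, by nlinarith, ?_, ?_, hε⟩
    · have := aux _ _ hf hf' hF; linarith
    · have := aux _ _ hg hg' hG; linarith

/-! ### Reaching the positive quadrant with two vectors -/

/-- If a nonnegative combination of planar vectors `(f i, g i)` lies in the open positive
quadrant, then so does one of at most two of these vectors. -/
theorem exists_pair_of_sum_pos {ι : Type*} [Fintype ι] {f g x : ι → ℝ} (hx : ∀ i, 0 ≤ x i)
    (hf : 0 < ∑ i, x i * f i) (hg : 0 < ∑ i, x i * g i) :
    ∃ i j, 0 < f i ∧ 0 < g j ∧ (i = j ∨ f j * g i < f i * g j) := by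
  by_contra hcon
  push Not at hcon
  have hP : ∃ i, 0 < f i := by
    by_contra h
    push Not at h
    exact absurd hf (not_lt.2 (Finset.sum_nonpos fun i _ => mul_nonpos_of_nonneg_of_nonpos (hx i) (h i)))
  -- If no such pair exists, the vector with `0 < f i` of steepest direction spans a line through
  -- the origin, of slope `-ρ`, with all vectors on or below it. Then `ρ * f + g` is nonpositive on
  -- every vector, but positive on the given combination.
  obtain ⟨i, hi, hmin⟩ := (Finset.univ.filter fun i => 0 < f i).exists_min_image
    (fun i => -g i / f i) (by obtain ⟨i, hi⟩ := hP; exact ⟨i, by simpa using hi⟩)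
  simp only [Finset.mem_filter, Finset.mem_univ, true_and] at hi hmin
  have hgn : ∀ j, 0 < f j → g j ≤ 0 := by
    intro j hj
    by_contra h
    exact (hcon j j hj (not_le.1 h)).1 rfl
  set ρ := -g i / f i with hρ
  have hρ0 : 0 ≤ ρ := div_nonneg (by linarith [hgn i hi]) hi.le
  have hρi : ρ * f i = -g i := by rw [hρ, div_mul_cancel₀ _ hi.ne']
  have hle : ∀ j, ρ * f j + g j ≤ 0 := by
    intro j
    by_cases hj : 0 < f j
    · have := (le_div_iff₀ hj).1 (hmin j hj)
      linarith
    · by_cases hj' : 0 < g j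
      · have h := (hcon i j hi hj').2
        have h2 : f i * (ρ * f j + g j) ≤ 0 := by
          have : f i * (ρ * f j + g j) = (ρ * f i) * f j + f i * g j := by ring
          rw [this, hρi]; linarith
        by_contra h3
        have := mul_pos hi (not_le.1 h3)
        linarith
      · have := mul_nonneg hρ0 (by linarith : 0 ≤ -f j)
        linarith
  have hsum : ρ * ∑ i, x i * f i + ∑ i, x i * g i ≤ 0 := by
    rw [Finset.mul_sum, ← Finset.sum_add_distrib]
    refine Finset.sum_nonpos fun j _ => ?_
    have := mul_nonneg (hx j) (sub_nonneg.2 (hle j))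
    linarith
  have := mul_nonneg hρ0 hf.le
  linarith

theorem exists_mix_pos {f₁ f₂ g₁ g₂ : ℝ} (hf : 0 < f₁) (hg : 0 < g₂) (h : f₂ * g₁ < f₁ * g₂) :
    ∃ t, 0 ≤ t ∧ t ≤ 1 ∧ 0 < (1 - t) * f₁ + t * f₂ ∧ 0 < (1 - t) * g₁ + t * g₂ := by
  by_cases h1 : g₂ < f₂
  · exact ⟨1, by norm_num, le_rfl, by linarith, by linarith⟩
  by_cases h2 : f₁ < g₁
  · exact ⟨0, le_rfl, by norm_num, by linarith, by linarith⟩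
  have h3 : 0 < (g₂ - f₂) + (f₁ - g₁) := by
    by_contra h3
    have h4 : g₂ = f₂ := by linarith
    have h5 : f₁ = g₁ := by linarith
    subst h4 h5
    linarith [mul_comm f₁ g₂]
  -- The weight at which the segment between the two vectors meets the diagonal; both coordinates
  -- there are the determinant divided by the denominator.
  refine ⟨(f₁ - g₁) / ((g₂ - f₂) + (f₁ - g₁)), div_nonneg (by linarith) h3.le,
    (div_le_one h3).2 (by linarith), ?_, ?_⟩
  · have : (1 - (f₁ - g₁) / ((g₂ - f₂) + (f₁ - g₁))) * f₁ +
        (f₁ - g₁) / ((g₂ - f₂) + (f₁ - g₁)) * f₂ =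
          (f₁ * g₂ - f₂ * g₁) / ((g₂ - f₂) + (f₁ - g₁)) := by
      field_simp; ring
    rw [this]; exact div_pos (by linarith) h3
  · have : (1 - (f₁ - g₁) / ((g₂ - f₂) + (f₁ - g₁))) * g₁ +
        (f₁ - g₁) / ((g₂ - f₂) + (f₁ - g₁)) * g₂ =
          (f₁ * g₂ - f₂ * g₁) / ((g₂ - f₂) + (f₁ - g₁)) := by
      field_simp; ring
    rw [this]; exact div_pos (by linarith) h3

theorem exists_mix_pos_of_pair {ι : Type*} {f g : ι → ℝ} {i j : ι} (hf : 0 < f i) (hg : 0 < g j)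
    (h : i = j ∨ f j * g i < f i * g j) :
    ∃ t, 0 ≤ t ∧ t ≤ 1 ∧ 0 < (1 - t) * f i + t * f j ∧ 0 < (1 - t) * g i + t * g j := by
  rcases h with rfl | h
  · exact ⟨0, le_rfl, zero_le_one, by simpa using hf, by simpa using hg⟩
  · exact exists_mix_pos hf hg h

theorem exists_pair_of_mix_pos {ι : Type*} {f g : ι → ℝ} {i j : ι} {t : ℝ} (h0 : 0 ≤ t)
    (h1 : t ≤ 1) (hf : 0 < (1 - t) * f i + t * f j) (hg : 0 < (1 - t) * g i + t * g j) :
    ∃ i j, 0 < f i ∧ 0 < g j ∧ (i = j ∨ f j * g i < f i * g j) := by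
  obtain ⟨k, l, hk, hl, h⟩ := exists_pair_of_sum_pos (x := ![1 - t, t]) (f := f ∘ ![i, j])
    (g := g ∘ ![i, j]) (by simp [Fin.forall_fin_two, h0, h1]) (by simpa using hf)
    (by simpa using hg)
  exact ⟨_, _, hk, hl, h.imp (congrArg _) id⟩

/-- Two rows `a, a'` and two columns `b, b'` such that some deviation that uses only these gives
more than `v` to the first player and more than `w` to the second, for matrices `A` and `B`. -/
def PairImproves (A B : ℕ → ℕ → ℝ) (v w : ℝ) (a a' b b' : ℕ) : Prop :=
  ∃ s, 0 ≤ s ∧ s ≤ 1 ∧ 0 < (1 - s) * (A a b - v) + s * (A a' b - v) ∧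
    0 < (1 - s) * (B a b' - w) + s * (B a' b' - w) ∧
    (b = b' ∨ ((1 - s) * (A a b' - v) + s * (A a' b' - v)) *
      ((1 - s) * (B a b - w) + s * (B a' b - w)) <
      ((1 - s) * (A a b - v) + s * (A a' b - v)) * ((1 - s) * (B a b' - w) + s * (B a' b' - w)))

namespace BimatrixGame

variable {m₁ m₂ : ℕ}

theorem payoff_sub_eq (U : BimatrixGame m₁ m₂) (i : Fin 2) {x : Profile m₁ m₂} (hx : IsMixed x)
    (v : ℝ) : payoff U i x - v = ∑ a, x.1 a * ∑ b, x.2 b * (U (i, a, b) - v) := by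
  have h1 : ∑ a, x.1 a * ∑ b, x.2 b * v = v := by
    rw [← Finset.sum_mul, ← Finset.sum_mul, hx.2.2, hx.1.2, one_mul, one_mul]
  simp only [mul_sub, Finset.sum_sub_distrib, h1, payoff]
  congr 1
  refine Finset.sum_congr rfl fun a _ => ?_
  rw [Finset.mul_sum]
  exact Finset.sum_congr rfl fun b _ => by ring

/-- The mixture of two actions. -/
def mix {ι : Type*} [DecidableEq ι] (t : ℝ) (i j : ι) : ι → ℝ :=
  (1 - t) • Pi.single i 1 + t • Pi.single j 1

theorem mix_mem {ι : Type*} [Fintype ι] [DecidableEq ι] {t : ℝ} (h0 : 0 ≤ t) (h1 : t ≤ 1)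
    (i j : ι) : mix t i j ∈ stdSimplex ℝ ι :=
  convex_stdSimplex ℝ ι (single_mem_stdSimplex ℝ i) (single_mem_stdSimplex ℝ j) (by linarith) h0
    (by ring)

theorem sum_mix_mul {ι : Type*} [Fintype ι] [DecidableEq ι] (t : ℝ) (i j : ι) (f : ι → ℝ) :
    ∑ k, mix t i j k * f k = (1 - t) * f i + t * f j := by
  simp [mix, add_mul, Finset.sum_add_distrib, Pi.single_apply]

/-- There is a pair of mixed strategies with payoffs above `v` and `w` if and only if there is
one in which each player uses at most two actions. -/
theorem exists_improvement_iff (U : BimatrixGame m₁ m₂) (A B : ℕ → ℕ → ℝ)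
    (hA : ∀ (a : Fin m₁) (b : Fin m₂), A a b = U (0, a, b))
    (hB : ∀ (a : Fin m₁) (b : Fin m₂), B a b = U (1, a, b)) (v w : ℝ) :
    (∃ x : Profile m₁ m₂, IsMixed x ∧ v < payoff U 0 x ∧ w < payoff U 1 x) ↔
      ∃ (a a' : Fin m₁) (b b' : Fin m₂), PairImproves A B v w a a' b b' := by
  constructor
  · rintro ⟨x, hx, h0, h1⟩
    have h0' := sub_pos.2 h0
    have h1' := sub_pos.2 h1
    rw [payoff_sub_eq U _ hx] at h0' h1'
    simp only [Finset.mul_sum] at h0' h1'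
    rw [Finset.sum_comm] at h0' h1'
    simp only [mul_left_comm (x.1 _), ← Finset.mul_sum] at h0' h1'
    obtain ⟨b₁, b₂, hb₁, hb₂, hb⟩ := exists_pair_of_sum_pos hx.2.1 h0' h1'
    obtain ⟨t, t0, t1, ht, ht'⟩ := exists_mix_pos_of_pair
      (f := fun b => ∑ a, x.1 a * (U (0, a, b) - v))
      (g := fun b => ∑ a, x.1 a * (U (1, a, b) - w)) hb₁ hb₂ hb
    simp only [Finset.mul_sum, ← Finset.sum_add_distrib, mul_left_comm _ (x.1 _),
      ← mul_add (x.1 _)] at ht ht'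
    obtain ⟨a, a', ha, ha', haa⟩ := exists_pair_of_sum_pos
      (f := fun a => (1 - t) * (U (0, a, b₁) - v) + t * (U (0, a, b₂) - v))
      (g := fun a => (1 - t) * (U (1, a, b₁) - w) + t * (U (1, a, b₂) - w)) hx.1.1 ht ht'
    obtain ⟨s, s0, s1, hs, hs'⟩ := exists_mix_pos_of_pair
      (f := fun a => (1 - t) * (U (0, a, b₁) - v) + t * (U (0, a, b₂) - v))
      (g := fun a => (1 - t) * (U (1, a, b₁) - w) + t * (U (1, a, b₂) - w)) ha ha' haa
    -- The determinant condition in `PairImproves` refers to the final row mixture, so the columns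
    -- are selected once more, now against the weight `s`; the pair may come out swapped or reduced
    -- to one column.
    obtain ⟨b, b', hb, hb', hbb⟩ := exists_pair_of_mix_pos (i := b₁) (j := b₂)
      (f := fun b => (1 - s) * (U (0, a, b) - v) + s * (U (0, a', b) - v))
      (g := fun b => (1 - s) * (U (1, a, b) - w) + s * (U (1, a', b) - w)) t0 t1
      (by linarith) (by linarith)
    refine ⟨a, a', b, b', s, s0, s1, ?_⟩
    simp only [hA, hB]
    exact ⟨hb, hb', hbb.imp (congrArg _) id⟩
  · rintro ⟨a, a', b, b', s, s0, s1, hf, hg, h⟩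
    simp only [hA, hB] at hf hg h
    obtain ⟨t, t0, t1, ht, ht'⟩ := exists_mix_pos_of_pair (i := b) (j := b')
      (f := fun b => (1 - s) * (U (0, a, b) - v) + s * (U (0, a', b) - v))
      (g := fun b => (1 - s) * (U (1, a, b) - w) + s * (U (1, a', b) - w)) hf hg
      (h.imp Fin.ext id)
    have hm : IsMixed (mix s a a', mix t b b') := ⟨mix_mem s0 s1 _ _, mix_mem t0 t1 _ _⟩
    refine ⟨_, hm, sub_pos.1 ?_, sub_pos.1 ?_⟩
    · rw [payoff_sub_eq U _ hm]; simp only [sum_mix_mul]; linarith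
    · rw [payoff_sub_eq U _ hm]; simp only [sum_mix_mul]; linarith

/-- Single players cannot improve upon a Nash equilibrium, so only the joint deviations of both
players matter. -/
theorem isStrongNash_iff (U : BimatrixGame m₁ m₂) (x : Profile m₁ m₂) :
    IsStrongNash U x ↔ IsNash U x ∧
      ¬ ∃ y : Profile m₁ m₂, IsMixed y ∧ payoff U 0 x < payoff U 0 y ∧
        payoff U 1 x < payoff U 1 y := by
  constructor
  · rintro ⟨h, hC⟩
    refine ⟨h, ?_⟩
    rintro ⟨y, hy, h0, h1⟩
    refine hC Finset.univ Finset.univ_nonempty ⟨y, ⟨hy, by simp, by simp⟩, ?_⟩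
    simp [Fin.forall_fin_two, h0, h1]
  · rintro ⟨h, hC⟩
    refine ⟨h, ?_⟩
    rintro C ⟨i, hi⟩ ⟨y, ⟨hy, hy0, hy1⟩, hgt⟩
    by_cases h0 : 0 ∈ C
    · by_cases h1 : 1 ∈ C
      · exact hC ⟨y, hy, hgt 0 h0, hgt 1 h1⟩
      · have := h.2.1 y.1 hy.1
        rw [← hy1 h1] at this
        exact absurd (hgt 0 h0) (not_lt.2 this)
    · have h1 : 1 ∈ C := by
        fin_cases i
        · exact absurd hi h0
        · exact hi
      have := h.2.2 y.2 hy.2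
      rw [← hy0 h0] at this
      exact absurd (hgt 1 h1) (not_lt.2 this)

end BimatrixGame

/-! ### In generic games, strong Nash equilibria are pure -/

/-- The best-reply condition: positive weight on an action below the mean would make the mean
smaller than itself. -/
theorem eq_sum_of_le_sum {ι : Type*} [Fintype ι] {w f : ι → ℝ} (hw : w ∈ stdSimplex ℝ ι)
    (hf : ∀ i, f i ≤ ∑ j, w j * f j) {i : ι} (hi : 0 < w i) : f i = ∑ j, w j * f j := by
  by_contra hne
  have h : ∑ j, w j * f j < ∑ j, w j * ∑ k, w k * f k :=
    Finset.sum_lt_sum (fun j _ => mul_le_mul_of_nonneg_left (hf j) (hw.1 j))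
      ⟨i, Finset.mem_univ i, mul_lt_mul_of_pos_left (lt_of_le_of_ne (hf i) hne) hi⟩
  rw [← Finset.sum_mul, hw.2, one_mul] at h
  exact lt_irrefl _ h

theorem sum_mul_le_of_le {ι : Type*} [Fintype ι] {w f : ι → ℝ} {v : ℝ} (hw : w ∈ stdSimplex ℝ ι)
    (hf : ∀ i, f i ≤ v) : ∑ j, w j * f j ≤ v := by
  calc ∑ j, w j * f j ≤ ∑ j, w j * v :=
        Finset.sum_le_sum fun j _ => mul_le_mul_of_nonneg_left (hf j) (hw.1 j)
    _ = v := by rw [← Finset.sum_mul, hw.2, one_mul]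

/-- Positive coordinates leave room in both directions and zero coordinates do not move. The
neighbourhood of `0` is two-sided because the signs of the perturbations are chosen later. -/
theorem eventually_perturbation_mem {ι : Type*} [Fintype ι] {z e : ι → ℝ}
    (hz : z ∈ stdSimplex ℝ ι) (he : ∑ i, e i = 0) (h0 : ∀ i, z i = 0 → e i = 0) :
    ∀ᶠ r in nhds (0 : ℝ), (fun i => z i + r * e i) ∈ stdSimplex ℝ ι := by
  have h : ∀ᶠ r in nhds (0 : ℝ), ∀ i, 0 ≤ z i + r * e i := by
    rw [Filter.eventually_all]
    intro i
    rcases (hz.1 i).eq_or_lt with h | h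
    · simp [← h, h0 i h.symm]
    · have hc : Continuous fun r : ℝ => z i + r * e i := by fun_prop
      exact (hc.continuousAt.eventually (lt_mem_nhds (by simpa using h))).mono fun _ h => le_of_lt h
  refine h.mono fun r hr => ⟨hr, ?_⟩
  rw [Finset.sum_add_distrib, hz.2, ← Finset.mul_sum, he, mul_zero, add_zero]

/-- The two products are the gains of the players under the perturbation in
`not_isStrongNash_of_supports`. For `c = 0` the second gain is `ε * δ`, so `ε = δ` is taken with the
sign of `g` (positive if `g = 0`). For `0 < c` a small positive `ε` with `g + ε ≠ 0` is fixed, and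
then `δ` is small with the sign of `g + ε`. -/
theorem exists_small_improvement {P R : ℝ → Prop} (hP : ∀ᶠ ε in nhds (0 : ℝ), P ε)
    (hR : ∀ᶠ δ in nhds (0 : ℝ), R δ) {c : ℝ} (hc : 0 ≤ c) (g σ : ℝ) :
    ∃ ε δ, P ε ∧ R δ ∧ 0 < δ * (g + ε) ∧ 0 < ε * ((1 - δ * σ) * c + δ) := by
  have hneg : Filter.Tendsto (fun r : ℝ => -r) (nhds 0) (nhds 0) := by
    simpa using (continuous_neg (G := ℝ)).tendsto 0
  rcases hc.eq_or_lt with rfl | hc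
  · have h := ((hP.and hR).and (hneg.eventually (hP.and hR))).filter_mono
      (nhdsWithin_le_nhds (s := Set.Ioi 0))
    obtain ⟨r, ⟨⟨h1, h2⟩, h3, h4⟩, hr⟩ := (h.and self_mem_nhdsWithin).exists
    have hr : 0 < r := hr
    rcases le_or_gt 0 g with hg | hg
    · exact ⟨r, r, h1, h2, by positivity, by rw [mul_zero, zero_add]; positivity⟩
    · exact ⟨-r, -r, h3, h4, mul_pos_of_neg_of_neg (by linarith) (by linarith),
        mul_pos_of_neg_of_neg (by linarith) (by linarith)⟩
  · have h1 : ∀ᶠ ε in nhdsWithin (0 : ℝ) (Set.Ioi 0), P ε ∧ g + ε ≠ 0 ∧ 0 < ε := by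
      refine (hP.filter_mono nhdsWithin_le_nhds).and (Filter.Eventually.and ?_ self_mem_nhdsWithin)
      by_cases hg : g < 0
      · filter_upwards [Ioo_mem_nhdsGT (neg_pos.2 hg)] with x hx
        have := hx.2
        intro h; linarith
      · refine Filter.Eventually.mono self_mem_nhdsWithin fun x hx => ?_
        have : 0 < x := hx
        intro h; linarith
    obtain ⟨ε, hε, hgε, ε0⟩ := h1.exists
    have h2 : ∀ᶠ δ in nhds (0 : ℝ), 0 < (1 - δ * σ) * c + δ := by
      have hcont : Continuous fun δ : ℝ => (1 - δ * σ) * c + δ := by fun_prop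
      exact hcont.continuousAt.eventually (lt_mem_nhds (by simpa using hc))
    have h := ((hR.and h2).and (hneg.eventually (hR.and h2))).filter_mono
      (nhdsWithin_le_nhds (s := Set.Ioi 0))
    obtain ⟨r, ⟨⟨h3, h4⟩, h5, h6⟩, hr⟩ := (h.and self_mem_nhdsWithin).exists
    have hr : 0 < r := hr
    rcases lt_or_gt_of_ne hgε with h7 | h7
    · exact ⟨ε, -r, hε, h5, mul_pos_of_neg_of_neg (by linarith) h7, mul_pos ε0 h6⟩
    · exact ⟨ε, r, hε, h3, mul_pos hr h7, mul_pos ε0 h4⟩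

/-! ### Best replies and the improving perturbation -/

namespace BimatrixGame

variable {m₁ m₂ : ℕ}

/-- The payoff of the first player's action `a` against `y`. -/
def rowPayoff (U : BimatrixGame m₁ m₂) (y : Fin m₂ → ℝ) (a : Fin m₁) : ℝ :=
  ∑ b, U (0, a, b) * y b

/-- The payoff of the second player's action `b` against `x`. -/
def colPayoff (U : BimatrixGame m₁ m₂) (x : Fin m₁ → ℝ) (b : Fin m₂) : ℝ :=
  ∑ a, U (1, a, b) * x a

theorem payoff_eq_sum_rows (U : BimatrixGame m₁ m₂) (i : Fin 2) (x : Profile m₁ m₂) :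
    payoff U i x = ∑ a, x.1 a * ∑ b, U (i, a, b) * x.2 b := by
  simp only [payoff, Finset.mul_sum]
  exact Finset.sum_congr rfl fun a _ => Finset.sum_congr rfl fun b _ => by ring

theorem payoff_eq_sum_cols (U : BimatrixGame m₁ m₂) (i : Fin 2) (x : Profile m₁ m₂) :
    payoff U i x = ∑ b, x.2 b * ∑ a, U (i, a, b) * x.1 a := by
  simp only [payoff, Finset.mul_sum]
  rw [Finset.sum_comm]
  exact Finset.sum_congr rfl fun a _ => Finset.sum_congr rfl fun b _ => by ring

theorem payoff_zero (U : BimatrixGame m₁ m₂) (x : Profile m₁ m₂) :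
    payoff U 0 x = ∑ a, x.1 a * rowPayoff U x.2 a := payoff_eq_sum_rows U 0 x

theorem payoff_one (U : BimatrixGame m₁ m₂) (x : Profile m₁ m₂) :
    payoff U 1 x = ∑ b, x.2 b * colPayoff U x.1 b := payoff_eq_sum_cols U 1 x

theorem isNash_iff (U : BimatrixGame m₁ m₂) (x : Profile m₁ m₂) :
    IsNash U x ↔ IsMixed x ∧ (∀ a, rowPayoff U x.2 a ≤ payoff U 0 x) ∧
      ∀ b, colPayoff U x.1 b ≤ payoff U 1 x := by
  refine and_congr_right fun _ => and_congr ⟨fun h a => ?_, fun h y hy => ?_⟩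
    ⟨fun h b => ?_, fun h y hy => ?_⟩
  · have := h _ (single_mem_stdSimplex ℝ a)
    rw [payoff_zero] at this
    simpa [Pi.single_apply] using this
  · rw [payoff_zero U (y, x.2)]
    exact sum_mul_le_of_le hy h
  · have := h _ (single_mem_stdSimplex ℝ b)
    rw [payoff_one] at this
    simpa [Pi.single_apply] using this
  · rw [payoff_one U (x.1, y)]
    exact sum_mul_le_of_le hy h

theorem IsNash.rowPayoff_eq {U : BimatrixGame m₁ m₂} {x : Profile m₁ m₂} (h : IsNash U x)
    {a : Fin m₁} (ha : 0 < x.1 a) : rowPayoff U x.2 a = payoff U 0 x := by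
  have h1 := ((isNash_iff U x).1 h).2.1
  rw [payoff_zero] at h1 ⊢
  exact eq_sum_of_le_sum h.1.1 h1 ha

theorem IsNash.colPayoff_eq {U : BimatrixGame m₁ m₂} {x : Profile m₁ m₂} (h : IsNash U x)
    {b : Fin m₂} (hb : 0 < x.2 b) : colPayoff U x.1 b = payoff U 1 x := by
  have h1 := ((isNash_iff U x).1 h).2.2
  rw [payoff_one] at h1 ⊢
  exact eq_sum_of_le_sum h.1.2 h1 hb

/-- The minor of the payoff differences between two rows that belongs to two columns. -/
def differenceMinor (U : BimatrixGame m₁ m₂) (a a' : Fin m₁) (b b' : Fin m₂) : ℝ :=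
  (U (0, a, b) - U (0, a', b)) * (U (1, a, b') - U (1, a', b')) -
    (U (0, a, b') - U (0, a', b')) * (U (1, a, b) - U (1, a', b))

/-- Polynomially many polynomial conditions that exclude mixed strong Nash equilibria. -/
def IsGeneric (U : BimatrixGame m₁ m₂) : Prop :=
  (∀ a a' b, a ≠ a' → U (0, a, b) ≠ U (0, a', b)) ∧
  (∀ a b b', b ≠ b' → U (1, a, b) ≠ U (1, a, b')) ∧
  ∀ a a' b b', a ≠ a' → b ≠ b' → differenceMinor U a a' b b' ≠ 0

/-- Exact bilinear expansion of a move from row `a'` to row `a` combined with a move towards the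
columns `b` and `b'`. At an equilibrium supported there, the first-order term in `ε` vanishes for
the first player, and that in `δ` for the second. -/
theorem payoff_perturbation (U : BimatrixGame m₁ m₂) (i : Fin 2) (x : Profile m₁ m₂)
    (a a' : Fin m₁) (b b' : Fin m₂) (ε δ s t : ℝ) :
    payoff U i (fun k => x.1 k + ε * ((Pi.single a 1 : Fin m₁ → ℝ) k - (Pi.single a' 1 : Fin m₁ → ℝ) k),
      fun k => x.2 k + δ * (s * (Pi.single b 1 : Fin m₂ → ℝ) k + t * (Pi.single b' 1 : Fin m₂ → ℝ) k -
        (s + t) * x.2 k)) =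
      (1 - δ * (s + t)) * payoff U i x + δ * (s * ∑ k, U (i, k, b) * x.1 k) +
        δ * (t * ∑ k, U (i, k, b') * x.1 k) +
        ε * ((1 - δ * (s + t)) * (∑ k, U (i, a, k) * x.2 k - ∑ k, U (i, a', k) * x.2 k) +
          δ * (s * (U (i, a, b) - U (i, a', b)) + t * (U (i, a, b') - U (i, a', b')))) := by
  have h1 : ∀ k, ∑ l, U (i, k, l) * (x.2 l + δ * (s * (Pi.single b 1 : Fin m₂ → ℝ) l +
      t * (Pi.single b' 1 : Fin m₂ → ℝ) l - (s + t) * x.2 l)) =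
      (1 - δ * (s + t)) * ∑ l, U (i, k, l) * x.2 l + δ * (s * U (i, k, b)) +
        δ * (t * U (i, k, b')) := by
    intro k
    have : ∀ l, U (i, k, l) * (x.2 l + δ * (s * (Pi.single b 1 : Fin m₂ → ℝ) l +
      t * (Pi.single b' 1 : Fin m₂ → ℝ) l - (s + t) * x.2 l)) = (1 - δ * (s + t)) * (U (i, k, l) * x.2 l) +
        δ * s * (U (i, k, l) * (Pi.single b 1 : Fin m₂ → ℝ) l) +
        δ * t * (U (i, k, l) * (Pi.single b' 1 : Fin m₂ → ℝ) l) := fun l => by ring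
    simp only [this, Finset.sum_add_distrib, ← Finset.mul_sum]
    simp [Pi.single_apply, mul_assoc]
  have h2 : ∀ f : Fin m₁ → ℝ, ∑ k, (x.1 k + ε * ((Pi.single a 1 : Fin m₁ → ℝ) k -
      (Pi.single a' 1 : Fin m₁ → ℝ) k)) * f k = ∑ k, x.1 k * f k + ε * (f a - f a') := by
    intro f
    have : ∀ k, (x.1 k + ε * ((Pi.single a 1 : Fin m₁ → ℝ) k - (Pi.single a' 1 : Fin m₁ → ℝ) k)) * f k =
        x.1 k * f k + ε * ((Pi.single a 1 : Fin m₁ → ℝ) k * f k) -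
          ε * ((Pi.single a' 1 : Fin m₁ → ℝ) k * f k) := fun k => by ring
    simp only [this, Finset.sum_add_distrib, Finset.sum_sub_distrib, ← Finset.mul_sum]
    simp [Pi.single_apply]
    ring
  rw [payoff_eq_sum_rows, payoff_eq_sum_rows]
  simp only [h1, h2]
  have h3 : ∀ k, x.1 k * ((1 - δ * (s + t)) * ∑ l, U (i, k, l) * x.2 l + δ * (s * U (i, k, b)) +
      δ * (t * U (i, k, b'))) = (1 - δ * (s + t)) * (x.1 k * ∑ l, U (i, k, l) * x.2 l) +
        δ * (s * (U (i, k, b) * x.1 k)) + δ * (t * (U (i, k, b') * x.1 k)) := fun k => by ring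
  simp only [h3, Finset.sum_add_distrib, ← Finset.mul_sum]
  ring

/-- With a nonzero minor the mixed second-order coefficients of both players can be normalized to
`1`. The first player's gain becomes `δ * (g + ε)` and the second player's `ε * ((1 - δ * (s + t)) *
c + δ)`; suitable signs make both positive. -/
theorem not_isStrongNash_of_supports {U : BimatrixGame m₁ m₂} {x : Profile m₁ m₂}
    (hx : IsStrongNash U x) {a a' : Fin m₁} {b b' : Fin m₂} (ha : 0 < x.1 a) (ha' : 0 < x.1 a')
    (hb : 0 < x.2 b) (hb' : 0 < x.2 b') : differenceMinor U a a' b b' = 0 := by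
  by_contra hD
  -- Exchanging the two rows changes the sign of this difference but leaves the minor unchanged.
  wlog hc : 0 ≤ ∑ k, U (1, a, k) * x.2 k - ∑ k, U (1, a', k) * x.2 k generalizing a a'
  · refine this ha' ha (fun h => hD ?_) (by linarith)
    rw [← h, differenceMinor, differenceMinor]; ring
  rw [isStrongNash_iff] at hx
  obtain ⟨hN, hE⟩ := hx
  have hX : ∀ᶠ ε in nhds (0 : ℝ), (fun k => x.1 k + ε * ((Pi.single a 1 : Fin m₁ → ℝ) k -
      (Pi.single a' 1 : Fin m₁ → ℝ) k)) ∈ stdSimplex ℝ (Fin m₁) := by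
    refine eventually_perturbation_mem hN.1.1 (by simp) fun k hk => ?_
    have h1 : k ≠ a := by rintro rfl; exact ha.ne' hk
    have h2 : k ≠ a' := by rintro rfl; exact ha'.ne' hk
    simp [h1, h2]
  have h2 : ∃ s t, s * (U (0, a, b) - U (0, a', b)) + t * (U (0, a, b') - U (0, a', b')) = 1 ∧
      s * (U (1, a, b) - U (1, a', b)) + t * (U (1, a, b') - U (1, a', b')) = 1 := by
    -- Cramer's rule for a two-by-two system whose determinant is the minor.
    refine ⟨((U (1, a, b') - U (1, a', b')) - (U (0, a, b') - U (0, a', b'))) /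
      differenceMinor U a a' b b', ((U (0, a, b) - U (0, a', b)) - (U (1, a, b) - U (1, a', b))) /
      differenceMinor U a a' b b', ?_, ?_⟩ <;>
    · field_simp
      rw [differenceMinor]; ring
  obtain ⟨s, t, hs, ht⟩ := h2
  have hY : ∀ᶠ δ in nhds (0 : ℝ), (fun k => x.2 k + δ * (s * (Pi.single b 1 : Fin m₂ → ℝ) k +
      t * (Pi.single b' 1 : Fin m₂ → ℝ) k - (s + t) * x.2 k)) ∈ stdSimplex ℝ (Fin m₂) := by
    refine eventually_perturbation_mem hN.1.2 ?_ fun k hk => ?_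
    · simp [Finset.sum_add_distrib, ← Finset.mul_sum, hN.1.2.2]
    · have h1 : k ≠ b := by rintro rfl; exact hb.ne' hk
      have h2 : k ≠ b' := by rintro rfl; exact hb'.ne' hk
      simp [h1, h2, hk]
  obtain ⟨ε, δ, hε, hδ, h0, h1⟩ := exists_small_improvement hX hY hc
    (s * (∑ k, U (0, k, b) * x.1 k - payoff U 0 x) +
      t * (∑ k, U (0, k, b') * x.1 k - payoff U 0 x)) (s + t)
  refine hE ⟨(_, _), ⟨hε, hδ⟩, sub_pos.1 ?_, sub_pos.1 ?_⟩
  · have e1 := hN.rowPayoff_eq ha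
    have e2 := hN.rowPayoff_eq ha'
    rw [rowPayoff] at e1 e2
    rw [payoff_perturbation, e1, e2, hs]
    linarith
  · have e1 := hN.colPayoff_eq hb
    have e2 := hN.colPayoff_eq hb'
    rw [colPayoff] at e1 e2
    rw [payoff_perturbation, e1, e2, ht]
    linarith

theorem eq_single_of_support_subset {ι : Type*} [Fintype ι] [DecidableEq ι] {w : ι → ℝ}
    (hw : w ∈ stdSimplex ℝ ι) {i : ι} (h : ∀ j, 0 < w j → j = i) : w = Pi.single i 1 := by
  have h0 : ∀ j, j ≠ i → w j = 0 := fun j hj =>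
    le_antisymm (not_lt.1 fun h' => hj (h j h')) (hw.1 j)
  have h1 : w i = 1 := by
    rw [← hw.2, Finset.sum_eq_single i (fun j _ hj => h0 j hj) (by simp)]
  ext j
  by_cases hj : j = i
  · subst hj; simp [h1]
  · simp [hj, h0 j hj]

theorem exists_pos_of_mem_stdSimplex {ι : Type*} [Fintype ι] {w : ι → ℝ}
    (hw : w ∈ stdSimplex ℝ ι) : ∃ i, 0 < w i := by
  by_contra h
  push Not at h
  have := Finset.sum_nonpos (s := Finset.univ) fun i _ => h i
  rw [hw.2] at this
  linarith

/-- All actions in a support are equally good. Against a pure strategy this would force two equal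
entries, so one player cannot mix alone; the minors exclude that both mix. -/
theorem IsGeneric.exists_eq_single {U : BimatrixGame m₁ m₂} (hU : IsGeneric U)
    {x : Profile m₁ m₂} (hx : IsStrongNash U x) :
    ∃ a b, x = (Pi.single a 1, Pi.single b 1) := by
  obtain ⟨a, ha⟩ := exists_pos_of_mem_stdSimplex hx.1.1.1
  obtain ⟨b, hb⟩ := exists_pos_of_mem_stdSimplex hx.1.1.2
  by_cases h1 : ∀ a', 0 < x.1 a' → a' = a
  · have hx1 := eq_single_of_support_subset hx.1.1.1 h1
    have h2 : ∀ b', 0 < x.2 b' → b' = b := by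
      intro b' hb'
      by_contra hne
      have h3 := (hx.1.colPayoff_eq hb').trans (hx.1.colPayoff_eq hb).symm
      simp only [colPayoff, hx1, Pi.single_apply, mul_ite, mul_one, mul_zero, Finset.sum_ite_eq',
        Finset.mem_univ, if_true] at h3
      exact hU.2.1 a b' b hne h3
    exact ⟨a, b, Prod.ext hx1 (eq_single_of_support_subset hx.1.1.2 h2)⟩
  · push Not at h1
    obtain ⟨a', ha', hne⟩ := h1
    exfalso
    by_cases h2 : ∀ b', 0 < x.2 b' → b' = b
    · have hx2 := eq_single_of_support_subset hx.1.1.2 h2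
      have h3 := (hx.1.rowPayoff_eq ha').trans (hx.1.rowPayoff_eq ha).symm
      simp only [rowPayoff, hx2, Pi.single_apply, mul_ite, mul_one, mul_zero, Finset.sum_ite_eq',
        Finset.mem_univ, if_true] at h3
      exact hU.1 a' a b hne h3
    · push Not at h2
      obtain ⟨b', hb', hne'⟩ := h2
      exact hU.2.2 a' a b' b hne hne' (not_isStrongNash_of_supports hx ha' ha hb' hb)

end BimatrixGame

/-! ### Strong Nash equilibria with coordinates that are rational in the payoffs -/

/-- The values that `k` rounds of forming all `a - b * c / d` yield from the elements of `S`. -/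
def derivedValues (S : Set ℝ) : ℕ → Set ℝ
  | 0 => S
  | k + 1 => {r | ∃ a ∈ derivedValues S k, ∃ b ∈ derivedValues S k, ∃ c ∈ derivedValues S k,
      ∃ d ∈ derivedValues S k, r = a - b * c / d}

theorem zero_mem_derivedValues {S : Set ℝ} (h0 : 0 ∈ S) : ∀ k, 0 ∈ derivedValues S k
  | 0 => h0
  | k + 1 => by
    have h := zero_mem_derivedValues h0 k
    exact ⟨0, h, 0, h, 0, h, 0, h, by simp⟩

theorem derivedValues_mono {S : Set ℝ} (h0 : 0 ∈ S) : Monotone (derivedValues S) := by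
  refine monotone_nat_of_le_succ fun k r hr => ?_
  have h := zero_mem_derivedValues h0 k
  exact ⟨r, hr, 0, h, 0, h, 0, h, by simp⟩

/-- The unique solution of a system of linear equations can be computed by elimination, in one
round of operations for each unknown. -/
theorem solution_mem_derivedValues {ι : Type*} [DecidableEq ι] {S : Set ℝ} (h0 : 0 ∈ S)
    (h1 : 1 ∈ S) (n : ℕ) : ∀ (J : Finset ι), J.card = n → ∀ (k : ℕ) (E : Set ((ι → ℝ) × ℝ)),
      (∀ e ∈ E, (∀ j ∈ J, e.1 j ∈ derivedValues S k) ∧ e.2 ∈ derivedValues S k) →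
      ∀ x : ι → ℝ, (∀ e ∈ E, ∑ j ∈ J, e.1 j * x j + e.2 = 0) →
      (∀ z : ι → ℝ, (∀ e ∈ E, ∑ j ∈ J, e.1 j * z j + e.2 = 0) → ∀ j ∈ J, z j = x j) →
      ∀ i ∈ J, x i ∈ derivedValues S (k + n) := by
  induction n with
  | zero =>
    intro J hJ k E _ x _ _ i hi
    rw [Finset.card_eq_zero] at hJ
    simp [hJ] at hi
  | succ n ih =>
    intro J hJ k E hE x hx huniq i hi
    -- An unknown absent from all equations could be changed at will, against uniqueness.
    have hcoef : ∀ q ∈ J, ∃ p ∈ E, p.1 q ≠ 0 := by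
      intro q hq
      by_contra hcon
      push Not at hcon
      have := huniq (Function.update x q (x q + 1)) (fun e he => ?_) q hq
      · simp at this
      · rw [← hx e he]
        congr 1
        refine Finset.sum_congr rfl fun j _ => ?_
        by_cases hj : j = q
        · subst hj; rw [hcon e he, zero_mul, zero_mul]
        · rw [Function.update_of_ne hj]
    by_cases hq : ∃ q ∈ J, q ≠ i
    · obtain ⟨q, hq, hqi⟩ := hq
      obtain ⟨p, hp, hpq⟩ := hcoef q hq
      have hsplit : ∀ (f : ι → ℝ), ∑ j ∈ J, f j = f q + ∑ j ∈ J.erase q, f j :=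
        fun f => (Finset.add_sum_erase J f hq).symm
      have hred : ∀ (e : (ι → ℝ) × ℝ) (z : ι → ℝ),
          ∑ j ∈ J.erase q, (e.1 j - e.1 q * p.1 j / p.1 q) * z j + (e.2 - e.1 q * p.2 / p.1 q) =
          (∑ j ∈ J.erase q, e.1 j * z j + e.2) -
            e.1 q / p.1 q * (∑ j ∈ J.erase q, p.1 j * z j + p.2) := by
        intro e z
        have : ∀ j, (e.1 j - e.1 q * p.1 j / p.1 q) * z j =
            e.1 j * z j - e.1 q / p.1 q * (p.1 j * z j) := fun j => by ring
        simp only [this, Finset.sum_sub_distrib, ← Finset.mul_sum]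
        ring
      -- The unknown `q` is eliminated from every equation with the pivot `p`. The coefficients of
      -- the new system have the form of one more round of derived values.
      have hres := ih (J.erase q) (by rw [Finset.card_erase_of_mem hq, hJ]; rfl) (k + 1)
        {e' | ∃ e ∈ E, e' = (fun j => e.1 j - e.1 q * p.1 j / p.1 q,
          e.2 - e.1 q * p.2 / p.1 q)} ?_ x ?_ ?_ i (Finset.mem_erase.2 ⟨hqi.symm, hi⟩)
      · rwa [show k + (n + 1) = k + 1 + n by ring]
      · rintro _ ⟨e, he, rfl⟩
        exact ⟨fun j hj => ⟨_, (hE e he).1 j (Finset.mem_of_mem_erase hj), _, (hE e he).1 q hq, _,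
            (hE p hp).1 j (Finset.mem_of_mem_erase hj), _, (hE p hp).1 q hq, rfl⟩,
          ⟨_, (hE e he).2, _, (hE e he).1 q hq, _, (hE p hp).2, _, (hE p hp).1 q hq, rfl⟩⟩
      · rintro _ ⟨e, he, rfl⟩
        have e1 := hx e he
        have e2 := hx p hp
        rw [hsplit] at e1 e2
        rw [hred]
        have e3 : ∑ j ∈ J.erase q, e.1 j * x j + e.2 = - (e.1 q * x q) := by linarith
        have e4 : ∑ j ∈ J.erase q, p.1 j * x j + p.2 = - (p.1 q * x q) := by linarith
        rw [e3, e4]; field_simp; ring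
      · intro z hz j hj
        have hjq := Finset.ne_of_mem_erase hj
        -- Back substitution extends a solution of the reduced system to the full one, so uniqueness
        -- is inherited.
        set z' := Function.update z q (-(∑ j ∈ J.erase q, p.1 j * z j + p.2) / p.1 q) with hz'
        have hz'q : p.1 q * z' q = -(∑ j ∈ J.erase q, p.1 j * z j + p.2) := by
          rw [hz', Function.update_self, mul_div_cancel₀ _ hpq]
        have hz'j : ∀ j ∈ J.erase q, z' j = z j := fun j hj =>
          Function.update_of_ne (Finset.ne_of_mem_erase hj) _ _
        rw [← huniq z' ?_ j (Finset.mem_of_mem_erase hj), hz'j j hj]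
        intro e he
        have := hz _ ⟨e, he, rfl⟩
        rw [hred] at this
        rw [hsplit, Finset.sum_congr rfl fun j hj => by rw [hz'j j hj]]
        have e5 : e.1 q * z' q = - (e.1 q / p.1 q * (∑ j ∈ J.erase q, p.1 j * z j + p.2)) := by
          rw [hz', Function.update_self]; ring
        rw [e5]; linarith
    · push Not at hq
      have hJi : J = {i} := Finset.eq_singleton_iff_unique_mem.2 ⟨hi, hq⟩
      obtain ⟨p, hp, hpi⟩ := hcoef i hi
      have h := hx p hp
      rw [hJi, Finset.sum_singleton] at h
      have hz := zero_mem_derivedValues h0 k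
      have ho : (1 : ℝ) ∈ derivedValues S k := derivedValues_mono h0 (Nat.zero_le k) h1
      refine derivedValues_mono h0 (show k + 1 ≤ k + (n + 1) by omega)
        ⟨0, hz, p.2, (hE p hp).2, 1, ho, p.1 i, (hE p hp).1 i hi, ?_⟩
      field_simp
      linarith

/-- Moving along a line until the first of finitely many affine functions vanishes. -/
theorem exists_first_zero {γ : Type*} [Fintype γ] {h g : γ → ℝ} (hh : ∀ c, 0 ≤ h c)
    (hg : ∀ c, h c = 0 → g c = 0) (hneg : ∃ c, g c < 0) :
    ∃ t, 0 ≤ t ∧ (∀ c, 0 ≤ h c + t * g c) ∧ ∃ c, h c ≠ 0 ∧ h c + t * g c = 0 := by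
  obtain ⟨c, hc, hmin⟩ := (Finset.univ.filter fun c => g c < 0).exists_min_image
    (fun c => h c / -g c) (by obtain ⟨c, hc⟩ := hneg; exact ⟨c, by simpa using hc⟩)
  simp only [Finset.mem_filter, Finset.mem_univ, true_and] at hc hmin
  have ht : 0 ≤ h c / -g c := div_nonneg (hh c) (by linarith)
  refine ⟨h c / -g c, ht, fun c' => ?_, c, fun h0 => hc.ne (hg c h0), ?_⟩
  · by_cases hc' : g c' < 0
    · have := (le_div_iff₀ (neg_pos.2 hc')).1 (hmin c' hc')
      linarith
    · have := mul_nonneg ht (not_lt.1 hc')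
      linarith [hh c']
  · have := hc.ne
    field_simp
    ring

/-! ### Vertices of the polyhedron of best-reply conditions -/

section Vertex

variable {α β : Type*} [Fintype β]

/-- The slacks of the constraints `0 ≤ y b` and `∑ b, A a b * y b ≤ v` at `p = (y, v)`. -/
def slack (A : α → β → ℝ) (p : (β → ℝ) × ℝ) : β ⊕ α → ℝ
  | .inl b => p.1 b
  | .inr a => p.2 - ∑ b, A a b * p.1 b

theorem slack_add_smul (A : α → β → ℝ) (p d : (β → ℝ) × ℝ) (t : ℝ) (c : β ⊕ α) :
    slack A (p + t • d) c = slack A p c + t * slack A d c := by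
  cases c with
  | inl b => simp [slack]
  | inr a =>
    simp only [slack, Prod.fst_add, Prod.snd_add, Prod.smul_fst, Prod.smul_snd, Pi.add_apply,
      Pi.smul_apply, smul_eq_mul, mul_add, Finset.sum_add_distrib, mul_left_comm _ t,
      ← Finset.mul_sum]
    ring

/-- A mixed strategy can be replaced by one with coordinates that are rational in the entries of
`A`, such that no tight constraint is lost and the value does not decrease. -/
theorem exists_derivedValues_vertex [Fintype α] [DecidableEq β] (A : α → β → ℝ) {S : Set ℝ} (h0 : 0 ∈ S)
    (h1 : 1 ∈ S) (h1' : -1 ∈ S) (hA : ∀ a b, A a b ∈ S) {p₀ : (β → ℝ) × ℝ}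
    (hp₀ : p₀.1 ∈ stdSimplex ℝ β) (hs₀ : ∀ c, 0 ≤ slack A p₀ c)
    (ht₀ : ∃ a, slack A p₀ (.inr a) = 0) :
    ∃ p : (β → ℝ) × ℝ, p.1 ∈ stdSimplex ℝ β ∧ (∀ c, 0 ≤ slack A p c) ∧
      (∀ c, slack A p₀ c = 0 → slack A p c = 0) ∧ p₀.2 ≤ p.2 ∧
      ∀ b, p.1 b ∈ derivedValues S (Fintype.card β + 1) := by
  classical
  let P : (β → ℝ) × ℝ → Prop := fun p => ∑ b, p.1 b = 1 ∧ (∀ c, 0 ≤ slack A p c) ∧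
      (∀ c, slack A p₀ c = 0 → slack A p c = 0) ∧ p₀.2 ≤ p.2
  let loose : (β → ℝ) × ℝ → Finset (β ⊕ α) := fun p => Finset.univ.filter fun c => slack A p c ≠ 0
  -- A feasible point with as few loose constraints as possible, among those that keep the tight
  -- constraints of `p₀` and do not lower the value, serves as the vertex.
  obtain ⟨p, hp, hmin⟩ := (measure fun p => (loose p).card).wf.has_min {p | P p}
    ⟨p₀, hp₀.2, hs₀, fun _ h => h, le_rfl⟩
  obtain ⟨hsum, hs, ht, hv⟩ := hp
  obtain ⟨a₀, ha₀⟩ := ht₀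
  -- Along such a direction one could move until another constraint becomes tight, without lowering
  -- the value. The move must stop: if no slack decreases, then `d.1` is nonnegative with sum zero,
  -- and the tight row `a₀` gives `d.2 = 0`.
  have no_dir : ∀ d : (β → ℝ) × ℝ, 0 ≤ d.2 → ∑ b, d.1 b = 0 →
      (∀ c, slack A p c = 0 → slack A d c = 0) → d = 0 := by
    intro d hd2 hdsum hdt
    by_contra hd
    have hneg : ∃ c, slack A d c < 0 := by
      by_contra hcon
      push Not at hcon
      have hd1 : d.1 = 0 := by
        have := (Finset.sum_eq_zero_iff_of_nonneg fun b _ => hcon (.inl b)).1 hdsum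
        ext b
        exact this b (Finset.mem_univ b)
      have := hdt _ (ht _ ha₀)
      simp only [slack, hd1, Pi.zero_apply, mul_zero, Finset.sum_const_zero, sub_zero] at this
      exact hd (Prod.ext hd1 this)
    obtain ⟨t, t0, hnn, c, hc, hc'⟩ := exists_first_zero hs hdt hneg
    have hst := slack_add_smul A p d t
    refine hmin (p + t • d) ⟨?_, ?_, ?_, ?_⟩ ?_
    · simp [Finset.sum_add_distrib, ← Finset.mul_sum, hsum, hdsum]
    · intro c; rw [hst]; exact hnn c
    · intro c hc; rw [hst, ht c hc, hdt c (ht c hc)]; simp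
    · have := mul_nonneg t0 hd2
      simp only [Prod.snd_add, Prod.smul_snd, smul_eq_mul]
      linarith
    · refine Finset.card_lt_card ⟨fun c' hc' => ?_, fun hsub => ?_⟩
      · simp only [loose, Finset.mem_filter, Finset.mem_univ, true_and] at hc' ⊢
        intro h
        rw [hst, h, hdt _ h] at hc'
        simp at hc'
      · have := hsub (show c ∈ loose p by simpa [loose] using hc)
        simp only [loose, Finset.mem_filter, Finset.mem_univ, true_and, hst] at this
        exact this hc'
  refine ⟨p, ⟨fun b => hs (.inl b), hsum⟩, hs, ht, hv, fun b => ?_⟩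
  -- The tight constraints and the normalization. The unknown `none` stands for minus the value, so
  -- a tight row reads `-v + ∑ b, A a b * y b = 0`.
  let E : Set ((Option β → ℝ) × ℝ) := {e | (∃ b, slack A p (.inl b) = 0 ∧
      e = (Pi.single (some b) 1, 0)) ∨ (∃ a, slack A p (.inr a) = 0 ∧
      e = (fun o => o.elim 1 (A a), 0)) ∨ e = (fun o => o.elim 0 fun _ => 1, -1)}
  have hmain := solution_mem_derivedValues h0 h1 (Fintype.card β + 1)
    (Finset.univ : Finset (Option β)) (by simp) 0 E ?_ (fun o => o.elim (-p.2) p.1) ?_ ?_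
    (some b) (Finset.mem_univ _)
  · simpa using hmain
  · rintro e (⟨b, -, rfl⟩ | ⟨a, -, rfl⟩ | rfl)
    · refine ⟨fun j _ => ?_, h0⟩
      by_cases hj : j = some b
      · subst hj; simpa [derivedValues] using h1
      · simpa [derivedValues, hj] using h0
    · refine ⟨fun j _ => ?_, h0⟩
      cases j with
      | none => exact h1
      | some b => exact hA a b
    · refine ⟨fun j _ => ?_, h1'⟩
      cases j with
      | none => exact h0
      | some b => exact h1
  · rintro e (⟨b, hb, rfl⟩ | ⟨a, ha, rfl⟩ | rfl)
    · simpa [Pi.single_apply, slack] using hb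
    · simp only [slack] at ha
      simp only [Fintype.sum_option, Option.elim]
      linarith
    · simp [hsum]
  · intro z hz
    set d : (β → ℝ) × ℝ := (fun b => z (some b) - p.1 b, - z none - p.2) with hd
    have hd1 : ∑ b, d.1 b = 0 := by
      have := hz _ (Or.inr (Or.inr rfl))
      simp only [Fintype.sum_option, Option.elim] at this
      simp only [hd, Finset.sum_sub_distrib, hsum]
      simp at this
      linarith
    have hd2 : ∀ c, slack A p c = 0 → slack A d c = 0 := by
      rintro (b | a) hc
      · have := hz _ (Or.inl ⟨b, hc, rfl⟩)
        simp only [Pi.single_apply, ite_mul, one_mul, zero_mul, Finset.sum_ite_eq',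
          Finset.mem_univ, if_true, add_zero] at this
        simp only [slack] at hc
        simp [slack, hd, this, hc]
      · have := hz _ (Or.inr (Or.inl ⟨a, hc, rfl⟩))
        simp only [Fintype.sum_option, Option.elim] at this
        simp only [slack] at hc
        simp only [slack, hd, mul_sub, Finset.sum_sub_distrib]
        linarith
    have hd0 : d = 0 := by
      -- The difference of two solutions and its negative both respect the tight constraints, and
      -- one of them does not lower the value.
      rcases le_total 0 d.2 with h | h
      · exact no_dir d h hd1 hd2
      · have := no_dir (-d) (by simpa using h) (by simp [hd1]) fun c hc => by
          have h3 := slack_add_smul A 0 d (-1) c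
          have h4 : slack A 0 c = 0 := by cases c <;> simp [slack]
          rw [hd2 c hc, h4] at h3
          simpa using h3
        exact neg_eq_zero.1 this
    intro j _
    cases j with
    | none =>
      have := congrArg Prod.snd hd0
      simp only [hd, Prod.snd_zero] at this
      simp only [Option.elim]; linarith
    | some b =>
      have := congrFun (congrArg Prod.fst hd0) b
      simp only [hd, Prod.fst_zero, Pi.zero_apply] at this
      simp only [Option.elim]; linarith

end Vertex

namespace BimatrixGame

variable {m₁ m₂ : ℕ}

/-- The constraints on each player's strategy involve only the opponent's payoff matrix, so the two
strategies are moved to vertices separately. Supports do not grow and best replies stay best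
replies, so the result is an equilibrium. Its payoffs are not smaller, hence a joint improvement
would also improve on `x`. -/
theorem IsStrongNash.exists_derivedValues {U : BimatrixGame m₁ m₂} {x : Profile m₁ m₂}
    (hx : IsStrongNash U x) {S : Set ℝ} (h0 : 0 ∈ S) (h1 : 1 ∈ S) (h1' : -1 ∈ S)
    (hU : ∀ i, U i ∈ S) :
    ∃ x' : Profile m₁ m₂, IsStrongNash U x' ∧
      (∀ a, x'.1 a ∈ derivedValues S (m₁ + m₂ + 1)) ∧
      ∀ b, x'.2 b ∈ derivedValues S (m₁ + m₂ + 1) := by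
  have hN := hx.1
  have hN' := (isNash_iff U x).1 hN
  obtain ⟨p, hp, hps, hpt, hpv, hpd⟩ := exists_derivedValues_vertex
    (fun (a : Fin m₁) (b : Fin m₂) => U (0, a, b)) h0 h1 h1' (fun _ _ => hU _)
    (p₀ := (x.2, payoff U 0 x)) hN.1.2
    (by rintro (b | a); exacts [hN.1.2.1 b, sub_nonneg.2 (hN'.2.1 a)])
    (by obtain ⟨a, ha⟩ := exists_pos_of_mem_stdSimplex hN.1.1
        exact ⟨a, sub_eq_zero.2 (hN.rowPayoff_eq ha).symm⟩)
  obtain ⟨q, hq, hqs, hqt, hqv, hqd⟩ := exists_derivedValues_vertex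
    (fun (b : Fin m₂) (a : Fin m₁) => U (1, a, b)) h0 h1 h1' (fun _ _ => hU _)
    (p₀ := (x.1, payoff U 1 x)) hN.1.1
    (by rintro (a | b); exacts [hN.1.1.1 a, sub_nonneg.2 (hN'.2.2 b)])
    (by obtain ⟨b, hb⟩ := exists_pos_of_mem_stdSimplex hN.1.2
        exact ⟨b, sub_eq_zero.2 (hN.colPayoff_eq hb).symm⟩)
  -- Complementary slackness: a row outside the old support still has weight zero, and a row inside
  -- it is still tight.
  have e0 : payoff U 0 (q.1, p.1) = p.2 := by
    rw [payoff_zero]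
    have : ∀ a, q.1 a * rowPayoff U p.1 a = q.1 a * p.2 := by
      intro a
      rcases (hN.1.1.1 a).eq_or_lt with h | h
      · have : q.1 a = 0 := hqt (.inl a) h.symm
        simp [this]
      · have : p.2 - rowPayoff U p.1 a = 0 :=
          hpt (.inr a) (sub_eq_zero.2 (hN.rowPayoff_eq h).symm)
        rw [sub_eq_zero.1 this]
    simp only [this, ← Finset.sum_mul, hq.2, one_mul]
  have e1 : payoff U 1 (q.1, p.1) = q.2 := by
    rw [payoff_one]
    have : ∀ b, p.1 b * colPayoff U q.1 b = p.1 b * q.2 := by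
      intro b
      rcases (hN.1.2.1 b).eq_or_lt with h | h
      · have : p.1 b = 0 := hpt (.inl b) h.symm
        simp [this]
      · have : q.2 - colPayoff U q.1 b = 0 :=
          hqt (.inr b) (sub_eq_zero.2 (hN.colPayoff_eq h).symm)
        rw [sub_eq_zero.1 this]
    simp only [this, ← Finset.sum_mul, hp.2, one_mul]
  refine ⟨(q.1, p.1), (isStrongNash_iff U _).2 ⟨(isNash_iff U _).2 ⟨⟨hq, hp⟩, fun a => ?_,
    fun b => ?_⟩, ?_⟩, fun a => ?_, fun b => ?_⟩
  · rw [e0]; exact sub_nonneg.1 (hps (.inr a))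
  · rw [e1]; exact sub_nonneg.1 (hqs (.inr b))
  · rintro ⟨y, hy, hy0, hy1⟩
    rw [e0] at hy0
    rw [e1] at hy1
    exact ((isStrongNash_iff U x).1 hx).2 ⟨y, hy, hpv.trans_lt hy0, hqv.trans_lt hy1⟩
  · exact derivedValues_mono h0 (by simp) (hqd a)
  · exact derivedValues_mono h0 (by simp) (hpd b)

end BimatrixGame

/-! ### Almost all perturbed games are generic -/

/-- A measurable set that meets every line parallel to a coordinate axis in at most one point is a
null set of a product of measures without atoms. -/
theorem pi_null_of_subsingleton_lines {ι : Type*} [Fintype ι] [DecidableEq ι]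
    (μ : ι → Measure ℝ) [∀ i, SigmaFinite (μ i)] [∀ i, NullSingletonClass (μ i)] (i : ι)
    {N : Set (ι → ℝ)} (hN : MeasurableSet N)
    (h : ∀ ω : ι → ℝ, {t | Function.update ω i t ∈ N}.Subsingleton) : Measure.pi μ N = 0 := by
  rw [← lintegral_indicator_one hN]
  -- Fubini in the coordinate `i`: every line meets the set in a null set.
  have := lintegral_eq_of_lmarginal_eq (μ := μ) {i}
    (f := N.indicator 1) (g := 0) (measurable_one.indicator hN) measurable_zero ?_
  · rw [this]; simp
  · ext ω
    rw [lmarginal_singleton, lmarginal_singleton]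
    have h2 : ∀ t, N.indicator (1 : (ι → ℝ) → ENNReal) (Function.update ω i t) =
        {t | Function.update ω i t ∈ N}.indicator 1 t := by
      intro t; simp [Set.indicator]
    simp only [h2]
    rw [lintegral_indicator_one (h ω).measurableSet, (h ω).measure_zero]
    simp

theorem nullSingletonClass_cond_volume (s : Set ℝ) :
    NullSingletonClass (cond (volume : Measure ℝ) s) :=
  ⟨fun x => cond_absolutelyContinuous (measure_singleton x)⟩

theorem isProbabilityMeasure_cond_Icc {σ : ℝ} (hσ : 0 < σ) :
    IsProbabilityMeasure (cond (volume : Measure ℝ) (Set.Icc (-σ) σ)) := by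
  refine cond_isProbabilityMeasure_of_finite ?_ ?_
  · rw [Real.volume_Icc]
    simp only [ne_eq, ENNReal.ofReal_eq_zero, not_le]
    linarith
  · rw [Real.volume_Icc]; exact ENNReal.ofReal_ne_top

namespace BimatrixGame

variable {m₁ m₂ : ℕ}

/-- The set of perturbations after which two given entries coincide is a null set. -/
theorem uniformNoise_entries_eq {σ : ℝ} (hσ : 0 < σ) (U : BimatrixGame m₁ m₂)
    {i j : Fin 2 × Fin m₁ × Fin m₂} (hij : i ≠ j) :
    uniformNoise m₁ m₂ σ {ω | (U + ω) i = (U + ω) j} = 0 := by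
  have := isProbabilityMeasure_cond_Icc hσ
  have := nullSingletonClass_cond_volume (Set.Icc (-σ) σ)
  refine pi_null_of_subsingleton_lines _ i ?_ fun ω t ht t' ht' => ?_
  · exact measurableSet_eq_fun (by simp only [Pi.add_apply]; fun_prop)
      (by simp only [Pi.add_apply]; fun_prop)
  · simp only [Set.mem_ofPred_eq, Pi.add_apply, Function.update_self,
      Function.update_of_ne hij.symm] at ht ht'
    linarith

/-- The set of perturbations after which a given minor vanishes is a null set. -/
theorem uniformNoise_differenceMinor_eq_zero {σ : ℝ} (hσ : 0 < σ) (U : BimatrixGame m₁ m₂)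
    {a a' : Fin m₁} {b b' : Fin m₂} (ha : a ≠ a') (hb : b ≠ b') :
    uniformNoise m₁ m₂ σ {ω | differenceMinor (U + ω) a a' b b' = 0} = 0 := by
  have := isProbabilityMeasure_cond_Icc hσ
  have := nullSingletonClass_cond_volume (Set.Icc (-σ) σ)
  -- The minor is affine in the entry `(1, a, b')`, with slope the difference of the entries `(0, a,
  -- b)` and `(0, a', b)`. Where that slope is nonzero each line has at most one zero; elsewhere two
  -- entries coincide.
  have h1 : uniformNoise m₁ m₂ σ ({ω | (U + ω) (0, a, b) ≠ (U + ω) (0, a', b)} ∩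
      {ω | differenceMinor (U + ω) a a' b b' = 0}) = 0 := by
    refine pi_null_of_subsingleton_lines _ (1, a, b') ?_ fun ω t ht t' ht' => ?_
    · have hm : ∀ i, Measurable fun ω : BimatrixGame m₁ m₂ => (U + ω) i := fun i => by
        simp only [Pi.add_apply]; fun_prop
      refine (measurableSet_eq_fun (hm _) (hm _)).compl.inter
        (measurableSet_eq_fun ?_ measurable_const)
      exact (((hm _).sub (hm _)).mul ((hm _).sub (hm _))).sub
        (((hm _).sub (hm _)).mul ((hm _).sub (hm _)))
    · have e1 : ∀ c d, ((0, c, d) : Fin 2 × Fin m₁ × Fin m₂) ≠ (1, a, b') := by simp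
      have e2 : ((1, a', b') : Fin 2 × Fin m₁ × Fin m₂) ≠ (1, a, b') := by simp [ha.symm]
      have e3 : ∀ c, ((1, c, b) : Fin 2 × Fin m₁ × Fin m₂) ≠ (1, a, b') := by simp [hb]
      simp only [Set.mem_ofPred_eq, Set.mem_inter_iff, differenceMinor, Pi.add_apply,
        Function.update_self, Function.update_of_ne (e1 _ _), Function.update_of_ne e2,
        Function.update_of_ne (e3 _)] at ht ht'
      have h := mul_left_cancel₀ (a := U (0, a, b) + ω (0, a, b) - (U (0, a', b) + ω (0, a', b)))
        (b := t) (c := t') (sub_ne_zero.2 ht.1) (by linarith [ht.2, ht'.2])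
      exact h
  refine measure_mono_null (fun ω hω => ?_) (measure_union_null h1
    (uniformNoise_entries_eq hσ U (i := (0, a, b)) (j := (0, a', b)) (by simp [ha])))
  by_cases h : (U + ω) (0, a, b) = (U + ω) (0, a', b)
  · exact Or.inr h
  · exact Or.inl ⟨h, hω⟩

theorem ae_isGeneric {σ : ℝ} (hσ : 0 < σ) (U : BimatrixGame m₁ m₂) :
    ∀ᵐ ω ∂uniformNoise m₁ m₂ σ, IsGeneric (U + ω) := by
  simp only [IsGeneric, Filter.eventually_and, Filter.eventually_all]
  refine ⟨fun a a' b h => ?_, fun a b b' h => ?_, fun a a' b b' h h' => ?_⟩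
  · rw [ae_iff]
    simpa only [not_not, ne_eq] using uniformNoise_entries_eq hσ U
      (i := (0, a, b)) (j := (0, a', b)) (by simp [h])
  · rw [ae_iff]
    simpa only [not_not, ne_eq] using uniformNoise_entries_eq hσ U
      (i := (1, a, b)) (j := (1, a, b')) (by simp [h])
  · rw [ae_iff]
    simpa only [not_not, ne_eq] using uniformNoise_differenceMinor_eq_zero hσ U h h'

end BimatrixGame

/-! ### Verification of a strategy profile by a program -/

namespace RealRAM

attribute [simp] IExpr.eval RExpr.eval Test.Holds

namespace Test

def or (b c : Test) : Test := .not (.and (.not b) (.not c))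

def le (e f : RExpr) : Test := .not (.realLt f e)

def idxEq (e f : IExpr) : Test := .and (.not (.idxLt e f)) (.not (.idxLt f e))

def any (l : List Test) : Test := l.foldr or (.realLt (.const 0) (.const 0))

@[simp] theorem holds_or {s : State} {b c : Test} : (b.or c).Holds s ↔ b.Holds s ∨ c.Holds s := by
  simp only [or, Holds]; tauto

@[simp] theorem holds_le {s : State} {e f : RExpr} : (le e f).Holds s ↔ e.eval s ≤ f.eval s := by
  simp [le]

@[simp] theorem holds_idxEq {s : State} {e f : IExpr} :
    (idxEq e f).Holds s ↔ e.eval s = f.eval s := by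
  simp only [idxEq, Holds]; omega

@[simp] theorem holds_any {s : State} {l : List Test} :
    (any l).Holds s ↔ ∃ b ∈ l, b.Holds s := by
  induction l with
  | nil => simp [any]
  | cons b l ih =>
    have : any (b :: l) = b.or (any l) := rfl
    simp [this, ih]

end Test

/-- The expressions for `testPoints`. -/
def testPointExprs (f₀ f₁ g₀ g₁ q₁ q₂ : RExpr) : List RExpr :=
  [.const 0, .const 1, .div (.sub (.const 0) f₀) f₁, .div (.sub (.const 0) g₀) g₁,
    .div (.sub (.const 0) q₁) (.mul (.const 2) q₂)]

/-- The test in `exists_pos_iff_testPoints` for two given points. -/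
def pointTest (d : Test) (f₀ f₁ g₀ g₁ q₀ q₁ q₂ c c' : RExpr) : Test :=
  let f := fun c => RExpr.add f₀ (.mul f₁ c)
  let g := fun c => RExpr.add g₀ (.mul g₁ c)
  .and (.and (.le (.const 0) c) (.and (.le c (.const 1))
      (.and (.le (.const 0) c') (.le c' (.const 1)))))
    (.and (.and (.le (.const 0) (f c)) (.and (.le (.const 0) (f c'))
        (.realLt (.const 0) (.add (f c) (f c')))))
      (.and (.and (.le (.const 0) (g c)) (.and (.le (.const 0) (g c'))
          (.realLt (.const 0) (.add (g c) (g c')))))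
        (.or d (.realLt (.const 0) (.add (.add q₀ (.mul q₁ c)) (.mul (.mul q₂ c) c))))))

def quadraticTest (d : Test) (f₀ f₁ g₀ g₁ q₀ q₁ q₂ : RExpr) : Test :=
  .any ((testPointExprs f₀ f₁ g₀ g₁ q₁ q₂).flatMap fun c =>
    (testPointExprs f₀ f₁ g₀ g₁ q₁ q₂).map fun c' => pointTest d f₀ f₁ g₀ g₁ q₀ q₁ q₂ c c')

/-- The disjunction over all 25 pairs of test points is a single test of constant cost. Division by
zero yields zero on both sides, so the expressions evaluate exactly to `testPoints`. -/
theorem quadraticTest_holds (d : Test) (f₀ f₁ g₀ g₁ q₀ q₁ q₂ : RExpr) (s : State) :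
    (quadraticTest d f₀ f₁ g₀ g₁ q₀ q₁ q₂).Holds s ↔
      ∃ r : ℝ, 0 ≤ r ∧ r ≤ 1 ∧ 0 < f₀.eval s + f₁.eval s * r ∧ 0 < g₀.eval s + g₁.eval s * r ∧
        (d.Holds s ∨ 0 < q₀.eval s + q₁.eval s * r + q₂.eval s * r * r) := by
  have h : testPoints (f₀.eval s) (f₁.eval s) (g₀.eval s) (g₁.eval s) (q₁.eval s) (q₂.eval s) =
      (testPointExprs f₀ f₁ g₀ g₁ q₁ q₂).map (RExpr.eval s) := by
    simp [testPoints, testPointExprs]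
  rw [exists_pos_iff_testPoints, h, quadraticTest, Test.holds_any]
  simp only [List.mem_flatMap, List.mem_map, exists_exists_and_eq_and]
  constructor
  · rintro ⟨_, ⟨c, hc, c', hc', rfl⟩, ht⟩
    refine ⟨c, hc, c', hc', ?_⟩
    simpa [pointTest] using ht
  · rintro ⟨c, hc, c', hc', ht⟩
    refine ⟨_, ⟨c, hc, c', hc', rfl⟩, ?_⟩
    simpa [pointTest] using ht

/-- The test for `PairImproves`; the rows are in the registers `2` and `3`, the columns in the
registers `4` and `5`, the payoffs in the arrays `8` and `9`. -/
def pairTest : Test :=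
  let v := RExpr.load 8 (.const 0) (.const 0)
  let w := RExpr.load 9 (.const 0) (.const 0)
  let A := fun i j => RExpr.load 0 (.reg i) (.reg j)
  let B := fun i j => RExpr.load 1 (.reg i) (.reg j)
  -- Along the row mixture, `f` and `h` are the first player's surpluses in the columns `4` and `5`,
  -- and `k` and `g` the second player's. The quadratic passed to the test is `f * g - h * k`.
  let f₀ := RExpr.sub (A 2 4) v
  let f₁ := RExpr.sub (A 3 4) (A 2 4)
  let g₀ := RExpr.sub (B 2 5) w
  let g₁ := RExpr.sub (B 3 5) (B 2 5)
  let h₀ := RExpr.sub (A 2 5) v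
  let h₁ := RExpr.sub (A 3 5) (A 2 5)
  let k₀ := RExpr.sub (B 2 4) w
  let k₁ := RExpr.sub (B 3 4) (B 2 4)
  quadraticTest (.idxEq (.reg 4) (.reg 5)) f₀ f₁ g₀ g₁ (.sub (.mul f₀ g₀) (.mul h₀ k₀))
    (.sub (.add (.mul f₀ g₁) (.mul f₁ g₀)) (.add (.mul h₀ k₁) (.mul h₁ k₀)))
    (.sub (.mul f₁ g₁) (.mul h₁ k₁))

theorem pairTest_holds (s : State) : pairTest.Holds s ↔
    PairImproves (s.arr 0) (s.arr 1) (s.arr 8 0 0) (s.arr 9 0 0)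
      (s.idx 2) (s.idx 3) (s.idx 4) (s.idx 5) := by
  rw [pairTest, quadraticTest_holds, PairImproves]
  simp only [Test.holds_idxEq, RExpr.eval, IExpr.eval]
  refine exists_congr fun r => and_congr_right fun _ => and_congr_right fun _ => ?_
  refine and_congr ?_ (and_congr ?_ (or_congr Iff.rfl ?_))
  · rw [iff_iff_eq]; congr 1; ring
  · rw [iff_iff_eq]; congr 1; ring
  · rw [← sub_pos (b := _ * _), iff_iff_eq]; congr 1; ring

/-- Run a test for all pairs of rows (registers `2` and `3`) and all pairs of columns (registers
`4` and `5`); register `6` is cleared if some test fails. -/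
def forAllPairs (b : Test) : Program :=
  forLoop 2 (.reg 0) <| forLoop 3 (.reg 0) <| forLoop 4 (.reg 1) <| forLoop 5 (.reg 1) <|
    .branch b .skip (.setIdx 6 (.const 0))

noncomputable def forAllPairsCost (b : Test) (m₁ m₂ : ℕ) : ℕ∞ :=
  forCost m₁ (.reg 0) <| forCost m₁ (.reg 0) <| forCost m₂ (.reg 1) <| forCost m₂ (.reg 1) <|
    (b.cost + 2 : ℕ)

/-- The loops change no array, so the outcome of the test depends only on the four counters;
register `6` is never set again once cleared. -/
theorem Spec.forAllPairs {b : Test} {s : State} {P : ℕ → ℕ → ℕ → ℕ → Prop}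
    (hb : ∀ s', s'.arr = s.arr →
      (b.Holds s' ↔ P (s'.idx 2) (s'.idx 3) (s'.idx 4) (s'.idx 5))) :
    Spec (forAllPairs b) s (forAllPairsCost b (s.idx 0) (s.idx 1)) fun s' =>
      (s'.idx 6 ≠ 0 ↔ s.idx 6 ≠ 0 ∧ ∀ i < s.idx 0, ∀ i' < s.idx 0, ∀ j < s.idx 1, ∀ j' < s.idx 1,
        P i i' j j') := by
  let I : State → Prop := fun s' => s'.arr = s.arr ∧ s'.idx 0 = s.idx 0 ∧ s'.idx 1 = s.idx 1
  let φ : State → Prop := fun s' => s'.idx 6 ≠ 0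
  refine (Spec.forAll (s.idx 0) I φ _ ?_ ?_ ?_ ?_ ⟨rfl, rfl, rfl⟩ ?_).imp fun s' h => h.2
  · simp [modIdx_forLoop, Program.ModIdx]
  · rintro s' i h; simpa [I] using h
  · simp [φ]
  · exact fun s' h => h.2.1
  intro i hi s₁ h₁ hi₁
  refine (Spec.forAll (s.idx 0) (fun s' => I s' ∧ s'.idx 2 = i) φ _ ?_ ?_ ?_ ?_ ⟨h₁, hi₁⟩ ?_).imp
    fun s' h => ⟨h.1.1, h.2⟩
  · simp [modIdx_forLoop, Program.ModIdx]
  · rintro s' i h; simpa [I] using h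
  · simp [φ]
  · exact fun s' h => h.1.2.1
  intro i' hi' s₂ h₂ hi₂
  refine (Spec.forAll (s.idx 1) (fun s' => I s' ∧ s'.idx 2 = i ∧ s'.idx 3 = i') φ _ ?_ ?_ ?_ ?_
    ⟨h₂.1, h₂.2, hi₂⟩ ?_).imp fun s' h => ⟨⟨h.1.1, h.1.2.1⟩, h.2⟩
  · simp [modIdx_forLoop, Program.ModIdx]
  · rintro s' i h; simpa [I] using h
  · simp [φ]
  · exact fun s' h => h.1.2.2
  intro j hj s₃ h₃ hi₃
  refine (Spec.forAll (s.idx 1) (fun s' => I s' ∧ s'.idx 2 = i ∧ s'.idx 3 = i' ∧ s'.idx 4 = j) φ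
    (P i i' j) ?_ ?_ ?_ ?_ ⟨h₃.1, h₃.2.1, h₃.2.2, hi₃⟩ ?_).imp
    fun s' h => ⟨⟨h.1.1, h.1.2.1, h.1.2.2.1⟩, h.2⟩
  · simp [Program.ModIdx]
  · rintro s' i h; simpa [I] using h
  · simp [φ]
  · exact fun s' h => h.1.2.2
  rintro j' hj' s₄ ⟨h₄, hi, hi', hj⟩ hj'
  have hP := hb s₄ h₄.1
  rw [hi, hi', hj, hj'] at hP
  refine (Spec.branch (T := 1) (T' := 2) (fun h => Spec.skip ?_)
    (fun h => (Spec.setIdx ?_).mono (by norm_num [IExpr.cost]) fun _ h => h)).mono ?_ fun _ h => h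
  · exact ⟨⟨h₄, hi, hi', hj⟩, by rw [← hP]; tauto⟩
  · refine ⟨by simpa [I, hi, hi', hj] using h₄, ?_⟩
    rw [← hP]; simp [φ, h]
  · push_cast
    gcongr
    norm_num

/-- Each inner sum writes to only one cell of row `0`, so the earlier sums survive. -/
theorem Spec.sumRows {k k' : ℕ} {e e' : IExpr} {a : ℕ} {f : RExpr} {s : State} (hkk : k ≠ k')
    (n n' : ℕ) (F : ℕ → ℕ → ℝ)
    (he : ∀ s', (∀ r, r ≠ k → r ≠ k' → s'.idx r = s.idx r) → e.eval s' = n)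
    (he' : ∀ s', (∀ r, r ≠ k → r ≠ k' → s'.idx r = s.idx r) → e'.eval s' = n')
    (hf : ∀ l < n, ∀ l' < n', ∀ s', (∀ r, r ≠ k → r ≠ k' → s'.idx r = s.idx r) →
      (∀ a' ≠ a, s'.arr a' = s.arr a') → s'.idx k = l → s'.idx k' = l' → f.eval s' = F l l') :
    Spec (RealRAM.forLoop k e (RealRAM.sumLoop k' e' a (.const 0) (.reg k) f)) s
      (forCost n e (sumCost n' e' (.const 0) (.reg k) f)) fun s' =>
        ∀ l < n, s'.arr a 0 l = ∑ l' ∈ Finset.range n', F l l' := by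
  refine (Spec.forLoop n (fun i s' => (∀ r, r ≠ k → r ≠ k' → s'.idx r = s.idx r) ∧
    (∀ a' ≠ a, s'.arr a' = s.arr a') ∧
    ∀ l < i, s'.arr a 0 l = ∑ l' ∈ Finset.range n', F l l') ?_ ?_ ?_ ?_).imp fun s' h => h.2.2
  · simp [modIdx_sumLoop, hkk]
  · exact ⟨fun r hr _ => by simp [hr], fun _ _ => rfl, by simp⟩
  · exact fun i s' h => he s' h.1
  rintro i hi s₁ ⟨h1, h2, h3⟩ hk
  have tr : ∀ s' : State, (∀ r ≠ k', s'.idx r = s₁.idx r) →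
      ∀ r, r ≠ k → r ≠ k' → s'.idx r = s.idx r := fun s' h r hr hr' => (h r hr').trans (h1 r hr hr')
  refine (Spec.sumLoop (j := .reg k) n' 0 i (F i) (fun s' h => he' s' (tr s' h))
    (fun _ _ => rfl) (fun s' h => (h k hkk).trans hk) fun l' hl' s' h hkl ha => ?_).imp ?_
  · exact hf i hi l' hl' s' (tr s' h) (fun a' ha' => (ha a' ha').trans (h2 a' ha'))
      ((h k hkk).trans hk) hkl
  · rintro s' ⟨h4, h5, h6, h7⟩
    refine ⟨fun r hr hr' => by simp [hr, tr s' h4 r hr hr'], fun a' ha' => ?_, fun l hl => ?_⟩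
    · simp [h5 a' ha', h2 a' ha']
    · rcases Nat.lt_succ_iff_lt_or_eq.1 hl with hl | rfl
      · rw [State.writeIdx_arr, h6 0 l (by omega), h3 l hl]
      · exact h7

/-! ### The checking program -/

/-- The final test of `check`. -/
def checkTest : Test :=
  let zero := IExpr.const 0
  .and (.and (.le (.const 0) (.load 2 zero (.reg 2))) (.le (.const 0) (.load 2 (.const 1) (.reg 4))))
    (.and (.and (.le (.load 5 zero zero) (.const 1)) (.le (.const 1) (.load 5 zero zero)))
      (.and (.and (.le (.load 6 zero zero) (.const 1)) (.le (.const 1) (.load 6 zero zero)))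
        (.and (.and (.le (.load 3 zero (.reg 2)) (.load 8 zero zero))
            (.le (.load 4 zero (.reg 4)) (.load 9 zero zero)))
          (.not pairTest))))

/-- Test whether the profile in the rows `0` and `1` of the array `2` is a strong Nash
equilibrium, and set register `6` accordingly. -/
def check : Program :=
  -- Arrays `3` and `4` receive the payoffs of the pure actions, `5` and `6` the total weights of
  -- the strategies, `8` and `9` the expected payoffs.
  .seq (forLoop 2 (.reg 0) (sumLoop 4 (.reg 1) 3 (.const 0) (.reg 2)
    (.mul (.load 0 (.reg 2) (.reg 4)) (.load 2 (.const 1) (.reg 4))))) <|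
  .seq (forLoop 4 (.reg 1) (sumLoop 2 (.reg 0) 4 (.const 0) (.reg 4)
    (.mul (.load 1 (.reg 2) (.reg 4)) (.load 2 (.const 0) (.reg 2))))) <|
  .seq (sumLoop 2 (.reg 0) 5 (.const 0) (.const 0) (.load 2 (.const 0) (.reg 2))) <|
  .seq (sumLoop 4 (.reg 1) 6 (.const 0) (.const 0) (.load 2 (.const 1) (.reg 4))) <|
  .seq (sumLoop 2 (.reg 0) 8 (.const 0) (.const 0)
    (.mul (.load 2 (.const 0) (.reg 2)) (.load 3 (.const 0) (.reg 2)))) <|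
  .seq (sumLoop 4 (.reg 1) 9 (.const 0) (.const 0)
    (.mul (.load 2 (.const 1) (.reg 4)) (.load 4 (.const 0) (.reg 4)))) <|
  .seq (.setIdx 6 (.const 1)) (forAllPairs checkTest)

theorem modIdx_check {k : ℕ} : check.ModIdx k ↔ k ∈ [2, 3, 4, 5, 6] := by
  simp only [check, Program.ModIdx, modIdx_sumLoop, forAllPairs, modIdx_forLoop, List.mem_cons,
    List.not_mem_nil, or_false, false_or]
  tauto

theorem modArr_check {a : ℕ} : check.ModArr a ↔ a ∈ [3, 4, 5, 6, 8, 9] := by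
  simp only [check, Program.ModArr, modArr_sumLoop, forAllPairs, modArr_forLoop, List.mem_cons,
    List.not_mem_nil, or_false, or_self]

/-- The condition that `check` tests. -/
def CheckHolds (m₁ m₂ : ℕ) (A B : ℕ → ℕ → ℝ) (x y : ℕ → ℝ) : Prop :=
  ∀ a < m₁, ∀ a' < m₁, ∀ b < m₂, ∀ b' < m₂, (0 ≤ x a ∧ 0 ≤ y b) ∧
    ∑ i ∈ Finset.range m₁, x i = 1 ∧ ∑ j ∈ Finset.range m₂, y j = 1 ∧
    (∑ j ∈ Finset.range m₂, A a j * y j ≤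
        ∑ i ∈ Finset.range m₁, x i * ∑ j ∈ Finset.range m₂, A i j * y j ∧
      ∑ i ∈ Finset.range m₁, B i b * x i ≤
        ∑ j ∈ Finset.range m₂, y j * ∑ i ∈ Finset.range m₁, B i j * x i) ∧
    ¬ PairImproves A B (∑ i ∈ Finset.range m₁, x i * ∑ j ∈ Finset.range m₂, A i j * y j)
      (∑ j ∈ Finset.range m₂, y j * ∑ i ∈ Finset.range m₁, B i j * x i) a a' b b'

noncomputable def checkCost (m₁ m₂ : ℕ) : ℕ∞ :=
  forCost m₁ (.reg 0) (sumCost m₂ (.reg 1) (.const 0) (.reg 2)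
    (.mul (.load 0 (.reg 2) (.reg 4)) (.load 2 (.const 1) (.reg 4)))) +
  (forCost m₂ (.reg 1) (sumCost m₁ (.reg 0) (.const 0) (.reg 4)
    (.mul (.load 1 (.reg 2) (.reg 4)) (.load 2 (.const 0) (.reg 2)))) +
  (sumCost m₁ (.reg 0) (.const 0) (.const 0) (.load 2 (.const 0) (.reg 2)) +
  (sumCost m₂ (.reg 1) (.const 0) (.const 0) (.load 2 (.const 1) (.reg 4)) +
  (sumCost m₁ (.reg 0) (.const 0) (.const 0)
    (.mul (.load 2 (.const 0) (.reg 2)) (.load 3 (.const 0) (.reg 2))) +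
  (sumCost m₂ (.reg 1) (.const 0) (.const 0)
    (.mul (.load 2 (.const 1) (.reg 4)) (.load 4 (.const 0) (.reg 4))) +
  (2 + forAllPairsCost checkTest m₁ m₂))))))

theorem Spec.check_holds (s : State) (m₁ m₂ : ℕ) (hm₁ : s.idx 0 = m₁) (hm₂ : s.idx 1 = m₂) :
    Spec check s (checkCost m₁ m₂) fun s' => (s'.idx 6 ≠ 0 ↔
      CheckHolds m₁ m₂ (s.arr 0) (s.arr 1) (s.arr 2 0) (s.arr 2 1)) := by
  refine Spec.seq ((Spec.sumRows (show 2 ≠ 4 by norm_num) m₁ m₂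
    (fun i j => s.arr 0 i j * s.arr 2 1 j) ?_ ?_ ?_).frame.imp ?_)
  · intro s' h; simp [h, hm₁]
  · intro s' h; simp [h, hm₂]
  · intro i _ j _ s' _ h hi hj; simp [h, hi, hj]
  rintro s₁ ⟨r₁, i₁, a₁⟩
  replace i₁ : ∀ k, k ≠ 2 → k ≠ 4 → s₁.idx k = s.idx k := fun k h2 h4 =>
    i₁ k (by simp [modIdx_sumLoop, modIdx_forLoop, h2, h4])
  replace a₁ : ∀ k, k ≠ 3 → s₁.arr k = s.arr k := fun k h =>
    a₁ k (by simp [modArr_sumLoop, modArr_forLoop, h])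
  refine Spec.seq ((Spec.sumRows (show 4 ≠ 2 by norm_num) m₂ m₁
    (fun j i => s.arr 1 i j * s.arr 2 0 i) ?_ ?_ ?_).frame.imp ?_)
  · intro s' h; simp [h, i₁, hm₂]
  · intro s' h; simp [h, i₁, hm₁]
  · intro i _ j _ s' _ h hi hj; simp [h, hi, hj, a₁]
  rintro s₂ ⟨r₂, i₂, a₂⟩
  replace i₂ : ∀ k, k ≠ 2 → k ≠ 4 → s₂.idx k = s.idx k := fun k h2 h4 =>
    (i₂ k (by simp [modIdx_sumLoop, modIdx_forLoop, h2, h4])).trans (i₁ k h2 h4)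
  replace a₂ : ∀ k, k ≠ 4 → s₂.arr k = s₁.arr k := fun k h =>
    a₂ k (by simp [modArr_sumLoop, modArr_forLoop, h])
  refine Spec.seq ((Spec.sumLoop m₁ 0 0 (s.arr 2 0) ?_ (by simp) (by simp) ?_).frame.imp ?_)
  · intro s' h; simp [h, i₂, hm₁]
  · intro i _ s' _ hi ha; simp [hi, ha, a₂, a₁]
  rintro s₃ ⟨⟨-, -, -, r₃⟩, i₃, a₃⟩
  replace i₃ : ∀ k, k ≠ 2 → k ≠ 4 → s₃.idx k = s.idx k := fun k h2 h4 =>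
    (i₃ k (by simp [modIdx_sumLoop, h2])).trans (i₂ k h2 h4)
  replace a₃ : ∀ k, k ≠ 5 → s₃.arr k = s₂.arr k := fun k h =>
    a₃ k (by simp [modArr_sumLoop, h])
  refine Spec.seq ((Spec.sumLoop m₂ 0 0 (s.arr 2 1) ?_ (by simp) (by simp) ?_).frame.imp ?_)
  · intro s' h; simp [h, i₃, hm₂]
  · intro i _ s' _ hi ha; simp [hi, ha, a₃, a₂, a₁]
  rintro s₄ ⟨⟨-, -, -, r₄⟩, i₄, a₄⟩
  replace i₄ : ∀ k, k ≠ 2 → k ≠ 4 → s₄.idx k = s.idx k := fun k h2 h4 =>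
    (i₄ k (by simp [modIdx_sumLoop, h4])).trans (i₃ k h2 h4)
  replace a₄ : ∀ k, k ≠ 6 → s₄.arr k = s₃.arr k := fun k h =>
    a₄ k (by simp [modArr_sumLoop, h])
  refine Spec.seq ((Spec.sumLoop m₁ 0 0 (fun i => s.arr 2 0 i * ∑ j ∈ Finset.range m₂,
    s.arr 0 i j * s.arr 2 1 j) ?_ (by simp) (by simp) ?_).frame.imp ?_)
  · intro s' h; simp [h, i₄, hm₁]
  · intro i hi' s' _ hi ha; simp [hi, ha, a₄, a₃, a₂, a₁, r₁ i hi']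
  rintro s₅ ⟨⟨-, -, -, r₅⟩, i₅, a₅⟩
  replace i₅ : ∀ k, k ≠ 2 → k ≠ 4 → s₅.idx k = s.idx k := fun k h2 h4 =>
    (i₅ k (by simp [modIdx_sumLoop, h2])).trans (i₄ k h2 h4)
  replace a₅ : ∀ k, k ≠ 8 → s₅.arr k = s₄.arr k := fun k h =>
    a₅ k (by simp [modArr_sumLoop, h])
  refine Spec.seq ((Spec.sumLoop m₂ 0 0 (fun j => s.arr 2 1 j * ∑ i ∈ Finset.range m₁,
    s.arr 1 i j * s.arr 2 0 i) ?_ (by simp) (by simp) ?_).frame.imp ?_)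
  · intro s' h; simp [h, i₅, hm₂]
  · intro i hi' s' _ hi ha; simp [hi, ha, a₅, a₄, a₃, a₂, a₁, r₂ i hi']
  rintro s₆ ⟨⟨-, -, -, r₆⟩, i₆, a₆⟩
  replace i₆ : ∀ k, k ≠ 2 → k ≠ 4 → s₆.idx k = s.idx k := fun k h2 h4 =>
    (i₆ k (by simp [modIdx_sumLoop, h4])).trans (i₅ k h2 h4)
  replace a₆ : ∀ k, k ≠ 9 → s₆.arr k = s₅.arr k := fun k h =>
    a₆ k (by simp [modArr_sumLoop, h])
  refine Spec.seq (T := 2) ((Spec.setIdx ?_).mono (by norm_num [IExpr.cost]) fun _ h => h)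
  let P : ℕ → ℕ → ℕ → ℕ → Prop := fun a a' b b' =>
    (0 ≤ s₆.arr 2 0 a ∧ 0 ≤ s₆.arr 2 1 b) ∧ s₆.arr 5 0 0 = 1 ∧ s₆.arr 6 0 0 = 1 ∧
      (s₆.arr 3 0 a ≤ s₆.arr 8 0 0 ∧ s₆.arr 4 0 b ≤ s₆.arr 9 0 0) ∧
      ¬ PairImproves (s₆.arr 0) (s₆.arr 1) (s₆.arr 8 0 0) (s₆.arr 9 0 0) a a' b b'
  have hfin := Spec.forAllPairs (b := checkTest) (s := s₆.writeIdx 6 ((IExpr.const 1).eval s₆))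
    (P := P) ?_
  · simp only [State.writeIdx_idx, i₆ 0 (by norm_num) (by norm_num),
      i₆ 1 (by norm_num) (by norm_num), hm₁, hm₂] at hfin
    refine hfin.imp fun s' h => ?_
    rw [h]
    simp only [IExpr.eval, if_true, ne_eq, one_ne_zero, not_false_eq_true, true_and, CheckHolds]
    refine forall₂_congr fun a ha => forall₂_congr fun a' ha' => forall₂_congr fun b hb =>
      forall₂_congr fun b' hb' => ?_
    simp [P, a₆, a₅, a₄, a₃, a₂, a₁, r₁ a ha, r₂ b hb, r₃, r₄, r₅, r₆]
  · intro s' hs'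
    simp only [State.writeIdx_arr] at hs'
    simp only [checkTest, Test.Holds, Test.holds_le, pairTest_holds, RExpr.eval, IExpr.eval, hs', P,
      ← le_antisymm_iff, Rat.cast_zero, Rat.cast_one]

/-- The state contains the game `U`, and the numbers of actions. -/
def Encodes {m₁ m₂ : ℕ} (U : BimatrixGame m₁ m₂) (s : State) : Prop :=
  s.idx 0 = m₁ ∧ s.idx 1 = m₂ ∧ (∀ (a : Fin m₁) (b : Fin m₂), s.arr 0 a b = U (0, a, b)) ∧
    ∀ (a : Fin m₁) (b : Fin m₂), s.arr 1 a b = U (1, a, b)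

/-- The profile in the array `2`. -/
def profileOf (m₁ m₂ : ℕ) (s : State) : Profile m₁ m₂ := (fun a => s.arr 2 0 a, fun b => s.arr 2 1 b)

/-- All conditions, including the normalization of the strategies, are tested inside the loop over
quadruples of actions. Both action sets must be nonempty for this loop to run at all. -/
theorem checkHolds_iff {m₁ m₂ : ℕ} (hm₁ : 1 ≤ m₁) (hm₂ : 1 ≤ m₂) {U : BimatrixGame m₁ m₂}
    {A B : ℕ → ℕ → ℝ} (hA : ∀ (a : Fin m₁) (b : Fin m₂), A a b = U (0, a, b))
    (hB : ∀ (a : Fin m₁) (b : Fin m₂), B a b = U (1, a, b)) (x y : ℕ → ℝ) :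
    CheckHolds m₁ m₂ A B x y ↔ U.IsStrongNash (fun a => x a, fun b => y b) := by
  rw [BimatrixGame.isStrongNash_iff, BimatrixGame.isNash_iff,
    BimatrixGame.exists_improvement_iff U A B hA hB, BimatrixGame.payoff_zero,
    BimatrixGame.payoff_one]
  simp only [CheckHolds, Finset.sum_range, BimatrixGame.rowPayoff, BimatrixGame.colPayoff,
    BimatrixGame.IsMixed, hA, hB, not_exists]
  constructor
  · intro h
    have a₀ : Fin m₁ := ⟨0, hm₁⟩
    have b₀ : Fin m₂ := ⟨0, hm₂⟩
    have h' := fun (a a' : Fin m₁) (b b' : Fin m₂) =>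
      h a a.2 a' a'.2 b b.2 b' b'.2
    simp only [hA, hB] at h'
    exact ⟨⟨⟨⟨fun a => (h' a a₀ b₀ b₀).1.1, (h' a₀ a₀ b₀ b₀).2.1⟩,
      ⟨fun b => (h' a₀ a₀ b b₀).1.2, (h' a₀ a₀ b₀ b₀).2.2.1⟩⟩,
      fun a => (h' a a₀ b₀ b₀).2.2.2.1.1, fun b => (h' a₀ a₀ b b₀).2.2.2.1.2⟩,
      fun a a' b b' => (h' a a' b b').2.2.2.2⟩
  · rintro ⟨⟨⟨⟨h1, h2⟩, h3, h4⟩, h5, h6⟩, h7⟩ a ha a' ha' b hb b' hb'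
    have h5' := h5 ⟨a, ha⟩
    have h6' := h6 ⟨b, hb⟩
    simp only [← hA, ← hB] at h5' h6'
    simp only [← hA, ← hB] at h7
    simp only [← hA, ← hB]
    exact ⟨⟨h1 ⟨a, ha⟩, h3 ⟨b, hb⟩⟩, h2, h4, ⟨h5', h6'⟩, h7 ⟨a, ha⟩ ⟨a', ha'⟩ ⟨b, hb⟩ ⟨b', hb'⟩⟩

theorem Spec.check {m₁ m₂ : ℕ} (hm₁ : 1 ≤ m₁) (hm₂ : 1 ≤ m₂) {U : BimatrixGame m₁ m₂} {s : State}
    (hs : Encodes U s) :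
    Spec RealRAM.check s (checkCost m₁ m₂) fun s' => (s'.idx 6 ≠ 0 ↔ U.IsStrongNash (profileOf m₁ m₂ s)) :=
  (Spec.check_holds s m₁ m₂ hs.1 hs.2.1).imp fun _ h =>
    h.trans (checkHolds_iff hm₁ hm₂ hs.2.2.1 hs.2.2.2 _ _)

end RealRAM

/-! ### Search for pure strong Nash equilibria, and the test for genericity -/

namespace RealRAM

theorem Encodes.of_eq {m₁ m₂ : ℕ} {U : BimatrixGame m₁ m₂} {s s' : State} (h : Encodes U s)
    (h0 : s'.idx 0 = s.idx 0) (h1 : s'.idx 1 = s.idx 1) (ha0 : s'.arr 0 = s.arr 0)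
    (ha1 : s'.arr 1 = s.arr 1) : Encodes U s' := by
  rw [Encodes, h0, h1, ha0, ha1]; exact h

/-- Register `7` tells whether the array `2` contains a strong Nash equilibrium; if not, then the
array `2` is still empty. -/
def SearchState {m₁ m₂ : ℕ} (U : BimatrixGame m₁ m₂) (s : State) : Prop :=
  Encodes U s ∧ (s.idx 7 = 0 → s.arr 2 = fun _ _ => 0) ∧
    (s.idx 7 ≠ 0 → U.IsStrongNash (profileOf m₁ m₂ s))

theorem SearchState.writeIdx {m₁ m₂ : ℕ} {U : BimatrixGame m₁ m₂} {s : State}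
    (h : SearchState U s) {k : ℕ} (h0 : k ≠ 0) (h1 : k ≠ 1) (h7 : k ≠ 7) (n : ℕ) :
    SearchState U (s.writeIdx k n) := by
  refine ⟨h.1.of_eq (by simp [h0.symm]) (by simp [h1.symm]) rfl rfl, fun h' => h.2.1 ?_,
    fun h' => h.2.2 ?_⟩
  · simpa [h7.symm] using h'
  · simpa [h7.symm] using h'

/-- Check the pure profile given by the registers `10` and `11`. -/
def tryPure : Program :=
  .branch (.idxLt (.const 0) (.reg 7)) .skip <|
  .seq (.setArr 2 (.const 0) (.reg 10) (.const 1)) <|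
  .seq (.setArr 2 (.const 1) (.reg 11) (.const 1)) <|
  .seq check <|
  .branch (.idxLt (.const 0) (.reg 6)) (.setIdx 7 (.const 1))
    (.seq (.setArr 2 (.const 0) (.reg 10) (.const 0)) (.setArr 2 (.const 1) (.reg 11) (.const 0)))

theorem modIdx_tryPure {k : ℕ} : tryPure.ModIdx k ↔ k ∈ [2, 3, 4, 5, 6, 7] := by
  simp only [tryPure, Program.ModIdx, modIdx_check, List.mem_cons, List.not_mem_nil, or_false,
    false_or]
  tauto

noncomputable def tryPureCost (m₁ m₂ : ℕ) : ℕ∞ := 3 + (4 + (4 + (checkCost m₁ m₂ + 11)))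

/-- The pure profile of the actions with numbers `a` and `b`. -/
def pureProfile (m₁ m₂ a b : ℕ) : Profile m₁ m₂ :=
  (fun k => if (k : ℕ) = a then 1 else 0, fun k => if (k : ℕ) = b then 1 else 0)

/-- Since the array `2` is zero before, writing two ones produces a pure profile in constant time;
erasing them after a failure restores the invariant. -/
theorem Spec.tryPure {m₁ m₂ : ℕ} (hm₁ : 1 ≤ m₁) (hm₂ : 1 ≤ m₂) {U : BimatrixGame m₁ m₂} {s : State}
    (hs : SearchState U s) {a b : ℕ} (ha : s.idx 10 = a) (hb : s.idx 11 = b) :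
    Spec tryPure s (tryPureCost m₁ m₂) fun s' => SearchState U s' ∧
      (s'.idx 7 = 0 ↔ s.idx 7 = 0 ∧ ¬ U.IsStrongNash (pureProfile m₁ m₂ a b)) := by
  refine (Spec.branch (T := 4 + (4 + (checkCost m₁ m₂ + 11)))
    (T' := 4 + (4 + (checkCost m₁ m₂ + 11))) (fun h => ?_) (fun h => ?_)).mono ?_ fun _ h => h
  · simp only [Test.Holds, IExpr.eval] at h
    refine (Spec.skip ⟨hs, ?_⟩).mono (le_add_right (by norm_num)) fun _ h => h
    simp [h.ne']
  · replace h : s.idx 7 = 0 := by simpa using h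
    refine Spec.seq ((Spec.setArr ?_).mono (by norm_num [IExpr.cost, RExpr.cost]) fun _ h => h)
    refine Spec.seq ((Spec.setArr ?_).mono (by norm_num [IExpr.cost, RExpr.cost]) fun _ h => h)
    simp only [IExpr.eval, RExpr.eval, State.writeArr_idx, ha, hb]
    set s₁ := (s.writeArr 2 0 a ((1 : ℚ) : ℝ)).writeArr 2 1 b ((1 : ℚ) : ℝ) with hs₁
    have e₁ : Encodes U s₁ := hs.1.of_eq rfl rfl (by simp [hs₁, State.writeArr])
      (by simp [hs₁, State.writeArr])
    have p₁ : profileOf m₁ m₂ s₁ = pureProfile m₁ m₂ a b := by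
      simp [profileOf, pureProfile, hs₁, State.writeArr_arr, hs.2.1 h]
    refine Spec.seq ((Spec.check hm₁ hm₂ e₁).frame.imp ?_)
    rintro s₂ ⟨h₂, i₂, a₂⟩
    rw [p₁] at h₂
    have a₂' : s₂.arr 2 = s₁.arr 2 := a₂ 2 (by simp [modArr_check])
    have i₂' : ∀ k, k ≠ 2 → k ≠ 3 → k ≠ 4 → k ≠ 5 → k ≠ 6 → s₂.idx k = s.idx k :=
      fun k h2 h3 h4 h5 h6 => i₂ k (by simp [modIdx_check, h2, h3, h4, h5, h6])
    have e₂ : Encodes U s₂ := e₁.of_eq (i₂ 0 (by simp [modIdx_check]))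
      (i₂ 1 (by simp [modIdx_check])) (a₂ 0 (by simp [modArr_check])) (a₂ 1 (by simp [modArr_check]))
    have h10 : s₂.idx 10 = a := by rw [i₂' 10 (by norm_num) (by norm_num) (by norm_num)
      (by norm_num) (by norm_num), ha]
    have h11 : s₂.idx 11 = b := by rw [i₂' 11 (by norm_num) (by norm_num) (by norm_num)
      (by norm_num) (by norm_num), hb]
    have h7 : s₂.idx 7 = 0 := by rw [i₂' 7 (by norm_num) (by norm_num) (by norm_num)
      (by norm_num) (by norm_num), h]
    refine (Spec.branch (T := 8) (T' := 8) (fun h' => ?_) (fun h' => ?_)).mono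
      (by norm_num [Test.cost, IExpr.cost]) fun _ h => h
    · refine (Spec.setIdx ?_).mono (by norm_num [IExpr.cost]) fun _ h => h
      have hst : U.IsStrongNash (pureProfile m₁ m₂ a b) :=
        h₂.1 (by simpa [Nat.pos_iff_ne_zero] using h')
      refine ⟨⟨e₂.of_eq (by simp) (by simp) rfl rfl, by simp, fun _ => ?_⟩, by simp [hst]⟩
      have : profileOf m₁ m₂ (s₂.writeIdx 7 ((IExpr.const 1).eval s₂)) = profileOf m₁ m₂ s₁ := by
        simp [profileOf, a₂']
      rwa [this, p₁]
    · have hst : ¬ U.IsStrongNash (pureProfile m₁ m₂ a b) := by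
        rw [← h₂]; simpa [Nat.pos_iff_ne_zero] using h'
      refine (Spec.seq (Spec.setArr (Spec.setArr ?_))).mono
        (by norm_num [IExpr.cost, RExpr.cost]) fun _ h => h
      simp only [IExpr.eval, RExpr.eval, State.writeArr_idx, h10, h11]
      refine ⟨⟨e₂.of_eq rfl rfl (by simp [State.writeArr]) (by simp [State.writeArr]),
        fun _ => ?_, fun h' => absurd h7 h'⟩, by simp [h7, h, hst]⟩
      ext i j
      simp only [State.writeArr_arr, a₂', hs₁, hs.2.1 h, true_and, Rat.cast_zero, Rat.cast_one]
      split_ifs <;> rfl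
  · norm_num [Test.cost, IExpr.cost, tryPureCost]

def pureSearch : Program := forLoop 10 (.reg 0) (forLoop 11 (.reg 1) tryPure)

noncomputable def pureSearchCost (m₁ m₂ : ℕ) : ℕ∞ :=
  forCost m₁ (.reg 0) (forCost m₂ (.reg 1) (tryPureCost m₁ m₂))

theorem Spec.pureSearch {m₁ m₂ : ℕ} (hm₁ : 1 ≤ m₁) (hm₂ : 1 ≤ m₂) {U : BimatrixGame m₁ m₂}
    {s : State} (hs : SearchState U s) :
    Spec pureSearch s (pureSearchCost m₁ m₂) fun s' => SearchState U s' ∧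
      (s'.idx 7 = 0 → ∀ a < m₁, ∀ b < m₂, ¬ U.IsStrongNash (pureProfile m₁ m₂ a b)) := by
  refine (Spec.forAll m₁ (SearchState U) (fun s' => s'.idx 7 = 0)
    (fun a => ∀ b < m₂, ¬ U.IsStrongNash (pureProfile m₁ m₂ a b)) ?_ ?_ ?_ ?_ hs ?_).imp
    fun s' h => ⟨h.1, fun h' => (h.2.1 h').2⟩
  · simp [modIdx_forLoop, modIdx_tryPure]
  · exact fun s' i h => h.writeIdx (by norm_num) (by norm_num) (by norm_num) i
  · simp
  · exact fun s' h => h.1.1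
  intro a _ s₁ h₁ ha
  refine (Spec.forAll m₂ (fun s' => SearchState U s' ∧ s'.idx 10 = a) (fun s' => s'.idx 7 = 0)
    (fun b => ¬ U.IsStrongNash (pureProfile m₁ m₂ a b)) ?_ ?_ ?_ ?_ ⟨h₁, ha⟩ ?_).imp
    fun s' h => ⟨h.1.1, h.2⟩
  · simp [modIdx_tryPure]
  · exact fun s' i h => ⟨h.1.writeIdx (by norm_num) (by norm_num) (by norm_num) i, by simp [h.2]⟩
  · simp
  · exact fun s' h => h.1.1.2.1
  intro b _ s₂ h₂ hb
  refine (Spec.tryPure hm₁ hm₂ h₂.1 h₂.2 hb).frame.imp fun s' h => ⟨⟨h.1.1, ?_⟩, h.1.2⟩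
  rw [h.2.1 10 (by simp [modIdx_tryPure]), h₂.2]

/-- The test of the conditions in `IsGeneric` for two rows and two columns. -/
def genericTest : Test :=
  let A := fun i j => RExpr.load 0 (.reg i) (.reg j)
  let B := fun i j => RExpr.load 1 (.reg i) (.reg j)
  let eq := fun e f => Test.and (.le e f) (.le f e)
  .and (.or (.idxEq (.reg 2) (.reg 3)) (.not (eq (A 2 4) (A 3 4))))
    (.and (.or (.idxEq (.reg 4) (.reg 5)) (.not (eq (B 2 4) (B 2 5))))
      (.or (.idxEq (.reg 2) (.reg 3)) (.or (.idxEq (.reg 4) (.reg 5))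
        (.not (eq (.sub (.mul (.sub (A 2 4) (A 3 4)) (.sub (B 2 5) (B 3 5)))
          (.mul (.sub (A 2 5) (A 3 5)) (.sub (B 2 4) (B 3 4)))) (.const 0))))))

/-- Decide whether the game is generic. -/
def genericCheck : Program := .seq (.setIdx 6 (.const 1)) (forAllPairs genericTest)

noncomputable def genericCheckCost (m₁ m₂ : ℕ) : ℕ∞ := 2 + forAllPairsCost genericTest m₁ m₂

theorem Spec.genericCheck {m₁ m₂ : ℕ} {U : BimatrixGame m₁ m₂}
    {s : State} (hs : Encodes U s) :
    Spec genericCheck s (genericCheckCost m₁ m₂) fun s' => (s'.idx 6 ≠ 0 ↔ U.IsGeneric) := by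
  refine Spec.seq ((Spec.setIdx ?_).mono (by norm_num [IExpr.cost]) fun _ h => h)
  let P : ℕ → ℕ → ℕ → ℕ → Prop := fun a a' b b' =>
    (a = a' ∨ s.arr 0 a b ≠ s.arr 0 a' b) ∧ (b = b' ∨ s.arr 1 a b ≠ s.arr 1 a b') ∧
    (a = a' ∨ b = b' ∨ (s.arr 0 a b - s.arr 0 a' b) * (s.arr 1 a b' - s.arr 1 a' b') -
      (s.arr 0 a b' - s.arr 0 a' b') * (s.arr 1 a b - s.arr 1 a' b) ≠ 0)
  have h := Spec.forAllPairs (b := genericTest) (s := s.writeIdx 6 ((IExpr.const 1).eval s))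
    (P := P) ?_
  · simp only [State.writeIdx_idx, hs.1, hs.2.1] at h
    refine h.imp fun s' h => ?_
    rw [h]
    simp only [IExpr.eval, if_true, ne_eq, one_ne_zero, not_false_eq_true, true_and]
    constructor
    · intro h'
      have h2 := fun (a a' : Fin m₁) (b b' : Fin m₂) => h' a a.2 a' a'.2 b b.2 b' b'.2
      simp only [P, hs.2.2.1, hs.2.2.2, Fin.val_inj] at h2
      exact ⟨fun a a' b hne => (h2 a a' b b).1.resolve_left hne,
        fun a b b' hne => (h2 a a b b').2.1.resolve_left hne,
        fun a a' b b' hne hne' => ((h2 a a' b b').2.2.resolve_left hne).resolve_left hne'⟩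
    · rintro ⟨g1, g2, g3⟩ a ha a' ha' b hb b' hb'
      have k1 := g1 ⟨a, ha⟩ ⟨a', ha'⟩ ⟨b, hb⟩
      have k2 := g2 ⟨a, ha⟩ ⟨b, hb⟩ ⟨b', hb'⟩
      have k3 := g3 ⟨a, ha⟩ ⟨a', ha'⟩ ⟨b, hb⟩ ⟨b', hb'⟩
      simp only [BimatrixGame.differenceMinor, ← hs.2.2.1, ← hs.2.2.2, ne_eq, Fin.mk.injEq]
        at k1 k2 k3
      exact ⟨or_iff_not_imp_left.2 k1, or_iff_not_imp_left.2 k2,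
        or_iff_not_imp_left.2 fun h => or_iff_not_imp_left.2 (k3 h)⟩
  · intro s' hs'
    simp only [State.writeIdx_arr] at hs'
    simp only [genericTest, Test.Holds, Test.holds_le, Test.holds_or, Test.holds_idxEq, RExpr.eval,
      IExpr.eval, hs', P, ← le_antisymm_iff, Rat.cast_zero, ne_eq]

end RealRAM

/-! ### Exhaustive search in degenerate games -/

namespace RealRAM

theorem Spec.top {c : Program} {s : State} {T : ℕ∞} {Q : State → Prop} (h : Spec c s T Q) :
    Spec c s ⊤ Q := h.mono le_top fun _ h => h

theorem Spec.seq_top {c d : Program} {s : State} {T : ℕ∞} {Q : State → Prop}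
    (h : Spec c s T fun s' => Spec d s' ⊤ Q) : Spec (.seq c d) s ⊤ Q := (Spec.seq h).top

theorem Spec.branch_top {b : Test} {c d : Program} {s : State} {Q : State → Prop}
    (h₁ : b.Holds s → Spec c s ⊤ Q) (h₂ : ¬ b.Holds s → Spec d s ⊤ Q) :
    Spec (.branch b c d) s ⊤ Q := (Spec.branch h₁ h₂).top

/-- The values that are listed in row `0` of the array `7`; register `8` contains the length of
the list. -/
def listed (s : State) : Set ℝ := {r | ∃ p < s.idx 8, s.arr 7 0 p = r}

/-- Append a value to the list. -/
def append (e : RExpr) : Program :=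
  .seq (.setArr 7 (.const 0) (.reg 8) e) (.setIdx 8 (.add (.reg 8) (.const 1)))

theorem modIdx_append {e : RExpr} {k : ℕ} : (append e).ModIdx k ↔ k = 8 := by
  simp [append, Program.ModIdx]

theorem modArr_append {e : RExpr} {a : ℕ} : (append e).ModArr a ↔ a = 7 := by
  simp [append, Program.ModArr]

theorem Spec.append {e : RExpr} {s : State} :
    Spec (append e) s ⊤ fun s' => s.idx 8 ≤ s'.idx 8 ∧ e.eval s ∈ listed s' ∧
      ∀ p < s.idx 8, s'.arr 7 0 p = s.arr 7 0 p := by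
  refine (Spec.seq (Spec.setArr (Spec.setIdx ?_))).top
  simp only [IExpr.eval, State.writeArr_idx, State.writeIdx_idx, if_true, State.writeIdx_arr]
  refine ⟨by omega, ⟨s.idx 8, by simp, by simp [State.writeArr_arr]⟩, fun p hp => ?_⟩
  simp [State.writeArr_arr, hp.ne]

theorem listed_subset {s s' : State} (h : s.idx 8 ≤ s'.idx 8)
    (h' : ∀ p < s.idx 8, s'.arr 7 0 p = s.arr 7 0 p) : listed s ⊆ listed s' := by
  rintro r ⟨p, hp, rfl⟩
  exact ⟨p, by omega, h' p hp⟩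

theorem listed_writeIdx {s : State} {k : ℕ} (hk : k ≠ 8) (n : ℕ) :
    listed (s.writeIdx k n) = listed s := by
  simp [listed, hk.symm]

/-- A loop that lists the values in `X i` for all `i < n`. -/
theorem Spec.collect {c : Program} {s : State} {k : ℕ} {e : IExpr} (n : ℕ) (I : State → Prop)
    (X : ℕ → Set ℝ) (hk : ¬ c.ModIdx k) (hk8 : k ≠ 8) (hI : ∀ s i, I s → I (s.writeIdx k i))
    (he : ∀ s, I s → e.eval s = n) (hs : I s)
    (hstep : ∀ i < n, ∀ s', I s' → s'.idx k = i →
      Spec c s' ⊤ fun s'' => I s'' ∧ X i ⊆ listed s'' ∧ listed s' ⊆ listed s'') :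
    Spec (RealRAM.forLoop k e c) s ⊤
      fun s' => I s' ∧ {r | ∃ i < n, r ∈ X i} ⊆ listed s' ∧ listed s ⊆ listed s' := by
  refine (Spec.forLoop (T := ⊤) n (fun i s' => I s' ∧ {r | ∃ j < i, r ∈ X j} ⊆ listed s' ∧
    listed s ⊆ listed s') hk ⟨hI _ _ hs, by simp, (listed_writeIdx hk8 0).ge⟩
    (fun i s' h => he s' h.1) ?_).top
  rintro i hi s' ⟨h1, h2, h3⟩ hki
  refine (hstep i hi s' h1 hki).imp ?_
  rintro s'' ⟨h4, h5, h6⟩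
  rw [listed_writeIdx hk8]
  refine ⟨hI _ _ h4, ?_, h3.trans h6⟩
  rintro r ⟨j, hj, hr⟩
  rcases Nat.lt_succ_iff_lt_or_eq.1 hj with hj | rfl
  · exact h6 (h2 ⟨j, hj, hr⟩)
  · exact h5 hr

/-- List all `a - b * c / d` for `a`, `b`, `c`, `d` in the list. -/
def deriveRound : Program :=
  let l := fun k => RExpr.load 7 (.const 0) (.reg k)
  -- The old length is saved, because register `8` grows while the loops run.
  .seq (.setIdx 9 (.reg 8)) <|
  forLoop 10 (.reg 9) <| forLoop 11 (.reg 9) <| forLoop 12 (.reg 9) <| forLoop 13 (.reg 9) <|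
    append (.sub (l 10) (.div (.mul (l 11) (l 12)) (l 13)))

theorem modIdx_deriveRound {k : ℕ} : deriveRound.ModIdx k ↔ k ∈ [8, 9, 10, 11, 12, 13] := by
  simp only [deriveRound, Program.ModIdx, modIdx_forLoop, modIdx_append, List.mem_cons,
    List.not_mem_nil, or_false]
  tauto

theorem modArr_deriveRound {a : ℕ} : deriveRound.ModArr a ↔ a = 7 := by
  simp [deriveRound, Program.ModArr, modArr_forLoop, modArr_append]

theorem Spec.deriveRound (s : State) :
    Spec deriveRound s ⊤ fun s' => ∀ a ∈ listed s, ∀ b ∈ listed s, ∀ c ∈ listed s, ∀ d ∈ listed s,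
      a - b * c / d ∈ listed s' := by
  refine Spec.seq_top (Spec.setIdx ?_)
  simp only [IExpr.eval]
  set N := s.idx 8 with hN
  set l : ℕ → ℝ := s.arr 7 0 with hl
  let I : State → Prop := fun s' => s'.idx 9 = N ∧ N ≤ s'.idx 8 ∧ ∀ p < N, s'.arr 7 0 p = l p
  refine (Spec.collect (k := 10) (s := s.writeIdx 9 N) N I (fun i => {r | ∃ j < N, r ∈ {r | ∃ k < N, r ∈ {r | ∃ h < N,
    r ∈ ({l i - l j * l k / l h} : Set ℝ)}}}) ?_ (by norm_num) ?_ ?_ ⟨by simp, by simp [hN],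
    fun _ _ => rfl⟩ ?_).imp ?_
  · simp [modIdx_forLoop, modIdx_append]
  · intro s' i h; simpa [I] using h
  · exact fun s' h => h.1
  · intro i hi s₁ h₁ hi₁
    refine (Spec.collect N (fun s' => I s' ∧ s'.idx 10 = i) _ ?_ (by norm_num) ?_ ?_
      ⟨h₁, hi₁⟩ ?_).imp fun s' h => ⟨h.1.1, h.2⟩
    · simp [modIdx_forLoop, modIdx_append]
    · intro s' i h; simpa [I] using h
    · exact fun s' h => h.1.1
    intro j hj s₂ h₂ hi₂
    refine (Spec.collect N (fun s' => I s' ∧ s'.idx 10 = i ∧ s'.idx 11 = j) _ ?_ (by norm_num) ?_ ?_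
      ⟨h₂.1, h₂.2, hi₂⟩ ?_).imp fun s' h => ⟨⟨h.1.1, h.1.2.1⟩, h.2⟩
    · simp [modIdx_forLoop, modIdx_append]
    · intro s' i h; simpa [I] using h
    · exact fun s' h => h.1.1
    intro k hk s₃ h₃ hi₃
    refine (Spec.collect N (fun s' => I s' ∧ s'.idx 10 = i ∧ s'.idx 11 = j ∧ s'.idx 12 = k) _ ?_
      (by norm_num) ?_ ?_ ⟨h₃.1, h₃.2.1, h₃.2.2, hi₃⟩ ?_).imp
      fun s' h => ⟨⟨h.1.1, h.1.2.1, h.1.2.2.1⟩, h.2⟩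
    · simp [modIdx_append]
    · intro s' i h; simpa [I] using h
    · exact fun s' h => h.1.1
    rintro h hh s₄ ⟨⟨i1, i2, i3⟩, e1, e2, e3⟩ e4
    refine Spec.append.frame.imp ?_
    rintro s₅ ⟨⟨f1, f2, f3⟩, f4, -⟩
    have f4' : ∀ r, r ≠ 8 → s₅.idx r = s₄.idx r := fun r hr => f4 r (by simp [modIdx_append, hr])
    refine ⟨⟨⟨by simp [f4', i1], by omega, fun p hp => by rw [f3 p (by omega), i3 p hp]⟩,
      by simp [f4', e1], by simp [f4', e2], by simp [f4', e3]⟩, ?_, listed_subset f1 f3⟩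
    rw [Set.singleton_subset_iff]
    simpa [e1, e2, e3, e4, i3 i hi, i3 j hj, i3 k hk, i3 h hh] using f2
  · rintro s' ⟨-, h, -⟩ a ⟨i, hi, rfl⟩ b ⟨j, hj, rfl⟩ c ⟨k, hk, rfl⟩ d ⟨h', hh', rfl⟩
    exact h ⟨i, hi, j, hj, k, hk, h', hh', rfl⟩

/-- List `0`, `1`, `-1` and the payoffs. -/
def listPayoffs : Program :=
  .seq (.setIdx 8 (.const 0)) <|
  .seq (append (.const 0)) <| .seq (append (.const 1)) <| .seq (append (.const (-1))) <|
  forLoop 10 (.reg 0) <| forLoop 11 (.reg 1) <|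
    .seq (append (.load 0 (.reg 10) (.reg 11))) (append (.load 1 (.reg 10) (.reg 11)))

theorem Spec.listPayoffs {m₁ m₂ : ℕ} {U : BimatrixGame m₁ m₂} {s : State} (hs : Encodes U s) :
    Spec listPayoffs s ⊤ fun s' => {0, 1, -1} ∪ Set.range U ⊆ listed s' := by
  refine Spec.seq_top (Spec.setIdx ?_)
  have step : ∀ (s₀ : State), Encodes U s₀ → ∀ q, Spec (RealRAM.append q) s₀ ⊤ fun s' =>
      Encodes U s' ∧ q.eval s₀ ∈ listed s' ∧ listed s₀ ⊆ listed s' := by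
    intro s₀ h₀ q
    refine Spec.append.frame.imp ?_
    rintro s' ⟨⟨h1, h2, h3⟩, h4, h5⟩
    exact ⟨h₀.of_eq (h4 _ (by simp [modIdx_append])) (h4 _ (by simp [modIdx_append]))
      (h5 _ (by simp [modArr_append])) (h5 _ (by simp [modArr_append])), h2, listed_subset h1 h3⟩
  refine Spec.seq_top ((step (s.writeIdx 8 0) (hs.of_eq (by simp) (by simp) rfl rfl) _).imp ?_)
  rintro s₁ ⟨h1, m1, -⟩
  refine Spec.seq_top ((step _ h1 _).imp ?_)
  rintro s₂ ⟨h2, m2, k2⟩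
  refine Spec.seq_top ((step _ h2 _).imp ?_)
  rintro s₃ ⟨h3, m3, k3⟩
  simp only [RExpr.eval, Rat.cast_zero, Rat.cast_one, Rat.cast_neg] at m1 m2 m3
  refine (Spec.collect m₁ (Encodes U) (fun a => {r | ∃ b < m₂, r ∈ {r | ∃ (ha : a < m₁)
    (hb : b < m₂), r = U (0, ⟨a, ha⟩, ⟨b, hb⟩) ∨ r = U (1, ⟨a, ha⟩, ⟨b, hb⟩)}}) ?_ (by norm_num)
    ?_ ?_ h3 ?_).imp ?_
  · simp [modIdx_forLoop, modIdx_append, Program.ModIdx]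
  · exact fun s' i h => h.of_eq (by simp) (by simp) rfl rfl
  · exact fun s' h => h.1
  · intro a ha s₄ h4 ha4
    refine (Spec.collect m₂ (fun s' => Encodes U s' ∧ s'.idx 10 = a) _ ?_ (by norm_num)
      ?_ ?_ ⟨h4, ha4⟩ ?_).imp fun s' h => ⟨h.1.1, h.2⟩
    · simp [modIdx_append, Program.ModIdx]
    · exact fun s' i h => ⟨h.1.of_eq (by simp) (by simp) rfl rfl, by simp [h.2]⟩
    · exact fun s' h => h.1.2.1
    rintro b hb s₅ ⟨h5, ha5⟩ hb5
    refine Spec.seq_top ((step _ h5 _).frame.imp ?_)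
    rintro s₆ ⟨⟨h6, m6, k6⟩, i6, -⟩
    refine (step _ h6 _).frame.imp ?_
    rintro s₇ ⟨⟨h7, m7, k7⟩, i7, -⟩
    have i6' : ∀ r, r ≠ 8 → s₆.idx r = s₅.idx r := fun r hr => i6 r (by simp [modIdx_append, hr])
    have i7' : ∀ r, r ≠ 8 → s₇.idx r = s₆.idx r := fun r hr => i7 r (by simp [modIdx_append, hr])
    refine ⟨⟨h7, by simp [i7', i6', ha5]⟩, ?_, k6.trans k7⟩
    rintro r ⟨ha, hb, rfl | rfl⟩
    · rw [← h5.2.2.1]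
      apply k7
      simpa [ha5, hb5] using m6
    · rw [← h6.2.2.2]
      simpa [i6', ha5, hb5] using m7
  · rintro s' ⟨-, h, k⟩ r (hr | ⟨⟨i, a, b⟩, rfl⟩)
    · rcases hr with rfl | rfl | rfl
      · exact k (k3 (k2 m1))
      · exact k (k3 m2)
      · exact k m3
    · refine h ⟨a, a.2, b, b.2, a.2, b.2, ?_⟩
      fin_cases i
      · exact Or.inl rfl
      · exact Or.inr rfl

/-- List all values that occur as coordinates of the candidates. -/
def listValues : Program :=
  .seq listPayoffs (forLoop 14 (.add (.add (.reg 0) (.reg 1)) (.const 1)) deriveRound)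

/-- An inclusion is enough: surplus or repeated values only add candidates, and each candidate is
checked. -/
theorem Spec.listValues {m₁ m₂ : ℕ} {U : BimatrixGame m₁ m₂} {s : State} (hs : Encodes U s) :
    Spec listValues s ⊤ fun s' =>
      derivedValues ({0, 1, -1} ∪ Set.range U) (m₁ + m₂ + 1) ⊆ listed s' := by
  refine Spec.seq_top ((Spec.listPayoffs hs).frame.imp ?_)
  rintro s₁ ⟨h1, i1, a1⟩
  have e1 : Encodes U s₁ := hs.of_eq
    (i1 0 (by simp [RealRAM.listPayoffs, Program.ModIdx, modIdx_forLoop, modIdx_append]))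
    (i1 1 (by simp [RealRAM.listPayoffs, Program.ModIdx, modIdx_forLoop, modIdx_append]))
    (a1 0 (by simp [RealRAM.listPayoffs, Program.ModArr, modArr_forLoop, modArr_append]))
    (a1 1 (by simp [RealRAM.listPayoffs, Program.ModArr, modArr_forLoop, modArr_append]))
  refine ((Spec.forLoop (T := ⊤) (m₁ + m₂ + 1) (fun k s' => Encodes U s' ∧
    derivedValues ({0, 1, -1} ∪ Set.range U) k ⊆ listed s') ?_ ?_ ?_ ?_).imp fun s' h => h.2).top
  · simp [modIdx_deriveRound]
  · refine ⟨e1.of_eq (by simp) (by simp) rfl rfl, ?_⟩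
    rw [listed_writeIdx (by norm_num)]
    exact h1
  · rintro i s' ⟨h, -⟩
    simp [h.1, h.2.1]
  · rintro i hi s₂ ⟨e2, h2⟩ -
    refine (Spec.deriveRound s₂).frame.imp ?_
    rintro s₃ ⟨h3, i3, a3⟩
    refine ⟨e2.of_eq (by simp [i3, modIdx_deriveRound]) (by simp [i3, modIdx_deriveRound])
      (by simp [a3, modArr_deriveRound]) (by simp [a3, modArr_deriveRound]), ?_⟩
    rw [listed_writeIdx (by norm_num)]
    rintro r ⟨a, ha, b, hb, c, hc, d, hd, rfl⟩
    exact h3 a (h2 ha) b (h2 hb) c (h2 hc) d (h2 hd)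

/-! ### Enumeration of the candidates by their digits -/

/-- Register `20` becomes the quotient, and register `19` the remainder, of the division of
register `18` by register `8`. -/
def divMod : Program :=
  .seq (.setIdx 19 (.reg 18)) <| .seq (.setIdx 20 (.const 0)) <|
  forLoop 11 (.reg 18) <| .branch (.idxLt (.reg 19) (.reg 8)) .skip <|
    .seq (.setIdx 19 (.sub (.reg 19) (.reg 8))) (.setIdx 20 (.add (.reg 20) (.const 1)))

theorem Spec.divMod (s : State) (hN : 0 < s.idx 8) :
    Spec divMod s ⊤ fun s' =>
      s'.idx 19 = s.idx 18 % s.idx 8 ∧ s'.idx 20 = s.idx 18 / s.idx 8 := by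
  set q := s.idx 18 with hq
  set N := s.idx 8 with hN'
  refine Spec.seq_top (Spec.setIdx (Spec.seq_top (Spec.setIdx ?_)))
  -- The loop makes `q` rounds, which is more than enough. Either the remainder is already small or
  -- every round so far has subtracted `N`; after `q` such rounds the remainder is zero.
  refine ((Spec.forLoop (T := ⊤) q (fun i s' => (s'.idx 18 = q ∧ s'.idx 8 = N) ∧
    s'.idx 19 + N * s'.idx 20 = q ∧ (s'.idx 19 < N ∨ i ≤ s'.idx 20)) ?_ ?_ ?_ ?_).imp ?_).top
  · simp [Program.ModIdx]
  · simp [hq, hN']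
  · exact fun i s' h => h.1.1
  · rintro i hi s' ⟨⟨h1, h2⟩, h3, h4⟩ -
    refine Spec.branch_top (fun h => (Spec.skip ?_).top) (fun h =>
      Spec.seq_top (Spec.setIdx (Spec.setIdx ?_).top))
    · simp only [Test.Holds, IExpr.eval] at h
      simp [h1, h2, h3]
      omega
    · simp only [Test.Holds, IExpr.eval, h2, not_lt] at h
      simp only [IExpr.eval, State.writeIdx_idx]
      norm_num
      refine ⟨⟨h1, h2⟩, ?_, by omega⟩
      rw [h2, mul_add, mul_one]
      omega
  · rintro s' ⟨-, h3, h4⟩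
    have h5 : s'.idx 19 < N := by
      rcases h4 with h4 | h4
      · exact h4
      · have : s'.idx 20 ≤ N * s'.idx 20 := Nat.le_mul_of_pos_left _ hN
        omega
    rw [← h3]
    constructor
    · rw [Nat.add_mul_mod_self_left, Nat.mod_eq_of_lt h5]
    · rw [Nat.add_mul_div_left _ _ hN, Nat.div_eq_of_lt h5, zero_add]

/-- Write the candidate with the number in register `17` into the array `2`. -/
def writeCandidate : Program :=
  .seq (.setIdx 18 (.reg 17)) <|
  forLoop 10 (.add (.reg 0) (.reg 1)) <|
    .seq divMod <| .seq (.setIdx 18 (.reg 20)) <|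
    .branch (.idxLt (.reg 10) (.reg 0))
      (.setArr 2 (.const 0) (.reg 10) (.load 7 (.const 0) (.reg 19)))
      (.setArr 2 (.const 1) (.sub (.reg 10) (.reg 0)) (.load 7 (.const 0) (.reg 19)))

theorem modIdx_writeCandidate {k : ℕ} : writeCandidate.ModIdx k ↔ k ∈ [10, 11, 18, 19, 20] := by
  simp only [writeCandidate, divMod, Program.ModIdx, modIdx_forLoop, List.mem_cons,
    List.not_mem_nil, or_false, false_or]
  tauto

theorem modArr_writeCandidate {a : ℕ} : writeCandidate.ModArr a ↔ a = 2 := by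
  simp [writeCandidate, divMod, Program.ModArr, modArr_forLoop]

/-- The candidate with number `r`: its coordinates are selected by the digits of `r`. -/
def candidate (m₁ m₂ N : ℕ) (l : ℕ → ℝ) (r : ℕ) : Profile m₁ m₂ :=
  (fun a => l (r / N ^ (a : ℕ) % N), fun b => l (r / N ^ (m₁ + b) % N))

theorem Spec.writeCandidate {m₁ m₂ : ℕ} (s : State) (h0 : s.idx 0 = m₁) (h1 : s.idx 1 = m₂)
    (hN : 0 < s.idx 8) : Spec writeCandidate s ⊤ fun s' =>
      profileOf m₁ m₂ s' = candidate m₁ m₂ (s.idx 8) (s.arr 7 0) (s.idx 17) := by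
  set N := s.idx 8 with hN'
  set r := s.idx 17 with hr
  set l := s.arr 7 0 with hl
  refine Spec.seq_top (Spec.setIdx ?_)
  refine ((Spec.forLoop (T := ⊤) (m₁ + m₂) (fun i s' =>
    (s'.idx 0 = m₁ ∧ s'.idx 1 = m₂ ∧ s'.idx 8 = N ∧ s'.arr 7 0 = l) ∧ s'.idx 18 = r / N ^ i ∧
    (∀ a < m₁, a < i → s'.arr 2 0 a = l (r / N ^ a % N)) ∧
    ∀ b < m₂, m₁ + b < i → s'.arr 2 1 b = l (r / N ^ (m₁ + b) % N)) ?_ ?_ ?_ ?_).imp ?_).top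
  · simp [RealRAM.divMod, Program.ModIdx, modIdx_forLoop]
  · simp [h0, h1, hN', hr, hl]
  · rintro i s' ⟨h, -⟩; simp [h.1, h.2.1]
  · rintro i hi s₁ ⟨⟨e0, e1, e8, ea⟩, e18, hx, hy⟩ e10
    refine Spec.seq_top ((Spec.divMod s₁ (by omega)).frame.imp ?_)
    rintro s₂ ⟨⟨d19, d20⟩, i2, a2⟩
    have i2' : ∀ k, k ≠ 11 → k ≠ 19 → k ≠ 20 → s₂.idx k = s₁.idx k := fun k k1 k2 k3 =>
      i2 k (by simp [RealRAM.divMod, Program.ModIdx, modIdx_forLoop, k1, k2, k3])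
    have a2' : s₂.arr = s₁.arr := by
      funext a; exact a2 a (by simp [RealRAM.divMod, Program.ModArr, modArr_forLoop])
    rw [e18, e8] at d19 d20
    rw [Nat.div_div_eq_div_mul, ← pow_succ] at d20
    refine Spec.seq_top (Spec.setIdx ?_)
    refine Spec.branch_top (fun h => (Spec.setArr ?_).top) (fun h => (Spec.setArr ?_).top)
    · simp only [Test.Holds, IExpr.eval, State.writeIdx_idx] at h
      norm_num [i2', e10, e0] at h
      simp only [IExpr.eval, RExpr.eval, State.writeIdx_idx, State.writeIdx_arr, a2',
        State.writeArr_idx, State.writeArr_arr, ea, d19]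
      norm_num [i2', e0, e1, e8, e10, d20]
      refine ⟨?_, fun a ha hai => ?_, fun b hb hbi => by omega⟩
      · funext k; simp [State.writeArr_arr, a2', ea]
      · split_ifs with h'
        · rw [h']
        · exact hx a ha (by omega)
    · simp only [Test.Holds, IExpr.eval, State.writeIdx_idx] at h
      norm_num [i2', e10, e0] at h
      simp only [IExpr.eval, RExpr.eval, State.writeIdx_idx, State.writeIdx_arr, a2',
        State.writeArr_idx, State.writeArr_arr, ea, d19]
      norm_num [i2', e0, e1, e8, e10, d20]
      refine ⟨?_, fun a ha hai => hx a ha (by omega), fun b hb hbi => ?_⟩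
      · funext k; simp [State.writeArr_arr, a2', ea]
      · split_ifs with h'
        · rw [h', Nat.add_sub_cancel' h]
        · exact hy b hb (by omega)
  · rintro s' ⟨-, -, hx, hy⟩
    refine Prod.ext (funext fun a => hx a a.2 (by omega)) (funext fun b => hy b b.2 (by omega))

/-- The number of candidates becomes the value of register `15`. -/
def countCandidates : Program :=
  .seq (.setIdx 15 (.const 1)) <|
  forLoop 10 (.add (.reg 0) (.reg 1)) <|
    .seq (.setIdx 16 (.const 0)) <|
    -- Index expressions have no multiplication, so it is done by repeated addition.
    .seq (forLoop 11 (.reg 8) (.setIdx 16 (.add (.reg 16) (.reg 15)))) (.setIdx 15 (.reg 16))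

theorem modIdx_countCandidates {k : ℕ} : countCandidates.ModIdx k ↔ k ∈ [10, 11, 15, 16] := by
  simp only [countCandidates, Program.ModIdx, modIdx_forLoop, List.mem_cons, List.not_mem_nil,
    or_false]
  tauto

theorem modArr_countCandidates {a : ℕ} : ¬ countCandidates.ModArr a := by
  simp [countCandidates, Program.ModArr, modArr_forLoop]

theorem Spec.countCandidates (s : State) :
    Spec countCandidates s ⊤ fun s' => s'.idx 15 = s.idx 8 ^ (s.idx 0 + s.idx 1) := by
  refine Spec.seq_top (Spec.setIdx ?_)
  refine ((Spec.forLoop (T := ⊤) (s.idx 0 + s.idx 1) (fun i s' => (s'.idx 0 = s.idx 0 ∧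
    s'.idx 1 = s.idx 1 ∧ s'.idx 8 = s.idx 8) ∧ s'.idx 15 = s.idx 8 ^ i) ?_ ?_ ?_ ?_).imp
    fun s' h => h.2).top
  · simp [Program.ModIdx, modIdx_forLoop]
  · simp
  · rintro i s' ⟨h, -⟩; simp [h.1, h.2.1]
  · rintro i hi s₁ ⟨⟨e0, e1, e8⟩, e15⟩ -
    refine Spec.seq_top (Spec.setIdx ?_)
    refine Spec.seq_top ((Spec.forLoop (T := ⊤) (s.idx 8) (fun j s' => (s'.idx 0 = s.idx 0 ∧
      s'.idx 1 = s.idx 1 ∧ s'.idx 8 = s.idx 8 ∧ s'.idx 15 = s.idx 8 ^ i) ∧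
      s'.idx 16 = j * s.idx 8 ^ i) ?_ ?_ ?_ ?_).imp ?_)
    · simp [Program.ModIdx]
    · simp [e0, e1, e8, e15]
    · exact fun j s' h => h.1.2.2.1
    · rintro j hj s' ⟨⟨f0, f1, f8, f15⟩, f16⟩ -
      refine (Spec.setIdx ?_).top
      simp [f0, f1, f8, f15, f16, add_mul]
    · rintro s' ⟨⟨f0, f1, f8, f15⟩, f16⟩
      refine (Spec.setIdx ?_).top
      simp [f0, f1, f8, f16, pow_succ, mul_comm]

/-- Check the candidate with the number in register `17`. -/
def tryCandidate : Program :=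
  .branch (.idxLt (.const 0) (.reg 7)) .skip <|
  .seq writeCandidate <| .seq check <|
  .branch (.idxLt (.const 0) (.reg 6)) (.setIdx 7 (.const 1)) .skip

theorem modIdx_tryCandidate {k : ℕ} :
    tryCandidate.ModIdx k ↔ k ∈ [2, 3, 4, 5, 6, 7, 10, 11, 18, 19, 20] := by
  simp only [tryCandidate, Program.ModIdx, modIdx_writeCandidate, modIdx_check, List.mem_cons,
    List.not_mem_nil, or_false, false_or]
  tauto

theorem modArr_tryCandidate {a : ℕ} : tryCandidate.ModArr a ↔ a ∈ [2, 3, 4, 5, 6, 8, 9] := by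
  simp only [tryCandidate, Program.ModArr, modArr_writeCandidate, modArr_check, List.mem_cons,
    List.not_mem_nil, or_false, false_or]

theorem Spec.tryCandidate {m₁ m₂ : ℕ} (hm₁ : 1 ≤ m₁) (hm₂ : 1 ≤ m₂) {U : BimatrixGame m₁ m₂}
    {s : State} (hs : Encodes U s) (hN : 0 < s.idx 8)
    (h7 : s.idx 7 ≠ 0 → U.IsStrongNash (profileOf m₁ m₂ s)) :
    Spec tryCandidate s ⊤ fun s' => (s'.idx 7 ≠ 0 → U.IsStrongNash (profileOf m₁ m₂ s')) ∧
      (s'.idx 7 = 0 ↔ s.idx 7 = 0 ∧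
        ¬ U.IsStrongNash (candidate m₁ m₂ (s.idx 8) (s.arr 7 0) (s.idx 17))) := by
  refine Spec.branch_top (fun h => (Spec.skip ⟨h7, by
    simp only [Test.Holds, IExpr.eval] at h
    simp [h.ne']⟩).top) (fun h => ?_)
  replace h : s.idx 7 = 0 := by simpa using h
  refine Spec.seq_top ((Spec.writeCandidate s hs.1 hs.2.1 hN).frame.imp ?_)
  rintro s₁ ⟨p₁, i₁, a₁⟩
  have e₁ : Encodes U s₁ := hs.of_eq (i₁ 0 (by simp [modIdx_writeCandidate]))
    (i₁ 1 (by simp [modIdx_writeCandidate])) (a₁ 0 (by simp [modArr_writeCandidate]))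
    (a₁ 1 (by simp [modArr_writeCandidate]))
  refine Spec.seq_top ((Spec.check hm₁ hm₂ e₁).frame.imp ?_)
  rintro s₂ ⟨h₂, i₂, a₂⟩
  have p₂ : profileOf m₁ m₂ s₂ = profileOf m₁ m₂ s₁ := by
    simp [profileOf, a₂ 2 (by simp [modArr_check])]
  have h7₂ : s₂.idx 7 = 0 := by
    rw [i₂ 7 (by simp [modIdx_check]), i₁ 7 (by simp [modIdx_writeCandidate]), h]
  rw [p₁] at h₂ p₂
  refine Spec.branch_top (fun h' => (Spec.setIdx ?_).top) (fun h' => (Spec.skip ?_).top)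
  · have hst := h₂.1 (by simpa [Nat.pos_iff_ne_zero] using h')
    have p₃ : profileOf m₁ m₂ (s₂.writeIdx 7 ((IExpr.const 1).eval s₂)) = profileOf m₁ m₂ s₂ := rfl
    rw [p₃, p₂]
    exact ⟨fun _ => hst, by simp [hst]⟩
  · have hst := (not_congr h₂).1 (by simpa [Nat.pos_iff_ne_zero] using h')
    exact ⟨fun h => absurd h7₂ h, by simp [h7₂, h, hst]⟩

/-- Check all profiles whose coordinates occur in the list of values. -/
def exhaustiveSearch : Program :=
  .seq listValues <| .seq countCandidates <| forLoop 17 (.reg 15) tryCandidate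

/-- Soundness comes from `check`. For completeness, any strong Nash equilibrium yields one with
listed coordinates, and its positions in the list are the digits of some candidate number. -/
theorem Spec.exhaustiveSearch {m₁ m₂ : ℕ} (hm₁ : 1 ≤ m₁) (hm₂ : 1 ≤ m₂)
    {U : BimatrixGame m₁ m₂} {s : State} (hs : Encodes U s) (h7 : s.idx 7 = 0) :
    Spec exhaustiveSearch s ⊤ fun s' =>
      (s'.idx 7 ≠ 0 → U.IsStrongNash (profileOf m₁ m₂ s')) ∧
      (s'.idx 7 = 0 → ¬ ∃ x, U.IsStrongNash x) := by
  refine Spec.seq_top ((Spec.listValues hs).frame.imp ?_)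
  rintro s₁ ⟨v₁, i₁, a₁⟩
  have mi : ∀ k, RealRAM.listValues.ModIdx k → k ∈ [8, 9, 10, 11, 12, 13, 14] := by
    intro k
    simp only [RealRAM.listValues, RealRAM.listPayoffs, Program.ModIdx, modIdx_forLoop,
      modIdx_append, modIdx_deriveRound, List.mem_cons, List.not_mem_nil, or_false]
    tauto
  have ma : ∀ a, RealRAM.listValues.ModArr a → a = 7 := by
    simp [RealRAM.listValues, RealRAM.listPayoffs, Program.ModArr, modArr_forLoop, modArr_append,
      modArr_deriveRound]
  have e₁ : Encodes U s₁ := hs.of_eq (i₁ 0 fun h => by simpa using mi 0 h)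
    (i₁ 1 fun h => by simpa using mi 1 h) (a₁ 0 fun h => by simpa using ma 0 h)
    (a₁ 1 fun h => by simpa using ma 1 h)
  replace h7 : s₁.idx 7 = 0 := by rw [i₁ 7 fun h => by simpa using mi 7 h, h7]
  set N := s₁.idx 8 with hN'
  set l := s₁.arr 7 0 with hl
  -- The list contains `0`, so its length is a valid divisor.
  have hN : 0 < N := by
    obtain ⟨p, hp, -⟩ := v₁ (zero_mem_derivedValues (by simp) _)
    omega
  refine Spec.seq_top ((Spec.countCandidates s₁).frame.imp ?_)
  rintro s₂ ⟨c₂, i₂, a₂⟩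
  rw [e₁.1, e₁.2.1] at c₂
  have e₂ : Encodes U s₂ := e₁.of_eq (i₂ 0 (by simp [modIdx_countCandidates]))
    (i₂ 1 (by simp [modIdx_countCandidates])) (a₂ 0 modArr_countCandidates)
    (a₂ 1 modArr_countCandidates)
  have h7₂ : s₂.idx 7 = 0 := by rw [i₂ 7 (by simp [modIdx_countCandidates]), h7]
  refine ((Spec.forAll (T := ⊤) (N ^ (m₁ + m₂)) (fun s' => (Encodes U s' ∧ s'.idx 8 = N ∧
    s'.idx 15 = N ^ (m₁ + m₂) ∧ s'.arr 7 0 = l) ∧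
    (s'.idx 7 ≠ 0 → U.IsStrongNash (profileOf m₁ m₂ s'))) (fun s' => s'.idx 7 = 0)
    (fun r => ¬ U.IsStrongNash (candidate m₁ m₂ N l r)) ?_ ?_ ?_ ?_ ?_ ?_).imp ?_).top
  · simp [modIdx_tryCandidate]
  · rintro s' i ⟨⟨h1, h2, h3, h4⟩, h5⟩
    exact ⟨⟨h1.of_eq (by simp) (by simp) rfl rfl, by simpa using h2, by simpa using h3, h4⟩,
      fun h => h5 (by simpa using h)⟩
  · simp
  · exact fun s' h => h.1.2.2.1
  · exact ⟨⟨e₂, i₂ 8 (by simp [modIdx_countCandidates]), c₂, by rw [a₂ 7 modArr_countCandidates]⟩,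
      fun h => absurd h7₂ h⟩
  · rintro r hr s' ⟨⟨h1, h2, h3, h4⟩, h5⟩ h17
    refine (Spec.tryCandidate hm₁ hm₂ h1 (by omega) h5).frame.imp ?_
    rintro s'' ⟨⟨h6, h8⟩, i, a⟩
    rw [h2, h4, h17] at h8
    exact ⟨⟨⟨h1.of_eq (by simp [i, modIdx_tryCandidate]) (by simp [i, modIdx_tryCandidate])
      (by simp [a, modArr_tryCandidate]) (by simp [a, modArr_tryCandidate]),
      by simp [i, modIdx_tryCandidate, h2], by simp [i, modIdx_tryCandidate, h3],
      by simp [a, modArr_tryCandidate, h4]⟩, h6⟩, h8⟩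
  · rintro s' ⟨⟨-, h1⟩, h2⟩
    refine ⟨h1, fun h0 => ?_⟩
    rintro ⟨x, hx⟩
    obtain ⟨x', hx', hx1, hx2⟩ := hx.exists_derivedValues (S := {0, 1, -1} ∪ Set.range U)
      (by simp) (by simp) (by simp) (fun i => Or.inr ⟨i, rfl⟩)
    choose d₁ hd₁ hd₁' using fun a => v₁ (hx1 a)
    choose d₂ hd₂ hd₂' using fun b => v₁ (hx2 b)
    -- The positions of the coordinates of both strategies, read as the base-`N` digits of the
    -- candidate number.
    let f : Fin (m₁ + m₂) → Fin N :=
      Fin.append (fun a => ⟨d₁ a, hd₁ a⟩) (fun b => ⟨d₂ b, hd₂ b⟩)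
    have hf : ∀ i : Fin (m₁ + m₂), (finFunctionFinEquiv f : ℕ) / N ^ (i : ℕ) % N = f i := fun i =>
      congrArg Fin.val (congrFun (finFunctionFinEquiv.symm_apply_apply f) i)
    refine (h2.1 h0).2 _ (finFunctionFinEquiv f).2 ?_
    convert hx'
    refine Prod.ext (funext fun a => ?_) (funext fun b => ?_)
    · have := hf (Fin.castAdd m₂ a)
      simp only [Fin.val_castAdd, f, Fin.append_left] at this
      simpa only [candidate, f, this] using hd₁' a
    · have := hf (Fin.natAdd m₁ b)
      simp only [Fin.val_natAdd, f, Fin.append_right] at this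
      simpa only [candidate, f, this] using hd₂' b

end RealRAM

/-! ### The program, and its running time -/

/-- The function is a polynomial with coefficients in the natural numbers. -/
def IsPolynomialCost (f : ℕ → ℕ → ℕ∞) : Prop :=
  ∃ p : MvPolynomial (Fin 2) ℕ, ∀ m₁ m₂ : ℕ, f m₁ m₂ = (MvPolynomial.eval ![m₁, m₂] p : ℕ)

namespace IsPolynomialCost

theorem const (n : ℕ) : IsPolynomialCost fun _ _ => n := ⟨MvPolynomial.C n, by simp⟩

theorem ofNat (n : ℕ) [n.AtLeastTwo] : IsPolynomialCost fun _ _ => (ofNat(n) : ℕ∞) := const n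

theorem fst : IsPolynomialCost fun m₁ _ => m₁ := ⟨MvPolynomial.X 0, by simp⟩

theorem snd : IsPolynomialCost fun _ m₂ => m₂ := ⟨MvPolynomial.X 1, by simp⟩

variable {f g : ℕ → ℕ → ℕ∞}

theorem add (hf : IsPolynomialCost f) (hg : IsPolynomialCost g) :
    IsPolynomialCost fun m₁ m₂ => f m₁ m₂ + g m₁ m₂ := by
  obtain ⟨p, hp⟩ := hf
  obtain ⟨q, hq⟩ := hg
  exact ⟨p + q, fun m₁ m₂ => by simp [hp, hq]⟩

theorem mul (hf : IsPolynomialCost f) (hg : IsPolynomialCost g) :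
    IsPolynomialCost fun m₁ m₂ => f m₁ m₂ * g m₁ m₂ := by
  obtain ⟨p, hp⟩ := hf
  obtain ⟨q, hq⟩ := hg
  exact ⟨p * q, fun m₁ m₂ => by simp [hp, hq]⟩

open RealRAM

theorem forCost {n : ℕ → ℕ → ℕ} (hn : IsPolynomialCost fun m₁ m₂ => n m₁ m₂) (e : IExpr)
    (hf : IsPolynomialCost f) : IsPolynomialCost fun m₁ m₂ => forCost (n m₁ m₂) e (f m₁ m₂) :=
  ((hn.mul ((hf.add (const _)).add (ofNat 6))).add (const _)).add (ofNat 4)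

theorem sumCost {n : ℕ → ℕ → ℕ} (hn : IsPolynomialCost fun m₁ m₂ => n m₁ m₂) (e i j : IExpr)
    (q : RExpr) : IsPolynomialCost fun m₁ m₂ => sumCost (n m₁ m₂) e i j q := by
  simp only [RealRAM.sumCost, Nat.cast_add, Nat.cast_mul]
  exact (const (i.cost + j.cost + 2)).add (((hn.mul (((const (i.cost + j.cost +
    (i.cost + j.cost + 1 + q.cost + 1) + 1)).add (const _)).add (const 6))).add
    (const _)).add (const 4))

theorem forAllPairsCost (b : Test) : IsPolynomialCost (forAllPairsCost b) :=
  forCost fst _ (forCost fst _ (forCost snd _ (forCost snd _ (const _))))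

theorem checkCost : IsPolynomialCost checkCost :=
  (forCost fst _ (sumCost snd _ _ _ _)).add <| (forCost snd _ (sumCost fst _ _ _ _)).add <|
    (sumCost fst _ _ _ _).add <| (sumCost snd _ _ _ _).add <| (sumCost fst _ _ _ _).add <|
    (sumCost snd _ _ _ _).add <| (ofNat 2).add (forAllPairsCost _)

theorem tryPureCost : IsPolynomialCost tryPureCost :=
  (ofNat 3).add <| (ofNat 4).add <| (ofNat 4).add <| checkCost.add (ofNat 11)

theorem pureSearchCost : IsPolynomialCost pureSearchCost :=
  forCost fst _ (forCost snd _ tryPureCost)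

theorem genericCheckCost : IsPolynomialCost genericCheckCost :=
  (ofNat 2).add (forAllPairsCost _)

end IsPolynomialCost

/-! ### The complete program and its expected running time -/

namespace RealRAM

/-- Find a strong Nash equilibrium, or report that there is none. -/
def strongNashProgram : Program :=
  .seq pureSearch <|
  .seq (.branch (.idxLt (.const 0) (.reg 7)) .skip
    (.seq genericCheck (.branch (.idxLt (.const 0) (.reg 6)) .skip exhaustiveSearch)))
  (.setIdx 0 (.reg 7))

noncomputable def strongNashCost (m₁ m₂ : ℕ) : ℕ∞ :=
  pureSearchCost m₁ m₂ + (3 + (genericCheckCost m₁ m₂ + 4) + 2)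

theorem encodes_initial {m₁ m₂ : ℕ} (U : BimatrixGame m₁ m₂) : Encodes U (initial U) := by
  refine ⟨rfl, rfl, fun a b => ?_, fun a b => ?_⟩ <;> simp [initial]

/-- `T` is the allowance for the exhaustive search. With `T = ⊤` the statement gives termination on
all games, with `T = 0` the polynomial bound on generic ones. -/
theorem Spec.strongNashProgram {m₁ m₂ : ℕ} (hm₁ : 1 ≤ m₁) (hm₂ : 1 ≤ m₂) (U : BimatrixGame m₁ m₂)
    (T : ℕ∞) (hT : ¬ U.IsGeneric → T = ⊤) :
    Spec strongNashProgram (initial U) (strongNashCost m₁ m₂ + T) fun s' =>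
      FindsStrongNash m₁ m₂ U (readProfile m₁ m₂ s') := by
  have hinit : SearchState U (initial U) := by
    refine ⟨encodes_initial U, fun _ => ?_, fun h => absurd rfl h⟩
    funext i j
    simp [initial]
  have hread : ∀ s' : State, (s'.idx 7 ≠ 0 → U.IsStrongNash (profileOf m₁ m₂ s')) →
      (s'.idx 7 = 0 → ¬ ∃ x, U.IsStrongNash x) →
      Spec (.setIdx 0 (.reg 7)) s' 2 fun s' => FindsStrongNash m₁ m₂ U (readProfile m₁ m₂ s') := by
    intro s' h1 h2
    refine (Spec.setIdx ?_).mono (by norm_num [IExpr.cost]) fun _ h => h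
    by_cases h : s'.idx 7 = 0
    · simpa [readProfile, IExpr.eval, h, FindsStrongNash] using h2 h
    · simpa [readProfile, IExpr.eval, h, FindsStrongNash, profileOf] using h1 h
  refine (Spec.seq (T' := 3 + (genericCheckCost m₁ m₂ + (3 + (1 + T))) + 2)
    ((Spec.pureSearch hm₁ hm₂ hinit).imp ?_)).mono ?_ fun _ h => h
  · rintro s₁ ⟨⟨e₁, -, h₁⟩, h₂⟩
    refine Spec.seq ((Spec.branch (T := genericCheckCost m₁ m₂ + (3 + (1 + T)))
      (T' := genericCheckCost m₁ m₂ + (3 + (1 + T))) (fun h => ?_) (fun h => ?_)).mono ?_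
      fun _ h => h)
    · refine (Spec.skip (hread s₁ h₁ fun h' => ?_)).mono ?_ fun _ h => h
      · simp [h'] at h
      · exact le_add_left ((by norm_num : (1 : ℕ∞) ≤ 3).trans le_self_add)
    · replace h : s₁.idx 7 = 0 := by simpa using h
      refine Spec.seq ((Spec.genericCheck e₁).frame.imp ?_)
      rintro s₂ ⟨g₂, i₂, a₂⟩
      have hi : ∀ k, k ∉ [2, 3, 4, 5, 6] → s₂.idx k = s₁.idx k := fun k hk => i₂ k (by
        simp only [RealRAM.genericCheck, RealRAM.forAllPairs, Program.ModIdx, modIdx_forLoop]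
        simp only [List.mem_cons, List.not_mem_nil] at hk
        tauto)
      have ha : s₂.arr = s₁.arr := funext fun a => a₂ a (by
        simp [RealRAM.genericCheck, RealRAM.forAllPairs, Program.ModArr, modArr_forLoop])
      have e₂ : Encodes U s₂ := e₁.of_eq (hi 0 (by simp)) (hi 1 (by simp)) (by rw [ha]) (by rw [ha])
      have h7 : s₂.idx 7 = 0 := by rw [hi 7 (by simp), h]
      refine (Spec.branch (T := 1 + T) (T' := 1 + T) (fun h' => ?_) (fun h' => ?_)).mono ?_
        fun _ h => h
      · have hg : U.IsGeneric := g₂.1 (by simpa [Nat.pos_iff_ne_zero] using h')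
        refine (Spec.skip (hread s₂ (fun h => absurd h7 h) fun _ => ?_)).mono le_self_add
          fun _ h => h
        -- In a generic game an equilibrium would be pure, and the pure search has already failed.
        rintro ⟨x, hx⟩
        obtain ⟨a, b, rfl⟩ := hg.exists_eq_single hx
        refine h₂ h a a.2 b b.2 ?_
        convert hx using 1
        refine Prod.ext (funext fun k => ?_) (funext fun k => ?_) <;>
          simp [pureProfile, Pi.single_apply, Fin.ext_iff]
      · have hg : ¬ U.IsGeneric := (not_congr g₂).1 (by simpa [Nat.pos_iff_ne_zero] using h')
        rw [hT hg, add_top]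
        exact (Spec.exhaustiveSearch hm₁ hm₂ e₂ h7).imp fun s' h => hread s' h.1 h.2
      · norm_num [Test.cost, IExpr.cost]
    · norm_num [Test.cost, IExpr.cost]
  · apply le_of_eq
    rw [strongNashCost]
    ring

theorem time_le_of_run {c : Program} {s s' : State} {t : ℕ} (h : Run c s t s') : time c s ≤ t :=
  iInf_le_of_le t (iInf_le_of_le s' (iInf_le_of_le h le_rfl))

theorem strongNashProgram_correct {m₁ m₂ : ℕ} (hm₁ : 1 ≤ m₁) (hm₂ : 1 ≤ m₂)
    (U : BimatrixGame m₁ m₂) : ∃ (t : ℕ) (s : State), Run strongNashProgram (initial U) t s ∧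
      FindsStrongNash m₁ m₂ U (readProfile m₁ m₂ s) := by
  obtain ⟨t, s, hr, -, h⟩ := Spec.strongNashProgram hm₁ hm₂ U ⊤ fun _ => rfl
  exact ⟨t, s, hr, h⟩

open scoped ENNReal in
theorem exists_expected_time_le : ∃ p : MvPolynomial (Fin 2) ℕ,
    ∀ m₁ m₂ : ℕ, 1 ≤ m₁ → 1 ≤ m₂ → ∀ (U : BimatrixGame m₁ m₂) (σ : ℝ), 0 < σ →
      ∫⁻ ω, time strongNashProgram (initial (U + ω)) ∂(uniformNoise m₁ m₂ σ) ≤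
        ((MvPolynomial.eval ![m₁, m₂] p : ℕ) : ℝ≥0∞) := by
  obtain ⟨p, hp⟩ : IsPolynomialCost strongNashCost :=
    IsPolynomialCost.pureSearchCost.add (((IsPolynomialCost.ofNat 3).add
      (IsPolynomialCost.genericCheckCost.add (IsPolynomialCost.ofNat 4))).add
      (IsPolynomialCost.ofNat 2))
  refine ⟨p, fun m₁ m₂ hm₁ hm₂ U σ hσ => ?_⟩
  have := isProbabilityMeasure_cond_Icc hσ
  have hprob : IsProbabilityMeasure (uniformNoise m₁ m₂ σ) :=
    inferInstanceAs (IsProbabilityMeasure (Measure.pi _))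
  calc ∫⁻ ω, time strongNashProgram (initial (U + ω)) ∂(uniformNoise m₁ m₂ σ)
      ≤ ∫⁻ _, ((MvPolynomial.eval ![m₁, m₂] p : ℕ) : ℝ≥0∞) ∂(uniformNoise m₁ m₂ σ) := by
        -- An almost sure pointwise bound is enough here, and it needs no measurability of the
        -- running time.
        refine lintegral_mono_ae ((BimatrixGame.ae_isGeneric hσ U).mono fun ω hω => ?_)
        obtain ⟨t, s, hr, ht, -⟩ := Spec.strongNashProgram hm₁ hm₂ (U + ω) 0 fun h => absurd hω h
        refine (time_le_of_run hr).trans ?_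
        rw [add_zero, hp, Nat.cast_le] at ht
        exact_mod_cast ht
    _ = _ := by simp

end RealRAM

theorem mainTheorem5 :
    InSmoothedP RealRAM.readProfile FindsStrongNash ∧
      InSmoothedP RealRAM.readBool DecidesStrongNash := by
  -- One program serves both problems: register `0`, which tells whether a profile is returned, is
  -- the answer to the decision problem.
  refine ⟨⟨RealRAM.strongNashProgram, fun m₁ m₂ h₁ h₂ U =>
      RealRAM.strongNashProgram_correct h₁ h₂ U, RealRAM.exists_expected_time_le⟩,
    ⟨RealRAM.strongNashProgram, fun m₁ m₂ h₁ h₂ U => ?_, RealRAM.exists_expected_time_le⟩⟩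
  obtain ⟨t, s, hr, h⟩ := RealRAM.strongNashProgram_correct h₁ h₂ U
  refine ⟨t, s, hr, ?_⟩
  by_cases h0 : s.idx 0 = 0
  · simpa [DecidesStrongNash, FindsStrongNash, RealRAM.readBool, RealRAM.readProfile, h0] using h
  · simp only [FindsStrongNash, RealRAM.readProfile, ne_eq, h0, not_false_eq_true, if_true] at h
    have hex : ∃ x, U.IsStrongNash x := ⟨_, h⟩
    simpa only [DecidesStrongNash, RealRAM.readBool, ne_eq, h0, not_false_eq_true, decide_true,
      true_iff] using hex
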